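/- Setting. Let $G$ be a (smooth, real) Lie group of dimension $4$ with Lie algebra $\mathfrak g$, and let $\mathfrak g=\mathfrak u+\mathfrak g_0$ be a vector space decomposition into a line $\mathfrak u$ and a $3$-dimensional ideal $\mathfrak g_0$ which, as a Lie algebra, is unimodular ($\operatorname{tr}\operatorname{ad}_x=0$ for all $x\in\mathfrak g_0$) and non-abelian. Definitions. For a three-form $H$ and a two-form $F$ on an $n$-manifold $M$ with $dF=0$ and $dH=-F\wedge F$, let $E_{H,F}=TM\oplus T^*M\oplus\mathbb R$ with anchor the projection to $TM$, scalar product $\langle X+\xi+\lambda,Y+\eta+\mu\rangle=\tfrac12(\eta(X)+\xi(Y))+\lambda\mu$ and Dorfman bracket $$[X+\xi+\lambda,Y+\eta+\mu]=\mathcal L_XY+\mathcal L_X\eta-i_Yd\xi+2\mu\,d\lambda+i_Xi_YH-2(\mu\, i_XF-\lambda\, i_YF)+X(\mu)-Y(\lambda)+F(X,Y).$$ A generalized metric is an orthogonal decomposition $E=E_+\oplus E_-$ such that the anchor maps $E_-$ isomorphically onto $TM$; $\mathcal G^{\mathrm{end}}$ is $\pm\mathrm{Id}$ on $E_\pm$.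 A $B_n$-generalized complex structure is a $\langle\cdot,\cdot\rangle$-skew-symmetric $\mathcal F\in\Gamma(\operatorname{End}E)$ with $\mathcal F u_0=0$ and $\mathcal F^2=-\mathrm{Id}+(-1)^n\langle\cdot,u_0\rangle u_0$ for some $u_0$ with $\langle u_0,u_0\rangle=(-1)^n$, such that the sections of the $i$-eigenbundle of $\mathcal F$ in $E_{\mathbb C}$ are closed under the Dorfman bracket. A $B_n$-generalized pseudo-Kähler structure is a pair $(\mathcal G,\mathcal F)$ such that $\mathcal G^{\mathrm{end}}\mathcal F=\mathcal F\mathcal G^{\mathrm{end}}$ and $\mathcal F$, $\mathcal G^{\mathrm{end}}\mathcal F$ are $B_n$-generalized complex structures. For $n$ even and $E_-=\{X-i_Xg\}$, with $g$ a pseudo-Riemannian metric, its components $(g,J_+,J_-,X_+,X_-,c_+)$ are defined by $\mathcal F(X-i_Xg)=J_-X-i_{J_-X}g$, by $\mathcal F(X+i_Xg)=J_+X+i_{J_+X}g-g(X_-,X)$, $\mathcal F(1)=X_-+i_{X_-}g$, and by a generator $u_+=X_++i_{X_+}g+c_+$ of $\ker\mathcal F$ with $\langle u_+,u_+\rangle=1$.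 On $G$ the structure is left-invariant if $H,F$ and the components are left-invariant; these are then regarded as tensors on $\mathfrak g$. It is adapted if $\mathfrak u\perp_g\mathfrak g_0$; the canonical operator $L$ of $(\mathfrak g_0,g|_{\mathfrak g_0\times\mathfrak g_0})$, defined up to sign by $[x,y]=L(x\times y)$, is diagonalizable over $\mathbb R$; $J_-(\mathfrak u)$ is contained in an eigenspace of $L$; and $\mathfrak u$ and $X_\pm$ are non-null. Call a basis $\{u,e_1,e_2,e_3\}$ of $\mathfrak g$ special for a bilinear form $g$ on $\mathfrak g$ if $u\in\mathfrak u$, $e_1,e_2,e_3\in\mathfrak g_0$, it is $g$-orthonormal with $g(u,u)=g(e_1,e_1)=\epsilon_1\in\{\pm1\}$ and $g(e_2,e_2)=g(e_3,e_3)=\epsilon_2=\epsilon_3\in\{\pm1\}$, and for some $\lambda\in\mathbb R\setminus\{0\}$, $\beta\in\mathbb R$, $$[e_1,e_2]=\epsilon_3\lambda e_3,\quad [e_2,e_3]=0,\quad [e_3,e_1]=\epsilon_2\lambda e_2,\quad [u,e_1]=0,\quad [u,e_2]=\beta e_3,\quad [u,e_3]=-\beta e_2.$$ Proposition. (1) For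 every bilinear form $g$ on $\mathfrak g$: there is an adapted left-invariant $B_4$-generalized pseudo-Kähler structure on some left-invariant $E_{H,F}$ over $G$, with metric component $g$ and with $c_+\neq0$, if and only if $\mathfrak g$ has a special basis for $g$. (2) Tensors $H\in\Lambda^3\mathfrak g^*$, $F\in\Lambda^2\mathfrak g^*$ and $(g,J_+,J_-,X_+,X_-,c_+)$ on $\mathfrak g$ are the twisting forms and the components of an adapted left-invariant $B_4$-generalized pseudo-Kähler structure with $c_+\ne0$ if and only if $H=0$, $F=0$, $c_+\in\mathbb R\setminus\{-1,0,1\}$ and there is a special basis $\{u,e_1,e_2,e_3\}$ for $g$ such that $X_+=au+be_1$, $X_-=\tilde au+\tilde be_1$ with $a,b,\tilde a,\tilde b\in\mathbb R$, $$\epsilon_1(a^2+b^2)=\epsilon_1(\tilde a^2+\tilde b^2)=1-c_+^2,\qquad a\tilde a+b\tilde b=0,$$ $J_-u=e_1$, $J_-e_1=-u$, $J_-e_2=e_3$, $J_-e_3=-e_2$, $J_+X_+=-c_+X_-$, $J_+X_-=c_+X_+$, and $J_+$ restricts to a $g$-skew-symmetric complex structure on $\mathrm{span}\{e_2,e_3\}$.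 -/

import Mathlib

open scoped Manifold ContDiff

noncomputable section

namespace BnGeometry

section Manifold

variable {n : ℕ} {M : Type*} [TopologicalSpace M] [ChartedSpace (EuclideanSpace ℝ (Fin n)) M]
  [IsManifold (𝓡 n) ∞ M]

/-- The tangent space of an `n`-dimensional manifold. -/
abbrev Tan (n : ℕ) {M : Type*} [TopologicalSpace M]
    [ChartedSpace (EuclideanSpace ℝ (Fin n)) M] (p : M) : Type :=
  TangentSpace (𝓡 n) p

/-- The fibre at `p` of `E = TM ⊕ T*M ⊕ ℝ`; an element is a triple `(X, ξ, l)`. -/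
abbrev Fiber (n : ℕ) {M : Type*} [TopologicalSpace M]
    [ChartedSpace (EuclideanSpace ℝ (Fin n)) M] (p : M) : Type :=
  Tan n p × Module.Dual ℝ (Tan n p) × ℝ

/-- The scalar product `⟨X + ξ + l, Y + η + m⟩ = (η(X) + ξ(Y)) / 2 + l m` on `E`. -/
def pairing {p : M} (u v : Fiber n p) : ℝ :=
  (1 / 2) * (v.2.1 u.1 + u.2.1 v.1) + u.2.2 * v.2.2

/-- Smooth real functions. -/
def SmoothFunction (n : ℕ) {M : Type*} [TopologicalSpace M]
    [ChartedSpace (EuclideanSpace ℝ (Fin n)) M] (f : M → ℝ) : Prop :=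
  ContMDiff (𝓡 n) 𝓘(ℝ) ∞ f

/-- Smooth vector fields. -/
def SmoothField (X : (p : M) → Tan n p) : Prop :=
  ContMDiff (𝓡 n) (𝓡 n).tangent ∞ (fun p => (⟨p, X p⟩ : TangentBundle (𝓡 n) M))

/-- The derivative `X(f)` of a function along a vector field. -/
def dirDeriv (X : (p : M) → Tan n p) (f : M → ℝ) (p : M) : ℝ :=
  (mfderiv (𝓡 n) 𝓘(ℝ) f p : Tan n p →L[ℝ] ℝ) (X p)

/-- The Lie bracket of vector fields. -/
abbrev vfBracket (X Y : (p : M) → Tan n p) : (p : M) → Tan n p :=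
  VectorField.mlieBracket (𝓡 n) X Y

/-- Smooth sections of `E`; a one-form is smooth if it is smooth on smooth vector fields. -/
structure SmoothSection (s : (p : M) → Fiber n p) : Prop where
  vec : SmoothField (fun p => (s p).1)
  form : ∀ Z : (p : M) → Tan n p, SmoothField Z → SmoothFunction n (fun p => (s p).2.1 (Z p))
  fn : SmoothFunction n (fun p => (s p).2.2)

/-- `(H, F)` are the twisting forms of a Courant algebroid `E_{H,F}` of type `B_n`: a smooth
three-form and a smooth two-form with `dF = 0` and `dH = - F ∧ F`.  The exterior derivatives are
written out by the invariant formula, on all smooth vector fields, and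
`(F ∧ F)(X,Y,Z,W) = 2 (F(X,Y) F(Z,W) - F(X,Z) F(Y,W) + F(X,W) F(Y,Z))`. -/
structure IsTwist (H : (p : M) → (Tan n p) [⋀^Fin 3]→ₗ[ℝ] ℝ)
    (F : (p : M) → (Tan n p) [⋀^Fin 2]→ₗ[ℝ] ℝ) : Prop where
  smooth_H : ∀ X Y Z : (p : M) → Tan n p, SmoothField X → SmoothField Y → SmoothField Z →
    SmoothFunction n (fun p => H p ![X p, Y p, Z p])
  smooth_F : ∀ X Y : (p : M) → Tan n p, SmoothField X → SmoothField Y →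
    SmoothFunction n (fun p => F p ![X p, Y p])
  d_F : ∀ X Y Z : (p : M) → Tan n p, SmoothField X → SmoothField Y → SmoothField Z → ∀ p,
    dirDeriv X (fun q => F q ![Y q, Z q]) p - dirDeriv Y (fun q => F q ![X q, Z q]) p
      + dirDeriv Z (fun q => F q ![X q, Y q]) p
      - F p ![vfBracket X Y p, Z p] + F p ![vfBracket X Z p, Y p] - F p ![vfBracket Y Z p, X p] = 0
  d_H : ∀ X Y Z W : (p : M) → Tan n p,
    SmoothField X → SmoothField Y → SmoothField Z → SmoothField W → ∀ p,
    dirDeriv X (fun q => H q ![Y q, Z q, W q]) p - dirDeriv Y (fun q => H q ![X q, Z q, W q]) p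
      + dirDeriv Z (fun q => H q ![X q, Y q, W q]) p - dirDeriv W (fun q => H q ![X q, Y q, Z q]) p
      - H p ![vfBracket X Y p, Z p, W p] + H p ![vfBracket X Z p, Y p, W p] - H p ![vfBracket X W p, Y p, Z p]
      - H p ![vfBracket Y Z p, X p, W p] + H p ![vfBracket Y W p, X p, Z p] - H p ![vfBracket Z W p, X p, Y p]
    = - (2 * (F p ![X p, Y p] * F p ![Z p, W p] - F p ![X p, Z p] * F p ![Y p, W p]
        + F p ![X p, W p] * F p ![Y p, Z p]))

/-- `w` is the Dorfman bracket `[u, v]`, twisted by `(H, F)`, of the sections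
`u = X + ξ + l` and `v = Y + η + m`, that is
`w = [X,Y] + L_X η - i_Y dξ + 2 m dl + i_X i_Y H - 2 (m i_X F - l i_Y F) + X(m) - Y(l) + F(X,Y)`.
The one-form is given through its values on the smooth vector fields `Z`, by
`(L_X η)(Z) = X(η(Z)) - η([X,Z])` and `dξ(Y,Z) = Y(ξ(Z)) - Z(ξ(Y)) - ξ([Y,Z])`. -/
structure IsDorfman (H : (p : M) → (Tan n p) [⋀^Fin 3]→ₗ[ℝ] ℝ)
    (F : (p : M) → (Tan n p) [⋀^Fin 2]→ₗ[ℝ] ℝ) (u v w : (p : M) → Fiber n p) : Prop where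
  vec : ∀ p, (w p).1 = vfBracket (fun q => (u q).1) (fun q => (v q).1) p
  form : ∀ Z : (p : M) → Tan n p, SmoothField Z → ∀ p,
    (w p).2.1 (Z p) =
      (dirDeriv (fun q => (u q).1) (fun q => (v q).2.1 (Z q)) p
        - (v p).2.1 (vfBracket (fun q => (u q).1) Z p))
      - (dirDeriv (fun q => (v q).1) (fun q => (u q).2.1 (Z q)) p
        - dirDeriv Z (fun q => (u q).2.1 (v q).1) p
        - (u p).2.1 (vfBracket (fun q => (v q).1) Z p))
      + 2 * (v p).2.2 * dirDeriv Z (fun q => (u q).2.2) p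
      + H p ![(v p).1, (u p).1, Z p]
      - 2 * ((v p).2.2 * F p ![(u p).1, Z p] - (u p).2.2 * F p ![(v p).1, Z p])
  fn : ∀ p, (w p).2.2 =
    dirDeriv (fun q => (u q).1) (fun q => (v q).2.2) p
      - dirDeriv (fun q => (v q).1) (fun q => (u q).2.2) p + F p ![(u p).1, (v p).1]

/-- A field of endomorphisms of `E` is smooth if it maps smooth sections to smooth sections. -/
def SmoothEnd (A : (p : M) → Module.End ℝ (Fiber n p)) : Prop :=
  ∀ s : (p : M) → Fiber n p, SmoothSection s → SmoothSection (fun p => A p (s p))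

/-- An (admissible) generalized metric, given by the endomorphism `G` of `E` that is `± 1` on
`E_±`; here `E_-` is the `(-1)`-eigenbundle, mapped isomorphically to `TM` by the anchor, and
`E_+` is the orthogonal complement of `E_-`. -/
structure IsGeneralizedMetric (G : (p : M) → Module.End ℝ (Fiber n p)) : Prop where
  smooth : SmoothEnd G
  involutive : ∀ (p : M) (u : Fiber n p), G p (G p u) = u
  symmetric : ∀ (p : M) (u v : Fiber n p), pairing (G p u) v = pairing u (G p v)
  admissible : ∀ p : M, Function.Bijective (fun u : {u : Fiber n p // G p u = -u} => u.1.1)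

/-- A `B_n`-generalized almost complex structure, as an endomorphism `A` of `E`: it is
skew-symmetric, vanishes on some `u₀` with `⟨u₀, u₀⟩ = (-1)^n`, and satisfies
`A² = - Id + (-1)^n ⟨·, u₀⟩ u₀`. -/
structure IsBnAlmostComplex (A : (p : M) → Module.End ℝ (Fiber n p)) : Prop where
  smooth : SmoothEnd A
  skew : ∀ (p : M) (u v : Fiber n p), pairing (A p u) v = - pairing u (A p v)
  square : ∀ p : M, ∃ u₀ : Fiber n p, pairing u₀ u₀ = (-1) ^ n ∧ A p u₀ = 0 ∧
    ∀ u, A p (A p u) = - u + ((-1) ^ n * pairing u u₀) • u₀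

/-- The complex section `s + i t` of the complexification of `E` is a smooth section of the
`i`-eigenbundle `L` of `A`. -/
structure IsSectionOfL (A : (p : M) → Module.End ℝ (Fiber n p))
    (s t : (p : M) → Fiber n p) : Prop where
  smooth_re : SmoothSection s
  smooth_im : SmoothSection t
  re : ∀ p, A p (s p) = - t p
  im : ∀ p, A p (t p) = s p

/-- Integrability of `A`: the smooth sections of its `i`-eigenbundle `L` are closed under the
complex bilinear extension
`[s + i t, s' + i t'] = ([s,s'] - [t,t']) + i ([s,t'] + [t,s'])` of the Dorfman bracket
(the bracket of smooth sections exists, is unique and smooth). -/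
def IsIntegrable (H : (p : M) → (Tan n p) [⋀^Fin 3]→ₗ[ℝ] ℝ)
    (F : (p : M) → (Tan n p) [⋀^Fin 2]→ₗ[ℝ] ℝ)
    (A : (p : M) → Module.End ℝ (Fiber n p)) : Prop :=
  ∀ s t s' t' : (p : M) → Fiber n p, IsSectionOfL A s t → IsSectionOfL A s' t' →
    ∃ ss tt st ts : (p : M) → Fiber n p,
      IsDorfman H F s s' ss ∧ IsDorfman H F t t' tt ∧
      IsDorfman H F s t' st ∧ IsDorfman H F t s' ts ∧
      ∀ p, A p (ss p - tt p) = - (st p + ts p) ∧ A p (st p + ts p) = ss p - tt p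

/-- `(G, A)` is a `B_n`-generalized pseudo-Kähler structure on `E_{H,F}`. -/
structure IsPseudoKahler (H : (p : M) → (Tan n p) [⋀^Fin 3]→ₗ[ℝ] ℝ)
    (F : (p : M) → (Tan n p) [⋀^Fin 2]→ₗ[ℝ] ℝ)
    (G A : (p : M) → Module.End ℝ (Fiber n p)) : Prop where
  metric : IsGeneralizedMetric G
  commute : ∀ p, G p * A p = A p * G p
  almost_complex : IsBnAlmostComplex A
  integrable : IsIntegrable H F A
  almost_complex₂ : IsBnAlmostComplex (fun p => G p * A p)
  integrable₂ : IsIntegrable H F (fun p => G p * A p)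

/-- `(g, J₊, J₋, X₊, X₋, c₊)` are the components of `(G, A)`, for even `n` and a generalized metric
in the standard form `E_- = {X - i_X g}`, `E_+ = {X + i_X g + a}`.  Here `g(X,Y) = - ⟨sX, sY⟩` with
`sX = X - i_X g`; under `E_- ≅ TM` the endomorphism `A` becomes `J₋`; the vector
`u₊ = X₊ + i_{X₊} g + c₊` is a unit generator of `ker A`; under `E_+ ≅ TM ⊕ ℝ` the endomorphism `A`
becomes the block matrix with rows `(J₊, X₋)` and `(- i_{X₋} g, 0)`. -/
structure IsComponents (G A : (p : M) → Module.End ℝ (Fiber n p))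
    (g : (p : M) → LinearMap.BilinForm ℝ (Tan n p)) (Jp Jm : (p : M) → Module.End ℝ (Tan n p))
    (Xp Xm : (p : M) → Tan n p) (c : M → ℝ) : Prop where
  standard : ∀ (p : M) (X : Tan n p),
    G p (X, - g p X, 0) = - ((X, - g p X, 0) : Fiber n p)
  metric : ∀ (p : M) (X Y : Tan n p),
    g p X Y = - pairing ((X, - g p X, 0) : Fiber n p) ((Y, - g p Y, 0) : Fiber n p)
  minus : ∀ (p : M) (X : Tan n p), A p (X, - g p X, 0) = (Jm p X, - g p (Jm p X), 0)
  unit : ∀ p : M, pairing ((Xp p, g p (Xp p), c p) : Fiber n p) (Xp p, g p (Xp p), c p) = 1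
  kernel : ∀ p : M, A p (Xp p, g p (Xp p), c p) = 0
  plus : ∀ (p : M) (X : Tan n p), A p (X, g p X, 0) = (Jp p X, g p (Jp p X), - g p (Xm p) X)
  plus_one : ∀ p : M, A p (0, 0, 1) = (Xm p, g p (Xm p), 0)

end Manifold

section LieGroup

variable {n : ℕ} {G : Type*} [TopologicalSpace G] [ChartedSpace (EuclideanSpace ℝ (Fin n)) G]
  [Group G]

/-- The Lie algebra of a smooth Lie group is defined in Mathlib for `C^3` Lie groups. -/
instance instLieGroupMinSmoothness [h : LieGroup (𝓡 n) ∞ G] :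
    LieGroup (𝓡 n) (minSmoothness ℝ 3) G := by
  rw [minSmoothness_of_isRCLikeNormedField]
  infer_instance

/-- The left translation `𝔤 = T_1 G → T_p G`. -/
def fromLie (p : G) : GroupLieAlgebra (𝓡 n) G →ₗ[ℝ] Tan n p :=
  (mfderiv (𝓡 n) (𝓡 n) (fun x : G => p * x) 1).toLinearMap

/-- The left translation `T_p G → T_1 G = 𝔤`. -/
def toLie (p : G) : Tan n p →ₗ[ℝ] GroupLieAlgebra (𝓡 n) G :=
  (mfderiv (𝓡 n) (𝓡 n) (fun x : G => p⁻¹ * x) p).toLinearMap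

/-- The left-invariant form with value `w` at `1`. -/
def leftForm {k : ℕ} (w : (GroupLieAlgebra (𝓡 n) G) [⋀^Fin k]→ₗ[ℝ] ℝ) (p : G) :
    (Tan n p) [⋀^Fin k]→ₗ[ℝ] ℝ :=
  w.compLinearMap (toLie p)

/-- The left-invariant bilinear form with value `g` at `1`. -/
def leftBilin (g : LinearMap.BilinForm ℝ (GroupLieAlgebra (𝓡 n) G)) (p : G) :
    LinearMap.BilinForm ℝ (Tan n p) :=
  g.compl₁₂ (toLie p) (toLie p)

/-- The left-invariant field of endomorphisms with value `J` at `1`. -/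
def leftEnd (J : Module.End ℝ (GroupLieAlgebra (𝓡 n) G)) (p : G) : Module.End ℝ (Tan n p) :=
  fromLie p ∘ₗ J ∘ₗ toLie p

/-- The left-invariant vector field with value `X` at `1`. -/
def leftField (X : GroupLieAlgebra (𝓡 n) G) (p : G) : Tan n p :=
  fromLie p X

end LieGroup

section LieAlgebra

/-- `v` is a `g`-orthonormal family with signs `δ i = g(v i, v i) = ± 1`. -/
def IsOrthonormalFamily {ι V : Type*} [AddCommGroup V] [Module ℝ V]
    (g : LinearMap.BilinForm ℝ V) (v : ι → V) (δ : ι → ℝ) : Prop :=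
  (∀ i, δ i = 1 ∨ δ i = -1) ∧ (∀ i, g (v i) (v i) = δ i) ∧ ∀ i j, i ≠ j → g (v i) (v j) = 0

variable {𝔤 : Type*} [LieRing 𝔤] [LieAlgebra ℝ 𝔤]

/-- `trace (ad x) = 0` for all `x`. -/
def IsUnimodular (𝔥 : Type*) [LieRing 𝔥] [LieAlgebra ℝ 𝔥] : Prop :=
  ∀ x : 𝔥, LinearMap.trace ℝ 𝔥 (LieAlgebra.ad ℝ 𝔥 x) = 0

/-- `L` is the canonical operator (unique up to sign) of a three-dimensional Lie algebra `𝔥` with a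
scalar product `g`: `[x, y] = L (x × y)`.  The cross product is the one of an orientation: it is
determined by `g(x × y, z) = vol(x, y, z)`, where `vol` is the volume form that is `1` on an
oriented `g`-orthonormal basis `v`. -/
def IsCanonicalOperator {𝔥 : Type*} [LieRing 𝔥] [LieAlgebra ℝ 𝔥]
    (g : LinearMap.BilinForm ℝ 𝔥) (L : Module.End ℝ 𝔥) : Prop :=
  ∃ (v : Module.Basis (Fin 3) ℝ 𝔥) (δ : Fin 3 → ℝ) (cross : 𝔥 →ₗ[ℝ] 𝔥 →ₗ[ℝ] 𝔥),
    IsOrthonormalFamily g v δ ∧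
    (∀ x y z, g (cross x y) z = v.det ![x, y, z]) ∧
    ∀ x y, ⁅x, y⁆ = L (cross x y)

/-- There is a basis of eigenvectors. -/
def IsDiagonalizable {V : Type*} [AddCommGroup V] [Module ℝ V] (L : Module.End ℝ V) : Prop :=
  ∃ (ι : Type) (b : Module.Basis ι ℝ V), ∀ i, ∃ r : ℝ, L (b i) = r • b i

/-- The restriction of a bilinear form to an ideal. -/
def restrictTo (𝔤₀ : LieIdeal ℝ 𝔤) (g : LinearMap.BilinForm ℝ 𝔤) : LinearMap.BilinForm ℝ 𝔤₀ :=
  g.compl₁₂ 𝔤₀.toSubmodule.subtype 𝔤₀.toSubmodule.subtype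

/-- The conditions on the components that make a left-invariant structure adapted to the
decomposition `𝔤 = 𝔲 + 𝔤₀`: it is `g`-orthogonal, the canonical operator `L` of
`(𝔤₀, g|𝔤₀)` is diagonalizable, `J₋(𝔲)` lies in an eigenspace of `L`, and `𝔲`, `X₊`, `X₋` are
non-null. -/
structure IsAdapted (𝔲 : Submodule ℝ 𝔤) (𝔤₀ : LieIdeal ℝ 𝔤) (g : LinearMap.BilinForm ℝ 𝔤)
    (Jm : Module.End ℝ 𝔤) (Xp Xm : 𝔤) : Prop where
  orthogonal : ∀ x ∈ 𝔲, ∀ y ∈ 𝔤₀, g x y = 0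
  canonical : ∃ L : Module.End ℝ 𝔤₀, IsCanonicalOperator (restrictTo 𝔤₀ g) L ∧
    IsDiagonalizable L ∧ ∃ r : ℝ, ∀ x ∈ 𝔲, ∃ z : 𝔤₀, (z : 𝔤) = Jm x ∧ L z = r • z
  non_null : ∀ x ∈ 𝔲, x ≠ 0 → g x x ≠ 0
  non_null_plus : g Xp Xp ≠ 0
  non_null_minus : g Xm Xm ≠ 0

/-- `b = {u, e₁, e₂, e₃}` is a `g`-orthonormal basis of `𝔤` with `u ∈ 𝔲` and `eᵢ ∈ 𝔤₀`, with signs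
`g(u,u) = g(e₁,e₁) = ε₁` and `g(e₂,e₂) = g(e₃,e₃) = ε₂`, in which the only non-zero brackets are
`[e₁,e₂] = ε₂ l e₃`, `[e₃,e₁] = ε₂ l e₂`, `[u,e₂] = β e₃`, `[u,e₃] = -β e₂`, up to
skew-symmetry; `l ≠ 0`. -/
structure IsSpecialBasis (𝔲 : Submodule ℝ 𝔤) (𝔤₀ : LieIdeal ℝ 𝔤) (g : LinearMap.BilinForm ℝ 𝔤)
    (b : Module.Basis (Fin 4) ℝ 𝔤) (ε₁ ε₂ l β : ℝ) : Prop where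
  mem_u : b 0 ∈ 𝔲
  mem_e₁ : b 1 ∈ 𝔤₀
  mem_e₂ : b 2 ∈ 𝔤₀
  mem_e₃ : b 3 ∈ 𝔤₀
  orthonormal : IsOrthonormalFamily g b ![ε₁, ε₁, ε₂, ε₂]
  l_ne_zero : l ≠ 0
  e₁_e₂ : ⁅b 1, b 2⁆ = (ε₂ * l) • b 3
  e₂_e₃ : ⁅b 2, b 3⁆ = 0
  e₃_e₁ : ⁅b 3, b 1⁆ = (ε₂ * l) • b 2
  u_e₁ : ⁅b 0, b 1⁆ = 0
  u_e₂ : ⁅b 0, b 2⁆ = β • b 3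
  u_e₃ : ⁅b 0, b 3⁆ = -(β • b 2)

end LieAlgebra

section Adapted

variable {n : ℕ} {G : Type*} [TopologicalSpace G] [ChartedSpace (EuclideanSpace ℝ (Fin n)) G]
  [Group G] [LieGroup (𝓡 n) ∞ G]

/-- The left-invariant tensor fields on `G` that extend `H`, `F` define a Courant algebroid
`E_{H,F}` of type `B_n`, and there is an adapted left-invariant `B_n`-generalized pseudo-Kähler
structure on it whose components are the left-invariant extensions of
`(g, J₊, J₋, X₊, X₋, c₊)`. -/
structure IsAdaptedPseudoKahler (𝔲 : Submodule ℝ (GroupLieAlgebra (𝓡 n) G))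
    (𝔤₀ : LieIdeal ℝ (GroupLieAlgebra (𝓡 n) G))
    (H : (GroupLieAlgebra (𝓡 n) G) [⋀^Fin 3]→ₗ[ℝ] ℝ)
    (F : (GroupLieAlgebra (𝓡 n) G) [⋀^Fin 2]→ₗ[ℝ] ℝ)
    (g : LinearMap.BilinForm ℝ (GroupLieAlgebra (𝓡 n) G))
    (Jp Jm : Module.End ℝ (GroupLieAlgebra (𝓡 n) G))
    (Xp Xm : GroupLieAlgebra (𝓡 n) G) (c : ℝ) : Prop where
  twist : IsTwist (n := n) (M := G) (leftForm H) (leftForm F)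
  pseudoKahler : ∃ Gend A : (p : G) → Module.End ℝ (Fiber n p),
    IsPseudoKahler (leftForm H) (leftForm F) Gend A ∧
    IsComponents Gend A (leftBilin g) (leftEnd Jp) (leftEnd Jm) (leftField Xp) (leftField Xm)
      (fun _ => c)
  adapted : IsAdapted 𝔲 𝔤₀ g Jm Xp Xm

end Adapted

end BnGeometry

end

open BnGeometry

open scoped Manifold ContDiff

noncomputable section

namespace BnGeometry

/-! ### Left translations on the Lie group and smoothness of left-invariant fields. -/

section LieGroup

variable {n : ℕ} {G : Type*} [TopologicalSpace G] [ChartedSpace (EuclideanSpace ℝ (Fin n)) G]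
  [Group G]

variable [LieGroup (𝓡 n) ∞ G]

/-! In the left trivialisation a section of `E` is a function from `G` to the fixed space `Model 𝔤`,
and the Dorfman bracket of constant functions is algebraic. The theorem thereby becomes a statement
about tensors on `𝔤`.

Necessity. The endomorphisms `𝓕` and `𝓖𝓕` agree on `E₊` and are opposite on `E₋`, so sums and
differences of their integrability conditions on left-invariant sections isolate the mixed
components of the bracket. Let `∇^±` be the metric connections with `g(∇^±_x y, z) = g(∇_x y, z) ±
H(x,y,z)/2`, where `∇` is the Levi-Civita connection. The outcome (`TensorIdentities`) is that `J₋`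
is `∇⁺`-parallel, `F` is of type (1,1) for `J₋` and has `X₊` in its kernel, `g(∇⁻_x X₊, z) = c
F(x,z)` and `g(∇⁻_x X₋, z) = F(x, J₊ z)`.

Take a unit vector `u` of `𝔲` and a frame `u, J₋u, w, J₋w`. As `J₋u` is an eigenvector of the
canonical operator, `[w, J₋w]` is a multiple of `J₋u`. Unimodularity makes the rest of the operator
a symmetric matrix on the definite plane of `w, J₋w`, so `w` can be turned until the brackets of the
ideal are diagonal, with entries `p, q, r` (`IsAdaptedNormal.exists_hermitianFrame`). The equation
`∇⁺J₋ = 0` then determines `H` and gives four relations between the structure constants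
(`IsHermitianFrame.torsion`).

What makes the structure rigid is that `X₊` and `X₋` are orthogonal and non-null, hence not
proportional. If `p ≠ 0` or `q ≠ r`, the equations for `∇⁻X₊` and `∇⁻X₋` force them to be
proportional, or else contradict injectivity of `J₊`. In the remaining case `p = 0`, `q = r ≠ 0`,
the form `F` is degenerate, so `F ∧ F = 0` and `dH = 0`, which kills the trace part of `ad u`. Then
`F = 0`, both vectors are `∇⁻`-parallel, the last unwanted constants vanish and so does `H`
(`IsHermitianFrame.rigid`).

Sufficiency. In a special basis `[z,w] = α(z) K w - α(w) K z`, where `K` is the rotation of the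
plane of `e₂, e₃`. Hence `∇_x = α(x) K` is metric and torsion-free, and all components are parallel
because `K` commutes with `J₊`, `J₋` and annihilates `X₊`, `X₋`. For `H = F = 0` the Dorfman bracket
is expressed through `∇` alone, and a parallel skew-symmetric endomorphism is integrable
(`isIntegrable_of_parallel`). -/

lemma smoothField_leftField (v : GroupLieAlgebra (𝓡 n) G) :
    SmoothField (leftField v : (p : G) → Tan n p) := by
  -- The field is the tangent map of the multiplication applied to the zero vector at `g` and the
  -- fixed vector `v` at `1`, a composition of smooth maps.
  let fg : G → TangentBundle (𝓡 n) G := fun g ↦ Bundle.TotalSpace.mk' (EuclideanSpace ℝ (Fin n)) g 0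
  have sfg : ContMDiff (𝓡 n) (𝓡 n).tangent ∞ fg :=
    Bundle.contMDiff_zeroSection ℝ (TangentSpace (𝓡 n) : G → Type _)
  let fv : G → TangentBundle (𝓡 n) G := fun _ ↦ Bundle.TotalSpace.mk' (EuclideanSpace ℝ (Fin n)) 1 v
  have sfv : ContMDiff (𝓡 n) (𝓡 n).tangent ∞ fv := contMDiff_const
  let F₁ : G → (TangentBundle (𝓡 n) G × TangentBundle (𝓡 n) G) := fun g ↦ (fg g, fv g)
  have S₁ : ContMDiff (𝓡 n) ((𝓡 n).tangent.prod (𝓡 n).tangent) ∞ F₁ := sfg.prodMk sfv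
  let F₂ : (TangentBundle (𝓡 n) G × TangentBundle (𝓡 n) G) →
      TangentBundle ((𝓡 n).prod (𝓡 n)) (G × G) := (equivTangentBundleProd (𝓡 n) G (𝓡 n) G).symm
  have S₂ : ContMDiff ((𝓡 n).tangent.prod (𝓡 n).tangent) ((𝓡 n).prod (𝓡 n)).tangent ∞ F₂ :=
    contMDiff_equivTangentBundleProd_symm
  let F₃ : TangentBundle ((𝓡 n).prod (𝓡 n)) (G × G) → TangentBundle (𝓡 n) G :=
    tangentMap ((𝓡 n).prod (𝓡 n)) (𝓡 n) (fun (p : G × G) ↦ p.1 * p.2)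
  have S₃ : ContMDiff ((𝓡 n).prod (𝓡 n)).tangent (𝓡 n).tangent ∞ F₃ := by
    apply ContMDiff.contMDiff_tangentMap _ (m := ∞) le_rfl
    exact contMDiff_mul (𝓡 n) ∞
  let S := (S₃.comp S₂).comp S₁
  unfold SmoothField
  convert! S with g
  · simp [F₁, F₂, F₃, fg, fv]
  · simp only [Function.comp_apply, tangentMap, F₃, F₂, F₁, fg, fv]
    rw [mfderiv_prod_eq_add_apply ((contMDiff_mul (𝓡 n) ∞).mdifferentiableAt (by simp))]
    have aux (L : EuclideanSpace ℝ (Fin n) →L[ℝ] EuclideanSpace ℝ (Fin n))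
        (w : EuclideanSpace ℝ (Fin n)) : w = L 0 + w := by simp
    exact aux _ _

lemma mdifferentiableAt_mul_left' (p q : G) :
    MDifferentiableAt (𝓡 n) (𝓡 n) (fun x : G => p * x) q :=
  (contMDiff_mul_left (n := ∞)).contMDiffAt.mdifferentiableAt (by simp)

lemma toLie_fromLie (p : G) (v : GroupLieAlgebra (𝓡 n) G) : toLie p (fromLie p v) = v := by
  have h : mfderiv (𝓡 n) (𝓡 n) ((fun x : G => p⁻¹ * x) ∘ (fun x : G => p * x)) 1
      = ContinuousLinearMap.id _ _ := by
    have : (fun x : G => p⁻¹ * x) ∘ (fun x : G => p * x) = id := by ext x; simp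
    rw [this]; exact mfderiv_id
  rw [mfderiv_comp (I' := 𝓡 n) _ (mdifferentiableAt_mul_left' _ _)
    (mdifferentiableAt_mul_left' _ _)] at h
  have h' := DFunLike.congr_fun h v
  -- The chain rule places the outer derivative at `p * 1`, while `toLie p` is the derivative at
  -- `p`.
  have e : p * 1 = p := mul_one p
  simp only [toLie, fromLie]
  rw [ContinuousLinearMap.comp_apply] at h'
  erw [e] at h'
  exact h'

lemma fromLie_toLie (p : G) (v : Tan n p) : fromLie p (toLie p v) = v := by
  have h : mfderiv (𝓡 n) (𝓡 n) ((fun x : G => p * x) ∘ (fun x : G => p⁻¹ * x)) p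
      = ContinuousLinearMap.id _ _ := by
    have : (fun x : G => p * x) ∘ (fun x : G => p⁻¹ * x) = id := by ext x; simp
    rw [this]; exact mfderiv_id
  rw [mfderiv_comp (I' := 𝓡 n) _ (mdifferentiableAt_mul_left' _ _)
    (mdifferentiableAt_mul_left' _ _)] at h
  have h' := DFunLike.congr_fun h v
  have e : p⁻¹ * p = 1 := inv_mul_cancel p
  simp only [toLie, fromLie]
  rw [ContinuousLinearMap.comp_apply] at h'
  erw [e] at h'
  exact h'

lemma vfBracket_leftField (X Y : GroupLieAlgebra (𝓡 n) G) :
    vfBracket (leftField X : (p : G) → Tan n p) (leftField Y) = leftField ⁅X, Y⁆ :=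
  (mulInvariantVector_mlieBracket X Y).symm

/-- As for left-invariant fields, with the tangent map of the multiplication applied to the zero
vector at `g⁻¹` and `X g`. -/
lemma smooth_toLie {X : (p : G) → Tan n p} (hX : SmoothField X) :
    ContMDiff (𝓡 n) (𝓡 n).tangent ∞ (fun p : G =>
      (⟨1, toLie p (X p)⟩ : TangentBundle (𝓡 n) G)) := by
  let fg : G → TangentBundle (𝓡 n) G := fun g ↦
    Bundle.TotalSpace.mk' (EuclideanSpace ℝ (Fin n)) g⁻¹ 0
  have sfg : ContMDiff (𝓡 n) (𝓡 n).tangent ∞ fg :=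
    (Bundle.contMDiff_zeroSection ℝ (TangentSpace (𝓡 n) : G → Type _)).comp (contMDiff_inv (𝓡 n) ∞)
  let F₁ : G → (TangentBundle (𝓡 n) G × TangentBundle (𝓡 n) G) := fun g ↦ (fg g, ⟨g, X g⟩)
  have S₁ : ContMDiff (𝓡 n) ((𝓡 n).tangent.prod (𝓡 n).tangent) ∞ F₁ := sfg.prodMk hX
  let F₂ : (TangentBundle (𝓡 n) G × TangentBundle (𝓡 n) G) →
      TangentBundle ((𝓡 n).prod (𝓡 n)) (G × G) := (equivTangentBundleProd (𝓡 n) G (𝓡 n) G).symm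
  have S₂ : ContMDiff ((𝓡 n).tangent.prod (𝓡 n).tangent) ((𝓡 n).prod (𝓡 n)).tangent ∞ F₂ :=
    contMDiff_equivTangentBundleProd_symm
  let F₃ : TangentBundle ((𝓡 n).prod (𝓡 n)) (G × G) → TangentBundle (𝓡 n) G :=
    tangentMap ((𝓡 n).prod (𝓡 n)) (𝓡 n) (fun (p : G × G) ↦ p.1 * p.2)
  have S₃ : ContMDiff ((𝓡 n).prod (𝓡 n)).tangent (𝓡 n).tangent ∞ F₃ := by
    apply ContMDiff.contMDiff_tangentMap _ (m := ∞) le_rfl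
    exact contMDiff_mul (𝓡 n) ∞
  let S := (S₃.comp S₂).comp S₁
  convert! S with g
  · simp [F₁, F₂, F₃, fg]
  · simp only [Function.comp_apply, tangentMap, F₃, F₂, F₁, fg]
    rw [mfderiv_prod_eq_add_apply ((contMDiff_mul (𝓡 n) ∞).mdifferentiableAt (by simp))]
    have aux (L : EuclideanSpace ℝ (Fin n) →L[ℝ] EuclideanSpace ℝ (Fin n))
        (w : EuclideanSpace ℝ (Fin n)) : w = L 0 + w := by simp
    exact aux _ _

/-- All vectors `toLie p (X p)` lie in the single fibre over `1`, so the trivialisation of the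
tangent bundle there turns smoothness in the bundle into smoothness in the model space. -/
lemma smoothFunction_toLie {X : (p : G) → Tan n p} (hX : SmoothField X)
    (φ : Module.Dual ℝ (GroupLieAlgebra (𝓡 n) G)) :
    SmoothFunction n (fun p : G => φ (toLie p (X p))) := by
  have h := smooth_toLie hX
  let e := trivializationAt (EuclideanSpace ℝ (Fin n)) (TangentSpace (𝓡 n) : G → Type _) (1 : G)
  have he : (1 : G) ∈ e.baseSet := FiberBundle.mem_baseSet_trivializationAt' 1
  let ψ : EuclideanSpace ℝ (Fin n) →ₗ[ℝ] ℝ := φ ∘ₗ (e.symmL ℝ (1 : G)).toLinearMap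
  intro p
  have h1 := (Bundle.contMDiffAt_totalSpace.1 (h p)).2
  have h2 : ContMDiffAt (𝓡 n) 𝓘(ℝ) ∞ (fun p : G =>
      (LinearMap.toContinuousLinearMap ψ) ((e ⟨1, toLie p (X p)⟩).2)) p :=
    (LinearMap.toContinuousLinearMap ψ).contMDiff.contMDiffAt.comp p h1
  convert h2 using 2 with q
  simp only [ψ, LinearMap.coe_toContinuousLinearMap', LinearMap.comp_apply]
  have := e.symmL_continuousLinearMapAt (R := ℝ) he (toLie q (X q))
  rw [e.continuousLinearMapAt_apply_of_mem ℝ he] at this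
  exact congrArg φ this.symm

end LieGroup

/-! ### Differential calculus of functions with values in a finite-dimensional vector space. -/

section Derivative

variable {n : ℕ} {M : Type*} [TopologicalSpace M] [ChartedSpace (EuclideanSpace ℝ (Fin n)) M]

/-- The differential of a real function. -/
def differential (n : ℕ) {M : Type*} [TopologicalSpace M]
    [ChartedSpace (EuclideanSpace ℝ (Fin n)) M] (f : M → ℝ) (p : M) : Tan n p →ₗ[ℝ] ℝ :=
  (mfderiv (𝓡 n) 𝓘(ℝ) f p : Tan n p →L[ℝ] ℝ).toLinearMap

lemma dirDeriv_eq (X : (p : M) → Tan n p) (f : M → ℝ) (p : M) :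
    dirDeriv X f p = differential n f p (X p) := rfl

lemma SmoothFunction.mdifferentiableAt {f : M → ℝ} (hf : SmoothFunction n f) (p : M) :
    MDifferentiableAt (𝓡 n) 𝓘(ℝ) f p :=
  (hf p).mdifferentiableAt (by simp)

lemma differential_const (c : ℝ) (p : M) : differential n (fun _ : M => c) p = 0 := by
  ext z
  simp only [differential, mfderiv_const]
  rfl

lemma differential_add {f g : M → ℝ} (hf : SmoothFunction n f) (hg : SmoothFunction n g) (p : M) :
    differential n (fun q => f q + g q) p = differential n f p + differential n g p := by
  have := mfderiv_add (hf.mdifferentiableAt p) (hg.mdifferentiableAt p)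
  ext z
  exact DFunLike.congr_fun this z

lemma differential_mul {f g : M → ℝ} (hf : SmoothFunction n f) (hg : SmoothFunction n g) (p : M) :
    differential n (fun q => f q * g q) p
      = f p • differential n g p + g p • differential n f p := by
  have := ((hf.mdifferentiableAt p).hasMFDerivAt.mul (hg.mdifferentiableAt p).hasMFDerivAt).mfderiv
  ext z
  exact DFunLike.congr_fun this z

lemma SmoothFunction.const (c : ℝ) : SmoothFunction n (fun _ : M => c) := contMDiff_const

lemma SmoothFunction.add {f g : M → ℝ} (hf : SmoothFunction n f) (hg : SmoothFunction n g) :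
    SmoothFunction n (fun q => f q + g q) := ContMDiff.add hf hg

lemma SmoothFunction.mul {f g : M → ℝ} (hf : SmoothFunction n f) (hg : SmoothFunction n g) :
    SmoothFunction n (fun q => f q * g q) := ContMDiff.mul hf hg

lemma SmoothFunction.sum {ι : Type*} {s : Finset ι} {f : ι → M → ℝ}
    (hf : ∀ i ∈ s, SmoothFunction n (f i)) : SmoothFunction n (fun q => ∑ i ∈ s, f i q) := by
  classical
  induction s using Finset.induction_on with
  | empty => simpa using SmoothFunction.const 0
  | insert a s ha ih =>
    simp only [Finset.sum_insert ha]
    exact (hf a (by simp)).add (ih fun i hi => hf i (by simp [hi]))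

lemma differential_sum {ι : Type*} {s : Finset ι} {f : ι → M → ℝ}
    (hf : ∀ i ∈ s, SmoothFunction n (f i)) (p : M) :
    differential n (fun q => ∑ i ∈ s, f i q) p = ∑ i ∈ s, differential n (f i) p := by
  classical
  induction s using Finset.induction_on with
  | empty => simpa using differential_const 0 p
  | insert a s ha ih =>
    simp only [Finset.sum_insert ha]
    rw [differential_add (hf a (by simp)) (SmoothFunction.sum fun i hi => hf i (by simp [hi])),
      ih fun i hi => hf i (by simp [hi])]

/-- Smooth maps to a finite-dimensional vector space, tested on linear functionals. -/
def WeaklySmooth (n : ℕ) {M : Type*} [TopologicalSpace M]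
    [ChartedSpace (EuclideanSpace ℝ (Fin n)) M] {W : Type*} [AddCommGroup W] [Module ℝ W]
    (σ : M → W) : Prop :=
  ∀ φ : Module.Dual ℝ W, SmoothFunction n (fun p => φ (σ p))

variable {W W' : Type*} [AddCommGroup W] [Module ℝ W] [AddCommGroup W'] [Module ℝ W']

lemma WeaklySmooth.comp {σ : M → W} (hσ : WeaklySmooth n σ) (A : W →ₗ[ℝ] W') :
    WeaklySmooth n (fun p => A (σ p)) := fun φ => hσ (φ ∘ₗ A)

lemma map_eq_sum_coord {ι : Type*} [Fintype ι] (b : Module.Basis ι ℝ W) (A : W →ₗ[ℝ] W') (w : W) :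
    A w = ∑ i, b.coord i w • A (b i) := by
  conv_lhs => rw [← b.sum_repr w, map_sum]
  simp only [map_smul, Module.Basis.coord_apply]

variable [Module.Finite ℝ W] [Module.Finite ℝ W']

/-- The differential of a map to a finite-dimensional vector space. -/
def vectorDifferential (n : ℕ) {M : Type*} [TopologicalSpace M]
    [ChartedSpace (EuclideanSpace ℝ (Fin n)) M] {W : Type*} [AddCommGroup W] [Module ℝ W]
    [Module.Finite ℝ W] (σ : M → W) (p : M) : Tan n p →ₗ[ℝ] W :=
  ∑ i, (differential n (fun q => (Module.finBasis ℝ W).coord i (σ q)) p).smulRight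
    (Module.finBasis ℝ W i)

/-- This characterises `vectorDifferential` without the auxiliary basis; equalities of vector-valued
derivatives are then tested on linear functionals. -/
lemma dual_vectorDifferential {σ : M → W} (hσ : WeaklySmooth n σ) (φ : Module.Dual ℝ W) (p : M)
    (z : Tan n p) : φ (vectorDifferential n σ p z) = differential n (fun q => φ (σ q)) p z := by
  have h : (fun q => φ (σ q)) = fun q => ∑ i,
      φ (Module.finBasis ℝ W i) * (Module.finBasis ℝ W).coord i (σ q) := by
    ext q
    rw [map_eq_sum_coord (Module.finBasis ℝ W) φ (σ q)]
    simp only [smul_eq_mul, mul_comm]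
  rw [h, differential_sum fun i _ => (SmoothFunction.const _).mul (hσ _)]
  simp only [vectorDifferential, LinearMap.sum_apply, map_sum, LinearMap.smulRight_apply, map_smul]
  refine Finset.sum_congr rfl fun i _ => ?_
  rw [differential_mul (SmoothFunction.const _) (hσ _), differential_const]
  simp [mul_comm]

lemma vectorDifferential_comp {σ : M → W} (hσ : WeaklySmooth n σ) (A : W →ₗ[ℝ] W') (p : M)
    (z : Tan n p) :
    vectorDifferential n (fun q => A (σ q)) p z = A (vectorDifferential n σ p z) := by
  rw [← sub_eq_zero, ← Module.forall_dual_apply_eq_zero_iff ℝ]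
  intro φ
  rw [map_sub, dual_vectorDifferential (hσ.comp A), sub_eq_zero]
  exact (dual_vectorDifferential hσ (φ ∘ₗ A) p z).symm

lemma WeaklySmooth.bilin {σ : M → W} {τ : M → W'} (hσ : WeaklySmooth n σ) (hτ : WeaklySmooth n τ)
    (B : W →ₗ[ℝ] W' →ₗ[ℝ] ℝ) : SmoothFunction n (fun q => B (σ q) (τ q)) := by
  have h : (fun q => B (σ q) (τ q)) = fun q => ∑ i,
      (Module.finBasis ℝ W).coord i (σ q) * B (Module.finBasis ℝ W i) (τ q) := by
    ext q
    rw [map_eq_sum_coord (Module.finBasis ℝ W) B (σ q)]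
    simp only [LinearMap.sum_apply, LinearMap.smul_apply, smul_eq_mul]
  rw [h]
  exact SmoothFunction.sum fun i _ => (hσ _).mul (hτ _)

lemma differential_bilin {σ : M → W} {τ : M → W'} (hσ : WeaklySmooth n σ) (hτ : WeaklySmooth n τ)
    (B : W →ₗ[ℝ] W' →ₗ[ℝ] ℝ) (p : M) (z : Tan n p) :
    differential n (fun q => B (σ q) (τ q)) p z
      = B (vectorDifferential n σ p z) (τ p) + B (σ p) (vectorDifferential n τ p z) := by
  have h : (fun q => B (σ q) (τ q)) = fun q => ∑ i,
      (Module.finBasis ℝ W).coord i (σ q) * B (Module.finBasis ℝ W i) (τ q) := by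
    ext q
    rw [map_eq_sum_coord (Module.finBasis ℝ W) B (σ q)]
    simp only [LinearMap.sum_apply, LinearMap.smul_apply, smul_eq_mul]
  have h2 : B (σ p) = ∑ i, (Module.finBasis ℝ W).coord i (σ p) • B (Module.finBasis ℝ W i) :=
    map_eq_sum_coord _ B _
  have h3 : B (vectorDifferential n σ p z) = ∑ i,
      differential n (fun q => (Module.finBasis ℝ W).coord i (σ q)) p z •
        B (Module.finBasis ℝ W i) := by
    simp only [vectorDifferential, LinearMap.sum_apply, map_sum, LinearMap.smulRight_apply,
      map_smul]
  rw [h, h2, h3, differential_sum fun i _ => (hσ _).mul (hτ _)]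
  simp only [LinearMap.sum_apply, LinearMap.smul_apply, smul_eq_mul, ← Finset.sum_add_distrib]
  refine Finset.sum_congr rfl fun i _ => ?_
  rw [differential_mul (hσ _) (hτ _), LinearMap.add_apply, LinearMap.smul_apply,
    LinearMap.smul_apply, dual_vectorDifferential hτ, smul_eq_mul, smul_eq_mul]
  ring

end Derivative

/-! ### Vector fields as functions with values in the Lie algebra. -/

section Bracket

variable {n : ℕ} {G : Type*} [TopologicalSpace G] [ChartedSpace (EuclideanSpace ℝ (Fin n)) G]
  [Group G] [LieGroup (𝓡 n) ∞ G]

instance : Module.Finite ℝ (GroupLieAlgebra (𝓡 n) G) :=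
  inferInstanceAs (Module.Finite ℝ (EuclideanSpace ℝ (Fin n)))

lemma SmoothField.mdifferentiableAt {X : (p : G) → Tan n p} (hX : SmoothField X) (p : G) :
    MDifferentiableAt (𝓡 n) (𝓡 n).tangent (fun p => (⟨p, X p⟩ : TangentBundle (𝓡 n) G)) p :=
  (hX p).mdifferentiableAt (by simp)

lemma SmoothField.weaklySmooth {X : (p : G) → Tan n p} (hX : SmoothField X) :
    WeaklySmooth n (fun p : G => toLie p (X p)) := smoothFunction_toLie hX

lemma SmoothField.smul {X : (p : G) → Tan n p} (hX : SmoothField X) {f : G → ℝ}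
    (hf : SmoothFunction n f) : SmoothField (f • X) := ContMDiff.smul_section hf hX

lemma SmoothField.sum {ι : Type*} {s : Finset ι} {X : ι → (p : G) → Tan n p}
    (hX : ∀ i ∈ s, SmoothField (X i)) : SmoothField (fun p => ∑ i ∈ s, X i p) :=
  ContMDiff.sum_section hX

/-- The Leibniz rule, used to reduce brackets of arbitrary fields to brackets with the
left-invariant frame. -/
lemma vfBracket_sum_right {ι : Type*} {s : Finset ι} {X : (p : G) → Tan n p} {f : ι → G → ℝ}
    {V : ι → (p : G) → Tan n p} (hf : ∀ i ∈ s, SmoothFunction n (f i))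
    (hV : ∀ i ∈ s, SmoothField (V i)) (p : G) :
    vfBracket X (∑ i ∈ s, f i • V i) p
      = ∑ i ∈ s, (differential n (f i) p (X p) • V i p + f i p • vfBracket X (V i) p) := by
  classical
  induction s using Finset.induction_on with
  | empty => simp
  | insert a s ha ih =>
    have h1 : SmoothField (∑ i ∈ s, f i • V i) := by
      have := SmoothField.sum (s := s) (X := fun i => f i • V i) fun i hi =>
        (hV i (by simp [hi])).smul (hf i (by simp [hi]))
      convert! this using 3
      simp
    rw [Finset.sum_insert ha, Finset.sum_insert ha, ← ih (fun i hi => hf i (by simp [hi]))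
      fun i hi => hV i (by simp [hi])]
    rw [vfBracket, VectorField.mlieBracket_add_right
      (((hV a (by simp)).smul (hf a (by simp))).mdifferentiableAt p) (h1.mdifferentiableAt p),
      VectorField.mlieBracket_smul_right ((hf a (by simp)).mdifferentiableAt p)
        ((hV a (by simp)).mdifferentiableAt p)]
    rfl

lemma field_eq_sum {ι : Type*} [Fintype ι] (b : Module.Basis ι ℝ (GroupLieAlgebra (𝓡 n) G))
    (X : (p : G) → Tan n p) :
    X = ∑ i, (fun p => b.coord i (toLie p (X p))) • (leftField (b i) : (p : G) → Tan n p) := by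
  ext1 p
  conv_lhs => rw [← fromLie_toLie p (X p), ← b.sum_repr (toLie p (X p)), map_sum]
  simp [leftField]

lemma smoothField_of_weaklySmooth {X : (p : G) → Tan n p}
    (hX : WeaklySmooth n (fun p : G => toLie p (X p))) : SmoothField X := by
  rw [field_eq_sum (Module.finBasis ℝ (GroupLieAlgebra (𝓡 n) G)) X]
  have := SmoothField.sum (s := Finset.univ) fun i _ =>
    (smoothField_leftField (Module.finBasis ℝ (GroupLieAlgebra (𝓡 n) G) i)).smul
      (hX ((Module.finBasis ℝ (GroupLieAlgebra (𝓡 n) G)).coord i))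
  convert! this using 3
  simp

/-- Expand `X` in a left-invariant frame: the brackets of the frame give the Lie bracket of `𝔤`, the
derivatives of the coefficients give the differential. -/
lemma toLie_vfBracket_leftField {X : (p : G) → Tan n p} (hX : SmoothField X)
    (y : GroupLieAlgebra (𝓡 n) G) (p : G) :
    toLie p (vfBracket (leftField y) X p)
      = ⁅y, toLie p (X p)⁆ + vectorDifferential n (fun q => toLie q (X q)) p (fromLie p y) := by
  set b := Module.finBasis ℝ (GroupLieAlgebra (𝓡 n) G)
  conv_lhs => rw [field_eq_sum b X]
  rw [vfBracket_sum_right (fun i _ => smoothFunction_toLie hX _) fun i _ => smoothField_leftField _,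
    Finset.sum_add_distrib, map_add, add_comm]
  congr 1
  · conv_rhs => rw [← b.sum_repr (toLie p (X p))]
    simp only [vfBracket_leftField, map_sum, map_smul, leftField, toLie_fromLie, lie_sum, lie_smul]
    rfl
  · simp only [vectorDifferential, map_sum, map_smul, leftField, toLie_fromLie,
      LinearMap.sum_apply, LinearMap.smulRight_apply]
    rfl

/-- Expand `Y` in a left-invariant frame; antisymmetry then leads back to the case in which one
field is left-invariant. -/
lemma toLie_vfBracket {X Y : (p : G) → Tan n p} (hX : SmoothField X) (hY : SmoothField Y) (p : G) :
    toLie p (vfBracket X Y p) = ⁅toLie p (X p), toLie p (Y p)⁆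
      + vectorDifferential n (fun q => toLie q (Y q)) p (X p)
      - vectorDifferential n (fun q => toLie q (X q)) p (Y p) := by
  set b := Module.finBasis ℝ (GroupLieAlgebra (𝓡 n) G)
  conv_lhs => rw [field_eq_sum b Y]
  rw [vfBracket_sum_right (fun i _ => smoothFunction_toLie hY _) fun i _ => smoothField_leftField _,
    Finset.sum_add_distrib, map_add]
  have h1 : toLie p (∑ i, differential n (fun p => b.coord i (toLie p (Y p))) p (X p) •
      leftField (b i) p) = vectorDifferential n (fun q => toLie q (Y q)) p (X p) := by
    simp only [vectorDifferential, map_sum, map_smul, leftField, toLie_fromLie,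
      LinearMap.sum_apply, LinearMap.smulRight_apply]
    rfl
  have h2 : ∀ i, toLie p (vfBracket X (leftField (b i)) p) = ⁅toLie p (X p), b i⁆
      - vectorDifferential n (fun q => toLie q (X q)) p (fromLie p (b i)) := by
    intro i
    rw [vfBracket, VectorField.mlieBracket_swap_apply, map_neg, toLie_vfBracket_leftField hX,
      ← lie_skew]
    abel
  have h3 : Y p = ∑ i, b.coord i (toLie p (Y p)) • fromLie p (b i) := by
    conv_lhs => rw [← fromLie_toLie p (Y p), ← b.sum_repr (toLie p (Y p)), map_sum]
    simp
  rw [h1]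
  simp only [map_sum, map_smul, h2, smul_sub, Finset.sum_sub_distrib]
  conv_rhs => rw [h3]
  simp only [map_sum, map_smul, toLie_fromLie, lie_sum, lie_smul]
  abel

end Bracket

/-! ### The model fibre and the Dorfman bracket of left-invariant sections. -/

section Algebra

/-- The model fibre `V ⊕ V* ⊕ ℝ`. -/
abbrev Model (V : Type*) [AddCommGroup V] [Module ℝ V] : Type _ := V × Module.Dual ℝ V × ℝ

/-- The scalar product of the model fibre. -/
def modelPairing (V : Type*) [AddCommGroup V] [Module ℝ V] : LinearMap.BilinForm ℝ (Model V) :=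
  LinearMap.mk₂ ℝ (fun u v => (1 / 2) * (v.2.1 u.1 + u.2.1 v.1) + u.2.2 * v.2.2)
    (fun u u' v => by simp; ring) (fun c u v => by simp; ring)
    (fun u v v' => by simp; ring) (fun c u v => by simp; ring)

variable {V : Type*} [AddCommGroup V] [Module ℝ V]

lemma modelPairing_apply (u v : Model V) :
    modelPairing V u v = (1 / 2) * (v.2.1 u.1 + u.2.1 v.1) + u.2.2 * v.2.2 := rfl

/-- Contraction of a two-form with a vector. -/
def contractTwo (F : V [⋀^Fin 2]→ₗ[ℝ] ℝ) (x : V) : Module.Dual ℝ V :=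
  F.toMultilinearMap.toLinearMap ![x, 0] 1

@[simp] lemma contractTwo_apply (F : V [⋀^Fin 2]→ₗ[ℝ] ℝ) (x y : V) :
    contractTwo F x y = F ![x, y] := by
  simp only [contractTwo, MultilinearMap.toLinearMap_apply, AlternatingMap.coe_multilinearMap]
  congr 1; ext i; fin_cases i <;> simp

/-- Contraction of a three-form with two vectors. -/
def contractThree (H : V [⋀^Fin 3]→ₗ[ℝ] ℝ) (x y : V) : Module.Dual ℝ V :=
  H.toMultilinearMap.toLinearMap ![x, y, 0] 2

@[simp] lemma contractThree_apply (H : V [⋀^Fin 3]→ₗ[ℝ] ℝ) (x y z : V) :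
    contractThree H x y z = H ![x, y, z] := by
  simp only [contractThree, MultilinearMap.toLinearMap_apply, AlternatingMap.coe_multilinearMap]
  congr 1; ext i; fin_cases i <;> simp

variable {𝔤 : Type*} [LieRing 𝔤] [LieAlgebra ℝ 𝔤]

/-- The Dorfman bracket of left-invariant sections. -/
def lieDorfman (H : 𝔤 [⋀^Fin 3]→ₗ[ℝ] ℝ) (F : 𝔤 [⋀^Fin 2]→ₗ[ℝ] ℝ) (u v : Model 𝔤) : Model 𝔤 :=
  (⁅u.1, v.1⁆,
    -(v.2.1 ∘ₗ (LieAlgebra.ad ℝ 𝔤 u.1)) + u.2.1 ∘ₗ (LieAlgebra.ad ℝ 𝔤 v.1)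
      + contractThree H v.1 u.1
      - (2 : ℝ) • (v.2.2 • contractTwo F u.1 - u.2.2 • contractTwo F v.1),
    F ![u.1, v.1])

end Algebra

/-! ### The Dorfman bracket in the left trivialisation of `E`. -/

section Trivialisation

variable {n : ℕ} {G : Type*} [TopologicalSpace G] [ChartedSpace (EuclideanSpace ℝ (Fin n)) G]
  [Group G] [LieGroup (𝓡 n) ∞ G]

/-- The left trivialisation of `E`. -/
def trivialise (p : G) : Fiber n p ≃ₗ[ℝ] Model (GroupLieAlgebra (𝓡 n) G) where
  toFun u := (toLie p u.1, u.2.1 ∘ₗ fromLie p, u.2.2)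
  invFun u := (fromLie p u.1, u.2.1 ∘ₗ toLie p, u.2.2)
  map_add' u v := by ext <;> simp
  map_smul' c v := by ext <;> simp
  left_inv u := by
    refine Prod.ext (fromLie_toLie p _) (Prod.ext ?_ rfl)
    ext z; exact congrArg u.2.1 (fromLie_toLie p z)
  right_inv u := by
    refine Prod.ext (toLie_fromLie p _) (Prod.ext ?_ rfl)
    ext z; exact congrArg u.2.1 (toLie_fromLie p z)

lemma trivialise_apply (p : G) (u : Fiber n p) :
    trivialise p u = (toLie p u.1, u.2.1 ∘ₗ fromLie p, u.2.2) := rfl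

lemma trivialise_symm_apply (p : G) (u : Model (GroupLieAlgebra (𝓡 n) G)) :
    (trivialise p).symm u = (fromLie p u.1, u.2.1 ∘ₗ toLie p, u.2.2) := rfl

lemma modelPairing_trivialise (p : G) (u v : Fiber n p) :
    modelPairing _ (trivialise p u) (trivialise p v) = pairing u v := by
  simp only [modelPairing_apply, trivialise_apply, pairing, LinearMap.comp_apply, fromLie_toLie]

lemma pairing_trivialise_symm (p : G) (u v : Model (GroupLieAlgebra (𝓡 n) G)) :
    pairing ((trivialise p).symm u) ((trivialise p).symm v) = modelPairing _ u v := by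
  rw [← modelPairing_trivialise, LinearEquiv.apply_symm_apply, LinearEquiv.apply_symm_apply]

instance : Module.Finite ℝ (Model (GroupLieAlgebra (𝓡 n) G)) := inferInstance

lemma smoothSection_iff (s : (p : G) → Fiber n p) :
    SmoothSection s ↔ WeaklySmooth n (fun p => trivialise p (s p)) := by
  constructor
  · intro h φ
    let φ₁ := φ ∘ₗ LinearMap.inl ℝ _ _
    let φ₂ := φ ∘ₗ LinearMap.inr ℝ _ _ ∘ₗ LinearMap.inl ℝ _ _
    -- The part of `φ` that acts on one-forms is evaluation at a vector `z`, because `𝔤` is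
    -- finite-dimensional; testing the one-form on the left-invariant field of `z` gives smoothness.
    obtain ⟨z, hz⟩ := (Module.evalEquiv ℝ (GroupLieAlgebra (𝓡 n) G)).surjective φ₂
    have h1 : (fun p : G => φ (trivialise p (s p))) = fun p =>
        (φ₁ (toLie p (s p).1) + (s p).2.1 (leftField z p)) + (s p).2.2 * φ (0, 0, 1) := by
      ext p
      have h2 : trivialise p (s p) = LinearMap.inl ℝ _ _ (toLie p (s p).1)
          + (LinearMap.inr ℝ (GroupLieAlgebra (𝓡 n) G) _ (LinearMap.inl ℝ _ ℝ
            ((s p).2.1 ∘ₗ fromLie p))) + (s p).2.2 • (0, 0, 1) := by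
        rw [trivialise_apply]
        ext <;> simp
      rw [h2, map_add, map_add, map_smul, smul_eq_mul]
      have h3 : φ₂ ((s p).2.1 ∘ₗ fromLie p) = (s p).2.1 (leftField z p) := by
        rw [← hz]; rfl
      rw [← h3]; rfl
    rw [h1]
    exact (((smoothFunction_toLie h.vec φ₁).add (h.form _ (smoothField_leftField z))).add
      (h.fn.mul (SmoothFunction.const _)))
  · intro h
    refine ⟨?_, ?_, ?_⟩
    · exact smoothField_of_weaklySmooth (h.comp (LinearMap.fst ℝ _ _))
    · intro Z hZ
      have h1 := (h.comp (LinearMap.fst ℝ _ _ ∘ₗ LinearMap.snd ℝ _ _)).bilin hZ.weaklySmooth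
        LinearMap.id
      convert h1 using 2 with p
      simp [trivialise_apply, fromLie_toLie]
    · exact h (LinearMap.snd ℝ _ _ ∘ₗ LinearMap.snd ℝ _ _)

/-- The Dorfman bracket of smooth sections in the left trivialisation. -/
def trivialDorfman (H : (GroupLieAlgebra (𝓡 n) G) [⋀^Fin 3]→ₗ[ℝ] ℝ)
    (F : (GroupLieAlgebra (𝓡 n) G) [⋀^Fin 2]→ₗ[ℝ] ℝ)
    (σ τ : G → Model (GroupLieAlgebra (𝓡 n) G)) (p : G) : Model (GroupLieAlgebra (𝓡 n) G) :=
  lieDorfman H F (σ p) (τ p) + vectorDifferential n τ p (fromLie p (σ p).1)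
    - vectorDifferential n σ p (fromLie p (τ p).1)
    + (0, (2 : ℝ) • ((modelPairing _).flip (τ p) ∘ₗ vectorDifferential n σ p ∘ₗ fromLie p), 0)

lemma leftForm_two (F : (GroupLieAlgebra (𝓡 n) G) [⋀^Fin 2]→ₗ[ℝ] ℝ) (p : G) (x y : Tan n p) :
    leftForm F p ![x, y] = F ![toLie p x, toLie p y] := by
  simp only [leftForm, AlternatingMap.compLinearMap_apply]
  congr 1; ext i; fin_cases i <;> rfl

lemma leftForm_three (H : (GroupLieAlgebra (𝓡 n) G) [⋀^Fin 3]→ₗ[ℝ] ℝ) (p : G) (x y z : Tan n p) :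
    leftForm H p ![x, y, z] = H ![toLie p x, toLie p y, toLie p z] := by
  simp only [leftForm, AlternatingMap.compLinearMap_apply]
  congr 1; ext i; fin_cases i <;> rfl

/-- The product rule splits every derivative of a contraction. The derivatives of the test field `Z`
coming from `X(η(Z))` and from `[X,Z]` cancel, and likewise for `ξ`, so the result is tensorial in
`Z`. -/
lemma isDorfman_trivialDorfman (H : (GroupLieAlgebra (𝓡 n) G) [⋀^Fin 3]→ₗ[ℝ] ℝ)
    (F : (GroupLieAlgebra (𝓡 n) G) [⋀^Fin 2]→ₗ[ℝ] ℝ)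
    {u v : (p : G) → Fiber n p} (hu : SmoothSection u) (hv : SmoothSection v) :
    IsDorfman (leftForm H) (leftForm F) u v (fun p => (trivialise p).symm
      (trivialDorfman H F (fun q => trivialise q (u q)) (fun q => trivialise q (v q)) p)) := by
  set σ := fun q => trivialise q (u q) with hσ_def
  set τ := fun q => trivialise q (v q) with hτ_def
  have hσ : WeaklySmooth n σ := (smoothSection_iff u).1 hu
  have hτ : WeaklySmooth n τ := (smoothSection_iff v).1 hv
  let π₁ : Model (GroupLieAlgebra (𝓡 n) G) →ₗ[ℝ] GroupLieAlgebra (𝓡 n) G := LinearMap.fst ℝ _ _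
  let π₂ : Model (GroupLieAlgebra (𝓡 n) G) →ₗ[ℝ] Module.Dual ℝ (GroupLieAlgebra (𝓡 n) G) :=
    LinearMap.fst ℝ _ _ ∘ₗ LinearMap.snd ℝ _ _
  let π₃ : Model (GroupLieAlgebra (𝓡 n) G) →ₗ[ℝ] ℝ := LinearMap.snd ℝ _ _ ∘ₗ LinearMap.snd ℝ _ _
  have hσ₁ : ∀ p (z : Tan n p), vectorDifferential n (fun q => toLie q (u q).1) p z
      = (vectorDifferential n σ p z).1 := fun p z => vectorDifferential_comp hσ π₁ p z
  have hτ₁ : ∀ p (z : Tan n p), vectorDifferential n (fun q => toLie q (v q).1) p z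
      = (vectorDifferential n τ p z).1 := fun p z => vectorDifferential_comp hτ π₁ p z
  have hσ₃ : ∀ p (z : Tan n p), differential n (fun q => (u q).2.2) p z
      = (vectorDifferential n σ p z).2.2 := fun p z => (dual_vectorDifferential hσ π₃ p z).symm
  have hτ₃ : ∀ p (z : Tan n p), differential n (fun q => (v q).2.2) p z
      = (vectorDifferential n τ p z).2.2 := fun p z => (dual_vectorDifferential hτ π₃ p z).symm
  have key : ∀ {w : (p : G) → Fiber n p} (_ : WeaklySmooth n fun q => trivialise q (w q))
      {Z : (p : G) → Tan n p} (_ : SmoothField Z) (p : G) (x : Tan n p),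
      differential n (fun q => (w q).2.1 (Z q)) p x
        = (vectorDifferential n (fun q => trivialise q (w q)) p x).2.1 (toLie p (Z p))
          + (w p).2.1 (fromLie p (vectorDifferential n (fun q => toLie q (Z q)) p x)) := by
    intro w hw Z hZ p x
    have h1 := differential_bilin (hw.comp π₂) hZ.weaklySmooth LinearMap.id p x
    have h2 : (fun q => (LinearMap.id (R := ℝ) (π₂ (trivialise q (w q)))) (toLie q (Z q)))
        = fun q => (w q).2.1 (Z q) := by
      ext q
      simp [π₂, trivialise_apply, fromLie_toLie]
    rw [h2, vectorDifferential_comp hw π₂] at h1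
    exact h1
  refine ⟨fun p => ?_, fun Z hZ p => ?_, fun p => ?_⟩
  · simp only [trivialise_symm_apply, trivialDorfman]
    rw [← fromLie_toLie p (vfBracket _ _ p), toLie_vfBracket hu.vec hv.vec, hσ₁, hτ₁]
    simp [lieDorfman, σ, τ, trivialise_apply, fromLie_toLie]
  · rw [dirDeriv_eq, dirDeriv_eq, dirDeriv_eq, dirDeriv_eq, key hτ hZ, key hσ hZ, key hσ hv.vec,
      ← fromLie_toLie p (vfBracket _ Z p), ← fromLie_toLie p (vfBracket (fun q => (v q).1) Z p),
      toLie_vfBracket hu.vec hZ, toLie_vfBracket hv.vec hZ, hσ₁, hτ₁, hσ₃,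
      leftForm_three, leftForm_two, leftForm_two]
    simp only [trivialise_symm_apply, trivialDorfman, lieDorfman]
    simp [σ, τ, trivialise_apply, fromLie_toLie, modelPairing_apply]
    ring
  · rw [dirDeriv_eq, dirDeriv_eq, hσ₃, hτ₃, leftForm_two]
    simp only [trivialise_symm_apply, trivialDorfman, lieDorfman]
    simp [σ, τ, trivialise_apply, fromLie_toLie]
    ring

/-- A one-form is determined by its values on left-invariant fields, since these take every value at
a given point. -/
lemma IsDorfman.unique {H : (p : G) → (Tan n p) [⋀^Fin 3]→ₗ[ℝ] ℝ}
    {F : (p : G) → (Tan n p) [⋀^Fin 2]→ₗ[ℝ] ℝ} {u v w w' : (p : G) → Fiber n p}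
    (h : IsDorfman H F u v w) (h' : IsDorfman H F u v w') (p : G) : w p = w' p := by
  refine Prod.ext ((h.vec p).trans (h'.vec p).symm) (Prod.ext ?_ ((h.fn p).trans (h'.fn p).symm))
  ext z
  have h1 := (h.form _ (smoothField_leftField (toLie p z)) p).trans
    (h'.form _ (smoothField_leftField (toLie p z)) p).symm
  rwa [leftField, fromLie_toLie] at h1

/-- The left-invariant section with value `u` at `1`. -/
def leftSection (u : Model (GroupLieAlgebra (𝓡 n) G)) (p : G) : Fiber n p := (trivialise p).symm u

lemma trivialise_leftSection (u : Model (GroupLieAlgebra (𝓡 n) G)) (p : G) :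
    trivialise p (leftSection u p) = u := LinearEquiv.apply_symm_apply _ _

lemma smoothSection_leftSection (u : Model (GroupLieAlgebra (𝓡 n) G)) :
    SmoothSection (leftSection u : (p : G) → Fiber n p) := by
  rw [smoothSection_iff]
  intro φ
  simp only [trivialise_leftSection]
  exact SmoothFunction.const _

lemma vectorDifferential_const {W : Type*} [AddCommGroup W] [Module ℝ W] [Module.Finite ℝ W]
    (w : W) (p : G) : vectorDifferential n (fun _ : G => w) p = 0 := by
  ext z
  simp [vectorDifferential, differential_const]

lemma isDorfman_leftSection (H : (GroupLieAlgebra (𝓡 n) G) [⋀^Fin 3]→ₗ[ℝ] ℝ)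
    (F : (GroupLieAlgebra (𝓡 n) G) [⋀^Fin 2]→ₗ[ℝ] ℝ) (u v : Model (GroupLieAlgebra (𝓡 n) G)) :
    IsDorfman (leftForm H) (leftForm F) (leftSection u : (p : G) → Fiber n p) (leftSection v)
      (leftSection (lieDorfman H F u v)) := by
  have h := isDorfman_trivialDorfman H F (smoothSection_leftSection (G := G) u)
    (smoothSection_leftSection v)
  convert! h using 2 with p
  simp only [trivialDorfman, trivialise_leftSection, vectorDifferential_const]
  simp [leftSection]

end Trivialisation

section Alternating

variable {V : Type*} [AddCommGroup V] [Module ℝ V]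

lemma two_swap (F : V [⋀^Fin 2]→ₗ[ℝ] ℝ) (x y : V) : F ![y, x] = -F ![x, y] := by
  rw [← F.map_swap ![x, y] (show (0 : Fin 2) ≠ 1 by decide)]
  congr 1; ext i; fin_cases i <;> simp

lemma three_swap_left (H : V [⋀^Fin 3]→ₗ[ℝ] ℝ) (x y z : V) : H ![y, x, z] = -H ![x, y, z] := by
  rw [← H.map_swap ![x, y, z] (show (0 : Fin 3) ≠ 1 by decide)]
  congr 1; ext i; fin_cases i <;> simp [Equiv.swap_apply_def]

lemma three_swap_right (H : V [⋀^Fin 3]→ₗ[ℝ] ℝ) (x y z : V) : H ![x, z, y] = -H ![x, y, z] := by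
  rw [← H.map_swap ![x, y, z] (show (1 : Fin 3) ≠ 2 by decide)]
  congr 1; ext i; fin_cases i <;> simp [Equiv.swap_apply_def]

end Alternating

/-! ### From integrability on left-invariant sections to tensor identities on the Lie algebra. -/

section LieAlgebra

variable {𝔤 : Type*} [LieRing 𝔤] [LieAlgebra ℝ 𝔤]

/-- `2 g(∇_x y, z) + H(x, y, z)`, where `∇` is the Levi-Civita connection of `g`. -/
def koszul (g : LinearMap.BilinForm ℝ 𝔤) (H : 𝔤 [⋀^Fin 3]→ₗ[ℝ] ℝ) (x y z : 𝔤) : ℝ :=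
  g ⁅x, y⁆ z - g ⁅y, z⁆ x + g ⁅z, x⁆ y + H ![x, y, z]

/-- The identities between tensors on the Lie algebra that a left-invariant `B_n`-generalized
pseudo-Kähler structure implies. -/
structure TensorIdentities (H : 𝔤 [⋀^Fin 3]→ₗ[ℝ] ℝ) (F : 𝔤 [⋀^Fin 2]→ₗ[ℝ] ℝ)
    (g : LinearMap.BilinForm ℝ 𝔤) (Jp Jm : Module.End ℝ 𝔤) (Xp Xm : 𝔤) (c : ℝ) : Prop where
  symm : ∀ x y, g x y = g y x
  nondegenerate : ∀ x, (∀ y, g x y = 0) → x = 0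
  minus_sq : ∀ x, Jm (Jm x) = -x
  minus_skew : ∀ x y, g (Jm x) y = -g x (Jm y)
  plus_skew : ∀ x y, g (Jp x) y = -g x (Jp y)
  plus_Xp : Jp Xp = -(c • Xm)
  plus_Xm : Jp Xm = c • Xp
  norm_Xp : g Xp Xp = 1 - c ^ 2
  norm_Xm : g Xm Xm = 1 - c ^ 2
  orthogonal : g Xp Xm = 0
  plus_sq : ∀ x, Jp (Jp x) = -x + g Xp x • Xp + g Xm x • Xm
  parallel_minus : ∀ x y z, koszul g H x (Jm y) z + koszul g H x y (Jm z) = 0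
  F_minus : ∀ x y, F ![Jm x, y] + F ![x, Jm y] = 0
  parallel_Xp : ∀ x z, koszul g (-H) x Xp z = 2 * c * F ![x, z]
  F_Xp : ∀ x, F ![x, Xp] = 0
  parallel_Xm : ∀ x z, koszul g (-H) x Xm z = 2 * F ![x, Jp z]
  d_H : ∀ x y z w,
    - H ![⁅x, y⁆, z, w] + H ![⁅x, z⁆, y, w] - H ![⁅x, w⁆, y, z]
      - H ![⁅y, z⁆, x, w] + H ![⁅y, w⁆, x, z] - H ![⁅z, w⁆, x, y]
    = - (2 * (F ![x, y] * F ![z, w] - F ![x, z] * F ![y, w] + F ![x, w] * F ![y, z]))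

/-- The structure tensor `⟨[u, v], w⟩` of the left-invariant sections. -/
def structureTensor (H : 𝔤 [⋀^Fin 3]→ₗ[ℝ] ℝ) (F : 𝔤 [⋀^Fin 2]→ₗ[ℝ] ℝ) (u v w : Model 𝔤) : ℝ :=
  modelPairing 𝔤 (lieDorfman H F u v) w

/-- Scalar products of left-invariant sections are constant, so the structure tensor is totally
skew; the two transposition rules below are read off from this formula. -/
lemma structureTensor_eq (H : 𝔤 [⋀^Fin 3]→ₗ[ℝ] ℝ) (F : 𝔤 [⋀^Fin 2]→ₗ[ℝ] ℝ) (u v w : Model 𝔤) :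
    structureTensor H F u v w =
      (1 / 2) * (w.2.1 ⁅u.1, v.1⁆ - v.2.1 ⁅u.1, w.1⁆ + u.2.1 ⁅v.1, w.1⁆ - H ![u.1, v.1, w.1])
        + w.2.2 * F ![u.1, v.1] - v.2.2 * F ![u.1, w.1] + u.2.2 * F ![v.1, w.1] := by
  simp [structureTensor, lieDorfman, modelPairing_apply, three_swap_left H u.1 v.1 w.1]
  ring

lemma structureTensor_swap_left (H : 𝔤 [⋀^Fin 3]→ₗ[ℝ] ℝ) (F : 𝔤 [⋀^Fin 2]→ₗ[ℝ] ℝ)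
    (u v w : Model 𝔤) : structureTensor H F v u w = -structureTensor H F u v w := by
  rw [structureTensor_eq, structureTensor_eq, three_swap_left H u.1 v.1, two_swap F u.1 v.1,
    ← lie_skew v.1 u.1, map_neg]
  ring

lemma structureTensor_swap_right (H : 𝔤 [⋀^Fin 3]→ₗ[ℝ] ℝ) (F : 𝔤 [⋀^Fin 2]→ₗ[ℝ] ℝ)
    (u v w : Model 𝔤) : structureTensor H F u w v = -structureTensor H F u v w := by
  rw [structureTensor_eq, structureTensor_eq, three_swap_right H u.1 v.1, two_swap F v.1 w.1,
    ← lie_skew w.1 v.1, map_neg]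
  ring

lemma structureTensor_cyclic (H : 𝔤 [⋀^Fin 3]→ₗ[ℝ] ℝ) (F : 𝔤 [⋀^Fin 2]→ₗ[ℝ] ℝ)
    (u v w : Model 𝔤) : structureTensor H F u v w = structureTensor H F v w u := by
  rw [structureTensor_swap_right H F v u w, structureTensor_swap_left H F u v w, neg_neg]

/-- The isomorphism of `𝔤` with the left-invariant sections of `E_-`. -/
def minusPart (g : LinearMap.BilinForm ℝ 𝔤) : 𝔤 →ₗ[ℝ] Model 𝔤 :=
  LinearMap.id.prod ((-g).prod 0)

/-- The isomorphism of `𝔤 ⊕ ℝ` with the left-invariant sections of `E_+`. -/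
def plusPart (g : LinearMap.BilinForm ℝ 𝔤) (x : 𝔤) (l : ℝ) : Model 𝔤 := (x, g x, l)

lemma minusPart_apply (g : LinearMap.BilinForm ℝ 𝔤) (x : 𝔤) : minusPart g x = (x, -g x, 0) := rfl

/-- The partial connection on `E₋` along `E₊` is the metric connection with torsion `H`, corrected
by `F` in the direction of the trivial line; for `E₊` along `E₋` the sign of `H` changes. -/
lemma structureTensor_plus_minus_minus {g : LinearMap.BilinForm ℝ 𝔤} (hg : ∀ x y, g x y = g y x)
    (H : 𝔤 [⋀^Fin 3]→ₗ[ℝ] ℝ) (F : 𝔤 [⋀^Fin 2]→ₗ[ℝ] ℝ) (x y z : 𝔤) (l : ℝ) :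
    structureTensor H F (plusPart g x l) (minusPart g y) (minusPart g z)
      = -(1 / 2) * koszul g H x y z + l * F ![y, z] := by
  rw [structureTensor_eq, koszul]
  simp only [minusPart_apply, plusPart, LinearMap.neg_apply]
  rw [← lie_skew x z, map_neg, hg ⁅x, y⁆, hg ⁅y, z⁆, hg ⁅z, x⁆]
  ring

lemma structureTensor_minus_plus_plus {g : LinearMap.BilinForm ℝ 𝔤} (hg : ∀ x y, g x y = g y x)
    (H : 𝔤 [⋀^Fin 3]→ₗ[ℝ] ℝ) (F : 𝔤 [⋀^Fin 2]→ₗ[ℝ] ℝ) (x y z : 𝔤) (l m : ℝ) :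
    structureTensor H F (minusPart g x) (plusPart g y l) (plusPart g z m)
      = (1 / 2) * koszul g (-H) x y z + m * F ![x, y] - l * F ![x, z] := by
  rw [structureTensor_eq, koszul]
  simp only [minusPart_apply, plusPart, LinearMap.neg_apply, AlternatingMap.neg_apply]
  rw [← lie_skew x z, map_neg, hg ⁅x, y⁆, hg ⁅y, z⁆, hg ⁅z, x⁆]
  ring

lemma pairing_minus_minus {g : LinearMap.BilinForm ℝ 𝔤} (hg : ∀ x y, g x y = g y x) (x y : 𝔤) :
    modelPairing 𝔤 (minusPart g x) (minusPart g y) = -g x y := by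
  simp only [modelPairing_apply, minusPart_apply, LinearMap.neg_apply, hg y x]; ring

lemma pairing_minus_plus {g : LinearMap.BilinForm ℝ 𝔤} (hg : ∀ x y, g x y = g y x) (x y : 𝔤)
    (l : ℝ) : modelPairing 𝔤 (minusPart g x) (plusPart g y l) = 0 := by
  simp only [modelPairing_apply, minusPart_apply, plusPart, LinearMap.neg_apply, hg y x]; ring

lemma pairing_plus_plus {g : LinearMap.BilinForm ℝ 𝔤} (hg : ∀ x y, g x y = g y x) (x y : 𝔤)
    (l m : ℝ) : modelPairing 𝔤 (plusPart g x l) (plusPart g y m) = g x y + l * m := by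
  simp only [modelPairing_apply, plusPart, hg y x]; ring

lemma plusPart_eq (g : LinearMap.BilinForm ℝ 𝔤) (x : 𝔤) (l : ℝ) :
    plusPart g x l = plusPart g x 0 + l • plusPart g 0 1 := by
  ext <;> simp [plusPart]

lemma plusPart_inj {g : LinearMap.BilinForm ℝ 𝔤} {x y : 𝔤} {l m : ℝ}
    (h : plusPart g x l = plusPart g y m) : x = y ∧ l = m :=
  ⟨congrArg (fun u : Model 𝔤 => u.1) h, congrArg (fun u : Model 𝔤 => u.2.2) h⟩

/-- Integrability of an endomorphism on left-invariant sections. -/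
def IsLieIntegrable (H : 𝔤 [⋀^Fin 3]→ₗ[ℝ] ℝ) (F : 𝔤 [⋀^Fin 2]→ₗ[ℝ] ℝ)
    (A : Module.End ℝ (Model 𝔤)) : Prop :=
  ∀ s s', A (A s) = -s → A (A s') = -s' →
    A (lieDorfman H F s s' - lieDorfman H F (A s) (A s'))
      = lieDorfman H F s (A s') + lieDorfman H F (A s) s' ∧
    A (lieDorfman H F s (A s') + lieDorfman H F (A s) s')
      = -(lieDorfman H F s s' - lieDorfman H F (A s) (A s'))

variable {H : 𝔤 [⋀^Fin 3]→ₗ[ℝ] ℝ} {F : 𝔤 [⋀^Fin 2]→ₗ[ℝ] ℝ}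

/-- Pair the integrability condition with `z` and move `A` to the other side by skewness. -/
lemma IsLieIntegrable.tensor {A : Module.End ℝ (Model 𝔤)} (hA : IsLieIntegrable H F A)
    (skew : ∀ u v, modelPairing 𝔤 (A u) v = -modelPairing 𝔤 u (A v)) {s s' : Model 𝔤}
    (hs : A (A s) = -s) (hs' : A (A s') = -s') (z : Model 𝔤) :
    structureTensor H F s s' (A z) - structureTensor H F (A s) (A s') (A z)
      + structureTensor H F s (A s') z + structureTensor H F (A s) s' z = 0 := by
  have h := congrArg (fun v => modelPairing 𝔤 v z) (hA s s' hs hs').1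
  simp only [skew, map_sub, map_add, LinearMap.sub_apply, LinearMap.add_apply] at h
  simp only [structureTensor]
  linarith

/-- Pairing with a vector of `ker A` removes the terms in the image of `A`, leaving information
about the kernel direction, which is orthogonal to the eigenbundle. -/
lemma IsLieIntegrable.tensor_kernel {A : Module.End ℝ (Model 𝔤)} (hA : IsLieIntegrable H F A)
    (skew : ∀ u v, modelPairing 𝔤 (A u) v = -modelPairing 𝔤 u (A v)) {s s' : Model 𝔤}
    (hs : A (A s) = -s) (hs' : A (A s') = -s') {u : Model 𝔤} (hu : A u = 0) :
    structureTensor H F s s' u = structureTensor H F (A s) (A s') u := by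
  have h := congrArg (fun v => modelPairing 𝔤 v u) (hA s s' hs hs').2
  simp only [skew, hu, map_sub, map_zero, map_neg, LinearMap.neg_apply, LinearMap.sub_apply] at h
  simp only [structureTensor]
  linarith

variable {g : LinearMap.BilinForm ℝ 𝔤} {Jp Jm : Module.End ℝ 𝔤} {Xp Xm : 𝔤} {c : ℝ}

/-- The squares of `A` give the pointwise relations. The differential relations say that the partial
connections on `E₋` along `E₊` and on `E₊` along `E₋` preserve `A`: first on sections orthogonal to
the kernel generator `u`, then in the direction of `u`. -/
lemma tensorIdentities_of_isLieIntegrable (symm : ∀ x y, g x y = g y x)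
    (nondeg : ∀ x, (∀ y, g x y = 0) → x = 0)
    (d_H : ∀ x y z w,
      - H ![⁅x, y⁆, z, w] + H ![⁅x, z⁆, y, w] - H ![⁅x, w⁆, y, z]
        - H ![⁅y, z⁆, x, w] + H ![⁅y, w⁆, x, z] - H ![⁅z, w⁆, x, y]
      = - (2 * (F ![x, y] * F ![z, w] - F ![x, z] * F ![y, w] + F ![x, w] * F ![y, z])))
    {A B : Module.End ℝ (Model 𝔤)}
    (hAm : ∀ x, A (minusPart g x) = minusPart g (Jm x))
    (hAp : ∀ x l, A (plusPart g x l) = plusPart g (Jp x + l • Xm) (-g Xm x))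
    (hBm : ∀ x, B (minusPart g x) = -minusPart g (Jm x))
    (hBp : ∀ x l, B (plusPart g x l) = plusPart g (Jp x + l • Xm) (-g Xm x))
    (skewA : ∀ u v, modelPairing 𝔤 (A u) v = -modelPairing 𝔤 u (A v))
    (skewB : ∀ u v, modelPairing 𝔤 (B u) v = -modelPairing 𝔤 u (B v))
    (unit : g Xp Xp + c * c = 1) (kernel : A (plusPart g Xp c) = 0)
    (square : ∀ v, A (A v) = -v + modelPairing 𝔤 v (plusPart g Xp c) • plusPart g Xp c)
    (intA : IsLieIntegrable H F A) (intB : IsLieIntegrable H F B) :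
    TensorIdentities H F g Jp Jm Xp Xm c := by
  set u := plusPart g Xp c with hu
  have hm : ∀ x, A (A (minusPart g x)) = -minusPart g x := fun x => by
    rw [square, hu, pairing_minus_plus symm, zero_smul, add_zero]
  have hBA : ∀ x, B (B (minusPart g x)) = A (A (minusPart g x)) := fun x => by
    simp only [hAm, hBm, map_neg, neg_neg]
  have hBAp : ∀ x l, B (plusPart g x l) = A (plusPart g x l) := fun x l => by rw [hAp, hBp]
  have hBAp2 : ∀ x l, B (B (plusPart g x l)) = A (A (plusPart g x l)) := fun x l => by
    rw [hBp, hBp, hAp, hAp]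
  have hJm : ∀ x, Jm (Jm x) = -x := fun x => by
    have := hm x
    rw [hAm, hAm] at this
    exact congrArg (fun u : Model 𝔤 => u.1) this
  have ker : Jp Xp + c • Xm = 0 ∧ -g Xm Xp = 0 := by
    rw [hu, hAp] at kernel
    exact plusPart_inj (kernel.trans (by ext <;> simp [plusPart] : (0 : Model 𝔤) = plusPart g 0 0))
  -- The vector and scalar parts of `A² = -1 + ⟨·,u⟩ u` on `E₊`.
  have sq : ∀ x l, Jp (Jp x + l • Xm) + (-g Xm x) • Xm = -x + (g x Xp + l * c) • Xp ∧
      -g Xm (Jp x + l • Xm) = -l + (g x Xp + l * c) * c := by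
    intro x l
    have h := square (plusPart g x l)
    rw [hAp, hAp, hu, pairing_plus_plus symm] at h
    refine plusPart_inj (h.trans ?_)
    ext <;> simp [plusPart]
  have plus_Xm : Jp Xm = c • Xp := by simpa using (sq 0 1).1
  have norm_Xm : g Xm Xm = 1 - c ^ 2 := by
    have := (sq 0 1).2
    simp at this
    linarith
  -- the partial connection on `E_+` preserves `A`
  have mixed : ∀ x y l, modelPairing 𝔤 (plusPart g y l) u = 0 →
      (∀ w, structureTensor H F (minusPart g x) (plusPart g y l) (minusPart g (Jm w))
        + structureTensor H F (minusPart g (Jm x)) (plusPart g y l) (minusPart g w) = 0) ∧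
      (∀ w k, structureTensor H F (minusPart g x) (plusPart g y l) (A (plusPart g w k))
        + structureTensor H F (minusPart g x) (A (plusPart g y l)) (plusPart g w k) = 0) := by
    intro x y l h
    have h2 : A (A (plusPart g y l)) = -plusPart g y l := by
      rw [square, h, zero_smul, add_zero]
    -- `A` and `B` agree on `E₊` and are opposite on `E₋`: when `z` is in `E₋` the difference of
    -- their conditions is needed, when `z` is in `E₊` their sum.
    have hA := intA.tensor skewA (hm x) h2
    have hB := intB.tensor skewB ((hBA x).trans (hm x)) ((hBAp2 y l).trans h2)
    have e3 : ∀ a b d, structureTensor H F a b (-d) = -structureTensor H F a b d := fun a b d => by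
      simp [structureTensor]
    have e : ∀ a b d, structureTensor H F (-a) b d = -structureTensor H F a b d := fun a b d => by
      rw [structureTensor_cyclic, e3, ← structureTensor_cyclic]
    constructor
    · intro w
      have hA' := hA (minusPart g w)
      have hB' := hB (minusPart g w)
      simp only [hBm, hAm, hBAp, e, e3] at hA' hB'
      linarith
    · intro w k
      have hA' := hA (plusPart g w k)
      have hB' := hB (plusPart g w k)
      simp only [hBm, hAm, hBAp, e] at hA' hB'
      linarith
  have huu : modelPairing 𝔤 u u = 1 := by rw [hu, pairing_plus_plus symm]; exact unit
  have e2 : ∀ a b b' d, structureTensor H F a (b + b') d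
      = structureTensor H F a b d + structureTensor H F a b' d := fun a b b' d => by
    rw [← neg_inj, ← structureTensor_swap_right, neg_add, ← structureTensor_swap_right,
      ← structureTensor_swap_right]
    simp [structureTensor]
  have e2s : ∀ a (r : ℝ) b d, structureTensor H F a (r • b) d
      = r * structureTensor H F a b d := fun a r b d => by
    rw [← neg_inj, ← structureTensor_swap_right, ← mul_neg, ← structureTensor_swap_right]
    simp [structureTensor]
  have Tuu : ∀ a, structureTensor H F a u u = 0 := fun a => by
    have := structureTensor_swap_right H F a u u
    linarith
  -- Orthogonal decomposition of `E₊` along the unit vector `u`.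
  have dec : ∀ y l, plusPart g y l = plusPart g (y - (g y Xp + l * c) • Xp)
      (l - (g y Xp + l * c) * c) + (g y Xp + l * c) • u := fun y l => by
    ext <;> simp [plusPart, hu]
  have dec0 : ∀ y l, modelPairing 𝔤 (plusPart g (y - (g y Xp + l * c) • Xp)
      (l - (g y Xp + l * c) * c)) u = 0 := fun y l => by
    rw [hu, pairing_plus_plus symm, map_sub, map_smul, LinearMap.sub_apply, LinearMap.smul_apply,
      smul_eq_mul]
    linear_combination (-(g y Xp + l * c)) * unit
  have Tu0 : ∀ x y l, modelPairing 𝔤 (plusPart g y l) u = 0 →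
      structureTensor H F (minusPart g x) (plusPart g y l) u = 0 := by
    intro x y l h
    have h2 : A (A (plusPart g y l)) = -plusPart g y l := by
      rw [square, h, zero_smul, add_zero]
    have h3 : modelPairing 𝔤 (A (plusPart g y l)) u = 0 := by
      rw [skewA, kernel, map_zero, neg_zero]
    rw [hAp] at h3
    -- Apply the identity to the image under `A` and pair with `u`: since `A u = 0` and `A² = -1` on
    -- the complement of `u`, only the wanted component survives.
    have h4 := (mixed x _ _ h3).2 Xp c
    rw [← hAp, h2, ← hu, kernel, ← neg_one_smul ℝ (plusPart g y l), e2s]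
      at h4
    simp only [structureTensor, map_zero, zero_add] at h4 ⊢
    linarith
  have Tu : ∀ x y l, structureTensor H F (minusPart g x) (plusPart g y l) u = 0 := by
    intro x y l
    rw [dec, e2, e2s, Tuu, Tu0 x _ _ (dec0 y l)]
    simp
  have mixed' : ∀ x y l w k, structureTensor H F (minusPart g x) (plusPart g y l)
      (A (plusPart g w k)) + structureTensor H F (minusPart g x) (A (plusPart g y l))
        (plusPart g w k) = 0 := by
    intro x y l w k
    have h := (mixed x _ _ (dec0 y l)).2 w k
    have h2 : structureTensor H F (minusPart g x) u (A (plusPart g w k)) = 0 := by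
      rw [structureTensor_swap_right, hAp, Tu, neg_zero]
    rw [dec y l, e2, e2s, h2, map_add, map_smul, kernel, smul_zero, add_zero]
    linarith
  have minus : ∀ y l x w, structureTensor H F (plusPart g y l) (minusPart g x) (minusPart g (Jm w))
      + structureTensor H F (plusPart g y l) (minusPart g (Jm x)) (minusPart g w) = 0 := by
    have hu' : ∀ x w, structureTensor H F (minusPart g x) u (minusPart g (Jm w))
        + structureTensor H F (minusPart g (Jm x)) u (minusPart g w) = 0 := by
      intro x w
      have h := intA.tensor_kernel skewA (hm x) (hm (Jm w)) kernel
      rw [hAm, hAm, hJm, map_neg, ← neg_one_smul ℝ (minusPart g w), e2s] at h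
      rw [structureTensor_swap_right, structureTensor_swap_right H F (minusPart g (Jm x))]
      linarith
    intro y l x w
    have h := (mixed x _ _ (dec0 y l)).1 w
    have h' := hu' x w
    rw [structureTensor_swap_left _ _ (minusPart g x), structureTensor_swap_left _ _
      (minusPart g (Jm x)), dec y l, e2, e2, e2s, e2s]
    linear_combination -h - (g y Xp + l * c) * h'
  -- This and the next two identities are affine in their scalar parameter; comparing the parameters
  -- 0 and 1 separates the connection identities from the conditions on `F`.
  have hminus : ∀ x l y z, (-(1 / 2) * koszul g H x y (Jm z) + l * F ![y, Jm z])
      + (-(1 / 2) * koszul g H x (Jm y) z + l * F ![Jm y, z]) = 0 := fun x l y z => by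
    rw [← structureTensor_plus_minus_minus symm, ← structureTensor_plus_minus_minus symm]
    exact minus x l y z
  have hTu : ∀ x y l, (1 / 2) * koszul g (-H) x y Xp + c * F ![x, y] - l * F ![x, Xp] = 0 :=
    fun x y l => by rw [← structureTensor_minus_plus_plus symm]; exact Tu x y l
  have hTu' : ∀ x z m, (1 / 2) * koszul g (-H) x Xp z + m * F ![x, Xp] - c * F ![x, z] = 0 :=
    fun x z m => by
      rw [← structureTensor_minus_plus_plus symm, structureTensor_swap_right]
      rw [← hu, Tu, neg_zero]
  refine ⟨symm, nondeg, hJm, ?_, ?_, eq_neg_of_add_eq_zero_left ker.1, plus_Xm, ?_, norm_Xm,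
    ?_, ?_, ?_, ?_, ?_, ?_, ?_, d_H⟩
  · intro x y
    have := skewA (minusPart g x) (minusPart g y)
    rw [hAm, hAm, pairing_minus_minus symm, pairing_minus_minus symm] at this
    linarith
  · intro x y
    have := skewA (plusPart g x 0) (plusPart g y 0)
    rw [hAp, hAp, pairing_plus_plus symm, pairing_plus_plus symm] at this
    simpa using this
  · linarith
  · rw [symm]; linarith [ker.2]
  · intro x
    have h := (sq x 0).1
    simp only [zero_smul, add_zero, zero_mul, neg_smul] at h
    rw [symm Xp x]
    rw [← h]
    abel
  · intro x y z
    have := hminus x 0 y z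
    linarith
  · intro x y
    have h1 := hminus 0 1 x y
    have h0 := hminus 0 0 x y
    linarith
  · intro x z
    have := hTu' x z 0
    linarith
  · intro x
    have h1 := hTu' x 0 1
    have h0 := hTu' x 0 0
    linarith
  · intro x z
    -- The vector zero with scalar `1` is the section `1` of `E`, which `A` maps to the section of
    -- `E₊` over `X₋`.
    have h := mixed' x 0 1 z 0
    rw [hAp, hAp, structureTensor_minus_plus_plus symm, structureTensor_minus_plus_plus symm] at h
    have h0 : ∀ z, koszul g (-H) x 0 z = 0 := fun z => by
      have : H ![x, 0, z] = 0 := by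
        rw [three_swap_right, ← contractThree_apply, map_zero, neg_zero]
      simp [koszul, this]
    have h1 : F ![x, 0] = 0 := by rw [← contractTwo_apply, map_zero]
    rw [h0, h1] at h
    simp at h
    linarith

end LieAlgebra

/-! ### Reduction of a left-invariant structure to its value at the identity. -/

section LeftInvariant

variable {n : ℕ} {G : Type*} [TopologicalSpace G] [ChartedSpace (EuclideanSpace ℝ (Fin n)) G]
  [Group G] [LieGroup (𝓡 n) ∞ G]

lemma leftSection_add (u v : Model (GroupLieAlgebra (𝓡 n) G)) (p : G) :
    leftSection (u + v) p = leftSection u p + leftSection v p := map_add _ _ _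

lemma leftSection_neg (u : Model (GroupLieAlgebra (𝓡 n) G)) (p : G) :
    leftSection (-u) p = -leftSection u p := map_neg _ _

lemma leftSection_sub (u v : Model (GroupLieAlgebra (𝓡 n) G)) (p : G) :
    leftSection (u - v) p = leftSection u p - leftSection v p := map_sub _ _ _

lemma leftSection_smul (r : ℝ) (u : Model (GroupLieAlgebra (𝓡 n) G)) (p : G) :
    leftSection (r • u) p = r • leftSection u p := map_smul _ _ _

lemma leftSection_injective (p : G) {u v : Model (GroupLieAlgebra (𝓡 n) G)}
    (h : leftSection u p = leftSection v p) : u = v := (trivialise p).symm.injective h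

lemma pairing_leftSection (u v : Model (GroupLieAlgebra (𝓡 n) G)) (p : G) :
    pairing (leftSection u p) (leftSection v p) = modelPairing _ u v :=
  pairing_trivialise_symm p u v

lemma leftSection_trivialise (p : G) (u : Fiber n p) : leftSection (trivialise p u) p = u :=
  LinearEquiv.symm_apply_apply _ _

lemma leftSection_minusPart (g : LinearMap.BilinForm ℝ (GroupLieAlgebra (𝓡 n) G))
    (x : GroupLieAlgebra (𝓡 n) G) (p : G) :
    leftSection (minusPart g x) p = (fromLie p x, -leftBilin g p (fromLie p x), 0) := by
  refine Prod.ext rfl (Prod.ext ?_ rfl)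
  ext z
  simp [leftSection, trivialise_symm_apply, minusPart_apply, leftBilin, toLie_fromLie]

lemma leftSection_plusPart (g : LinearMap.BilinForm ℝ (GroupLieAlgebra (𝓡 n) G))
    (x : GroupLieAlgebra (𝓡 n) G) (l : ℝ) (p : G) :
    leftSection (plusPart g x l) p = (fromLie p x, leftBilin g p (fromLie p x), l) := by
  refine Prod.ext rfl (Prod.ext ?_ rfl)
  ext z
  simp [leftSection, trivialise_symm_apply, plusPart, leftBilin, toLie_fromLie]

lemma leftEnd_fromLie (J : Module.End ℝ (GroupLieAlgebra (𝓡 n) G))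
    (x : GroupLieAlgebra (𝓡 n) G) (p : G) : leftEnd J p (fromLie p x) = fromLie p (J x) := by
  simp [leftEnd, toLie_fromLie]

lemma leftBilin_fromLie (g : LinearMap.BilinForm ℝ (GroupLieAlgebra (𝓡 n) G))
    (x y : GroupLieAlgebra (𝓡 n) G) (p : G) :
    leftBilin g p (fromLie p x) (fromLie p y) = g x y := by
  simp [leftBilin, toLie_fromLie]

/-- The endomorphism of left-invariant sections given by the value at `1`. -/
def lieEnd (A : (p : G) → Module.End ℝ (Fiber n p)) :
    Module.End ℝ (Model (GroupLieAlgebra (𝓡 n) G)) :=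
  (trivialise (1 : G)).toLinearMap ∘ₗ A 1 ∘ₗ (trivialise (1 : G)).symm.toLinearMap

lemma leftSection_lieEnd (A : (p : G) → Module.End ℝ (Fiber n p))
    (v : Model (GroupLieAlgebra (𝓡 n) G)) :
    leftSection (lieEnd A v) (1 : G) = A 1 (leftSection v 1) :=
  leftSection_trivialise _ _

/-- The eigenbundle consists of the sections `s - i A s` with `A² s = -s`. For left-invariant `s`
the Dorfman bracket is known and unique, so evaluating at `1` gives the algebraic condition. -/
lemma isLieIntegrable_of_isIntegrable {H : (GroupLieAlgebra (𝓡 n) G) [⋀^Fin 3]→ₗ[ℝ] ℝ}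
    {F : (GroupLieAlgebra (𝓡 n) G) [⋀^Fin 2]→ₗ[ℝ] ℝ} {A : (p : G) → Module.End ℝ (Fiber n p)}
    (hinv : ∀ p v, A p (leftSection v p) = leftSection (lieEnd A v) p)
    (hA : IsIntegrable (leftForm H) (leftForm F) A) : IsLieIntegrable H F (lieEnd A) := by
  have neg_left : ∀ u v : Model (GroupLieAlgebra (𝓡 n) G),
      lieDorfman H F (-u) v = -lieDorfman H F u v := by
    intro u v
    have h1 : F ![-u.1, v.1] = -F ![u.1, v.1] := by
      rw [two_swap, ← contractTwo_apply, map_neg, contractTwo_apply, two_swap F u.1, neg_neg]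
    ext z
    · simp [lieDorfman]
    · have h2 : F ![-u.1, z] = -F ![u.1, z] := by
        rw [two_swap, ← contractTwo_apply, map_neg, contractTwo_apply, two_swap F u.1, neg_neg]
      have h3 : H ![v.1, -u.1, z] = -H ![v.1, u.1, z] := by
        rw [three_swap_right, ← contractThree_apply, map_neg, contractThree_apply,
          three_swap_right H v.1 u.1, neg_neg]
      simp [lieDorfman, h2, h3]
      ring
    · simp [lieDorfman, h1]
  have neg_right : ∀ u v : Model (GroupLieAlgebra (𝓡 n) G),
      lieDorfman H F u (-v) = -lieDorfman H F u v := by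
    intro u v
    have h1 : F ![u.1, -v.1] = -F ![u.1, v.1] := by
      rw [← contractTwo_apply, map_neg, contractTwo_apply]
    ext z
    · simp [lieDorfman]
    · have h2 : F ![-v.1, z] = -F ![v.1, z] := by
        rw [two_swap, ← contractTwo_apply, map_neg, contractTwo_apply, two_swap F v.1, neg_neg]
      have h3 : H ![-v.1, u.1, z] = -H ![v.1, u.1, z] := by
        rw [three_swap_left, three_swap_right, ← contractThree_apply, map_neg, contractThree_apply,
          three_swap_left H u.1 v.1, three_swap_right H u.1]
        ring
      simp [lieDorfman, h2, h3]
      ring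
    · simp [lieDorfman, h1]
  intro s s' hs hs'
  have sec : ∀ s, lieEnd A (lieEnd A s) = -s →
      IsSectionOfL A (leftSection s) (leftSection (-lieEnd A s)) := by
    intro s hs
    refine ⟨smoothSection_leftSection _, smoothSection_leftSection _, fun p => ?_, fun p => ?_⟩
    · rw [hinv, leftSection_neg, neg_neg]
    · rw [hinv, map_neg, hs, neg_neg]
  obtain ⟨ss, tt, st, ts, hss, htt, hst, hts, h⟩ := hA _ _ _ _ (sec s hs) (sec s' hs')
  have h1 := h 1
  rw [hss.unique (isDorfman_leftSection H F s s'), htt.unique (isDorfman_leftSection H F _ _),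
    hst.unique (isDorfman_leftSection H F _ _), hts.unique (isDorfman_leftSection H F _ _),
    ← leftSection_sub, ← leftSection_add, ← leftSection_neg, hinv, hinv] at h1
  simp only [neg_left, neg_right, neg_neg, map_add, map_neg] at h1
  have h2 := leftSection_injective 1 h1.1
  have h3 := leftSection_injective 1 h1.2
  constructor
  · rw [h2]; abel
  · rw [← h3, map_add]; abel

variable {𝔲 : Submodule ℝ (GroupLieAlgebra (𝓡 n) G)}
  {𝔤₀ : LieIdeal ℝ (GroupLieAlgebra (𝓡 n) G)}
  {H : (GroupLieAlgebra (𝓡 n) G) [⋀^Fin 3]→ₗ[ℝ] ℝ}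
  {F : (GroupLieAlgebra (𝓡 n) G) [⋀^Fin 2]→ₗ[ℝ] ℝ}
  {g : LinearMap.BilinForm ℝ (GroupLieAlgebra (𝓡 n) G)}
  {Jp Jm : Module.End ℝ (GroupLieAlgebra (𝓡 n) G)} {Xp Xm : GroupLieAlgebra (𝓡 n) G} {c : ℝ}

lemma dirDeriv_const (X : (p : G) → Tan n p) (r : ℝ) (p : G) :
    dirDeriv X (fun _ => r) p = 0 := by
  rw [dirDeriv_eq, differential_const]; rfl

set_option maxHeartbeats 1000000 in
-- The components determine both endomorphisms on `E₋` and `E₊`, which together span `E`; since the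
-- components are left-invariant, so are the endomorphisms, and the algebraic lemma applies to their
-- values at `1`.
lemma IsAdaptedPseudoKahler.tensorIdentities (hn : Even n)
    (h : IsAdaptedPseudoKahler 𝔲 𝔤₀ H F g Jp Jm Xp Xm c) :
    TensorIdentities H F g Jp Jm Xp Xm c := by
  obtain ⟨twist, ⟨E, A, hK, hC⟩, -⟩ := h
  have symm : ∀ x y, g x y = g y x := by
    intro x y
    have h := hC.metric 1 (fromLie 1 x) (fromLie 1 y)
    rw [← leftSection_minusPart, ← leftSection_minusPart, pairing_leftSection,
      leftBilin_fromLie] at h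
    simp only [modelPairing_apply, minusPart_apply, LinearMap.neg_apply] at h
    linarith
  have hE : ∀ x p, E p (leftSection (minusPart g x) p) = -leftSection (minusPart g x) p := by
    intro x p
    rw [leftSection_minusPart]
    exact hC.standard p _
  have eigen : ∀ (p : G) (u : Fiber n p), E p u = -u → ∃ x, u = leftSection (minusPart g x) p := by
    intro p u hu
    refine ⟨toLie p u.1, ?_⟩
    have := (hK.metric.admissible p).1 (a₁ := ⟨u, hu⟩)
      (a₂ := ⟨leftSection (minusPart g (toLie p u.1)) p, hE _ p⟩)
      (by simp [leftSection, trivialise_symm_apply, minusPart_apply, fromLie_toLie])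
    exact congrArg Subtype.val this
  have nondeg : ∀ x, (∀ y, g x y = 0) → x = 0 := by
    intro x hx
    have h0 : ∀ v : Fiber n (1 : G), pairing (leftSection (minusPart g x) 1) v = 0 := by
      intro v
      obtain ⟨y, hy⟩ := eigen 1 (v - E 1 v) (by rw [map_sub, hK.metric.involutive]; abel)
      have h1 : pairing (leftSection (minusPart g x) 1) (v - E 1 v) = 0 := by
        rw [hy, pairing_leftSection, pairing_minus_minus symm, hx, neg_zero]
      have h2 := hK.metric.symmetric 1 (leftSection (minusPart g x) 1) v
      rw [hE] at h2
      simp only [← modelPairing_trivialise, map_sub, map_neg, LinearMap.neg_apply] at h1 h2 ⊢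
      linarith
    have h1 : ∀ φ : Module.Dual ℝ (GroupLieAlgebra (𝓡 n) G), φ x = 0 := by
      intro φ
      have h2 := h0 (leftSection (0, φ, 0) 1)
      rw [pairing_leftSection] at h2
      simpa [modelPairing_apply, minusPart_apply] using h2
    exact (Module.forall_dual_apply_eq_zero_iff ℝ x).1 h1
  -- Nondegeneracy of `g` represents every covector as `g z`, which gives the decomposition `E = E₋
  -- ⊕ E₊`.
  have surj : ∀ v : Model (GroupLieAlgebra (𝓡 n) G), ∃ x y l,
      v = minusPart g x + plusPart g y l := by
    have hinj : Function.Injective g := by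
      rw [← LinearMap.ker_eq_bot, LinearMap.ker_eq_bot']
      exact fun x hx => nondeg x fun y => by rw [hx]; rfl
    have hsurj : Function.Surjective g :=
      (LinearMap.injective_iff_surjective_of_finrank_eq_finrank
        (Subspace.dual_finrank_eq).symm).1 hinj
    intro v
    obtain ⟨z, hz⟩ := hsurj v.2.1
    refine ⟨(1 / 2 : ℝ) • (v.1 - z), (1 / 2 : ℝ) • (v.1 + z), v.2.2, ?_⟩
    refine Prod.ext ?_ (Prod.ext ?_ ?_)
    · simp only [minusPart_apply, plusPart, Prod.fst_add]
      module
    · change v.2.1 = -g ((1 / 2 : ℝ) • (v.1 - z)) + g ((1 / 2 : ℝ) • (v.1 + z))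
      rw [map_smul, map_smul, map_sub, map_add, hz]
      module
    · simp [minusPart_apply, plusPart]
  have hEp : ∀ x l p, E p (leftSection (plusPart g x l) p) = leftSection (plusPart g x l) p := by
    intro x l p
    set v := leftSection (plusPart g x l) p with hv
    -- The difference `v - E v` lies in `E₋`; it is also orthogonal to `E₋`, so it vanishes.
    obtain ⟨y, hy⟩ := eigen p (v - E p v) (by rw [map_sub, hK.metric.involutive]; abel)
    have h0 : ∀ z, pairing v (leftSection (minusPart g z) p) = 0 := fun z => by
      have := pairing_minus_plus symm z x l
      rw [hv, pairing_leftSection]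
      rw [modelPairing_apply] at this ⊢
      linarith
    have h1 : y = 0 := by
      refine nondeg y fun z => ?_
      have h2 := hK.metric.symmetric p v (leftSection (minusPart g z) p)
      rw [hE] at h2
      have h3 := h0 z
      have h4 : pairing (v - E p v) (leftSection (minusPart g z) p) = -g y z := by
        rw [hy, pairing_leftSection, pairing_minus_minus symm]
      simp only [← modelPairing_trivialise, map_sub, map_neg, LinearMap.sub_apply] at h2 h3 h4
      linarith
    rw [h1, map_zero] at hy
    have h2 : leftSection (0 : Model (GroupLieAlgebra (𝓡 n) G)) p = 0 := map_zero _
    rw [h2, sub_eq_zero] at hy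
    exact hy.symm
  have hAm : ∀ x p, A p (leftSection (minusPart g x) p) = leftSection (minusPart g (Jm x)) p := by
    intro x p
    rw [leftSection_minusPart, leftSection_minusPart, ← leftEnd_fromLie]
    exact hC.minus p _
  have hAp : ∀ x l p, A p (leftSection (plusPart g x l) p)
      = leftSection (plusPart g (Jp x + l • Xm) (-g Xm x)) p := by
    intro x l p
    have h1 : A p (leftSection (plusPart g x 0) p) = leftSection (plusPart g (Jp x) (-g Xm x)) p := by
      rw [leftSection_plusPart, leftSection_plusPart, ← leftEnd_fromLie, ← leftBilin_fromLie g Xm]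
      exact hC.plus p _
    have h2 : A p (leftSection (plusPart g 0 1) p) = leftSection (plusPart g Xm 0) p := by
      rw [leftSection_plusPart, leftSection_plusPart, map_zero, map_zero]
      exact hC.plus_one p
    rw [plusPart_eq, leftSection_add, leftSection_smul, map_add, map_smul, h1, h2,
      ← leftSection_smul, ← leftSection_add]
    congr 1
    ext <;> simp [plusPart]
  have to_lie : ∀ {B : (p : G) → Module.End ℝ (Fiber n p)} {v w},
      B 1 (leftSection v 1) = leftSection w 1 → lieEnd B v = w := by
    intro B v w hw
    apply leftSection_injective (1 : G)
    rw [leftSection_lieEnd, hw]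
  set B : (p : G) → Module.End ℝ (Fiber n p) := fun p => E p * A p with hB
  have hBm : ∀ x p, B p (leftSection (minusPart g x) p)
      = leftSection (-minusPart g (Jm x)) p := by
    intro x p
    change E p (A p _) = _
    rw [hAm, hE, leftSection_neg]
  have hBp : ∀ x l p, B p (leftSection (plusPart g x l) p)
      = leftSection (plusPart g (Jp x + l • Xm) (-g Xm x)) p := by
    intro x l p
    change E p (A p _) = _
    rw [hAp, hEp]
  have inv : ∀ {B : (p : G) → Module.End ℝ (Fiber n p)}
      {f : GroupLieAlgebra (𝓡 n) G → Model (GroupLieAlgebra (𝓡 n) G)}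
      {f' : GroupLieAlgebra (𝓡 n) G → ℝ → Model (GroupLieAlgebra (𝓡 n) G)},
      (∀ x p, B p (leftSection (minusPart g x) p) = leftSection (f x) p) →
      (∀ x l p, B p (leftSection (plusPart g x l) p) = leftSection (f' x l) p) →
      ∀ p v, B p (leftSection v p) = leftSection (lieEnd B v) p := by
    intro B f f' h1 h2 p v
    obtain ⟨x, y, l, rfl⟩ := surj v
    rw [leftSection_add, map_add, map_add, h1, h2, to_lie (h1 x 1), to_lie (h2 y l 1),
      leftSection_add]
  have skew : ∀ {B : (p : G) → Module.End ℝ (Fiber n p)}, IsBnAlmostComplex B → ∀ u v,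
      modelPairing _ (lieEnd B u) v = -modelPairing _ u (lieEnd B v) := by
    intro B hB u v
    rw [← pairing_leftSection _ _ (1 : G), ← pairing_leftSection _ _ (1 : G), leftSection_lieEnd,
      leftSection_lieEnd]
    exact hB.skew 1 _ _
  have hu1 : modelPairing _ (plusPart g Xp c) (plusPart g Xp c) = 1 := by
    rw [← pairing_leftSection _ _ (1 : G), leftSection_plusPart]
    exact hC.unit 1
  have hu0 : lieEnd A (plusPart g Xp c) = 0 := by
    apply to_lie
    have h2 : leftSection (0 : Model (GroupLieAlgebra (𝓡 n) G)) (1 : G) = 0 := map_zero _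
    rw [leftSection_plusPart, h2]
    exact hC.kernel 1
  refine tensorIdentities_of_isLieIntegrable symm nondeg ?_ (A := lieEnd A) (B := lieEnd B)
    (fun x => to_lie (hAm x 1)) (fun x l => to_lie (hAp x l 1)) (fun x => to_lie (hBm x 1))
    (fun x l => to_lie (hBp x l 1)) (skew hK.almost_complex) (skew hK.almost_complex₂)
    (by rw [← pairing_plus_plus symm]; exact hu1) hu0 ?_
    (isLieIntegrable_of_isIntegrable (inv hAm hAp) hK.integrable)
    (isLieIntegrable_of_isIntegrable (inv hBm hBp) hK.integrable₂)
  · intro x y z w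
    have h := twist.d_H (leftField x) (leftField y) (leftField z) (leftField w)
      (smoothField_leftField x) (smoothField_leftField y) (smoothField_leftField z)
      (smoothField_leftField w) 1
    simp only [vfBracket_leftField, leftForm_three, leftForm_two, leftField, toLie_fromLie,
      dirDeriv_const] at h
    linarith
  · intro v
    obtain ⟨u₀, -, -, h2⟩ := hK.almost_complex.square 1
    have h3 : ∀ v, lieEnd A (lieEnd A v) = -v
        + modelPairing _ v (trivialise 1 u₀) • trivialise 1 u₀ := by
      intro v
      apply leftSection_injective (1 : G)
      rw [leftSection_lieEnd, leftSection_lieEnd, h2, leftSection_add, leftSection_neg,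
        leftSection_smul, leftSection_trivialise, ← pairing_leftSection _ _ (1 : G),
        leftSection_trivialise, hn.neg_one_pow, one_mul]
    -- The square formula comes with some unit generator `u₁` of the kernel. Evaluated on the given
    -- generator it yields `a u₁` with `a² = 1`, and the formula is insensitive to this sign.
    set u₁ := trivialise 1 u₀
    have h4 := h3 (plusPart g Xp c)
    rw [hu0, map_zero] at h4
    have h5 : plusPart g Xp c = modelPairing _ (plusPart g Xp c) u₁ • u₁ := by
      rw [eq_comm, add_comm, add_neg_eq_zero] at h4
      exact h4.symm
    set a := modelPairing _ (plusPart g Xp c) u₁ with ha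
    have h7 : a * a = 1 := by
      have h8 := congrArg (fun w => modelPairing _ (plusPart g Xp c) w) h5
      simp only [map_smul, smul_eq_mul, ← ha, hu1] at h8
      exact h8.symm
    rw [h3, h5, map_smul, smul_smul, smul_eq_mul]
    congr 2
    linear_combination (-(modelPairing _ v u₁)) * h7

end LeftInvariant

/-! ### Structure constants, torsion and connection in a frame adapted to `J₋`. -/

section Frames

set_option linter.unusedSimpArgs false

variable {𝔤 : Type*} [LieRing 𝔤] [LieAlgebra ℝ 𝔤]

/-- Structure constants of a four-dimensional Lie algebra with a distinguished frame. -/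
structure FrameConstants where
  (p q r d11 d21 d31 d12 d22 d32 d13 d23 d33 : ℝ)

/-- A `g`-orthonormal frame adapted to a skew-symmetric complex structure `J`, with its structure
constants; the second, third and fourth vectors span an ideal in diagonal form. -/
structure IsHermitianFrame (g : LinearMap.BilinForm ℝ 𝔤) (J : Module.End ℝ 𝔤)
    (v : Module.Basis (Fin 4) ℝ 𝔤) (ε₁ ε₂ : ℝ) (k : FrameConstants) : Prop where
  orthonormal : IsOrthonormalFamily g v ![ε₁, ε₁, ε₂, ε₂]
  J_zero : J (v 0) = v 1
  J_two : J (v 2) = v 3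
  b23 : ⁅v 2, v 3⁆ = k.p • v 1
  b31 : ⁅v 3, v 1⁆ = k.q • v 2
  b12 : ⁅v 1, v 2⁆ = k.r • v 3
  b01 : ⁅v 0, v 1⁆ = k.d11 • v 1 + k.d21 • v 2 + k.d31 • v 3
  b02 : ⁅v 0, v 2⁆ = k.d12 • v 1 + k.d22 • v 2 + k.d32 • v 3
  b03 : ⁅v 0, v 3⁆ = k.d13 • v 1 + k.d23 • v 2 + k.d33 • v 3

variable {V : Type*} [AddCommGroup V] [Module ℝ V]

lemma three_perms (H : V [⋀^Fin 3]→ₗ[ℝ] ℝ) (x y z : V) :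
    H ![y, x, z] = -H ![x, y, z] ∧ H ![x, z, y] = -H ![x, y, z] ∧ H ![y, z, x] = H ![x, y, z] ∧
      H ![z, x, y] = H ![x, y, z] ∧ H ![z, y, x] = -H ![x, y, z] := by
  refine ⟨three_swap_left H x y z, three_swap_right H x y z, ?_, ?_, ?_⟩
  · rw [three_swap_right H y x z, three_swap_left H x y z, neg_neg]
  · rw [three_swap_left H x z y, three_swap_right H x y z, neg_neg]
  · rw [three_swap_left H y z x, three_swap_right H y x z, three_swap_left H x y z, neg_neg]

lemma two_self (F : V [⋀^Fin 2]→ₗ[ℝ] ℝ) (x : V) : F ![x, x] = 0 :=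
  F.map_eq_zero_of_eq _ (i := 0) (j := 1) rfl (by decide)

lemma three_self_left (H : V [⋀^Fin 3]→ₗ[ℝ] ℝ) (x y : V) : H ![x, x, y] = 0 :=
  H.map_eq_zero_of_eq _ (i := 0) (j := 1) rfl (by decide)

lemma three_self_right (H : V [⋀^Fin 3]→ₗ[ℝ] ℝ) (x y : V) : H ![y, x, x] = 0 :=
  H.map_eq_zero_of_eq _ (i := 1) (j := 2) rfl (by decide)

lemma three_self_outer (H : V [⋀^Fin 3]→ₗ[ℝ] ℝ) (x y : V) : H ![x, y, x] = 0 :=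
  H.map_eq_zero_of_eq _ (i := 0) (j := 2) rfl (by decide)

/-- The values of a symmetric form on an orthonormal frame of type `(ε₁, ε₁, ε₂, ε₂)`. -/
lemma IsOrthonormalFamily.values {g : LinearMap.BilinForm ℝ V} {v : Fin 4 → V} {ε₁ ε₂ : ℝ}
    (h : IsOrthonormalFamily g v ![ε₁, ε₁, ε₂, ε₂]) :
    (g (v 0) (v 0) = ε₁ ∧ g (v 1) (v 1) = ε₁ ∧ g (v 2) (v 2) = ε₂ ∧ g (v 3) (v 3) = ε₂) ∧
    (g (v 0) (v 1) = 0 ∧ g (v 0) (v 2) = 0 ∧ g (v 0) (v 3) = 0 ∧ g (v 1) (v 2) = 0 ∧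
      g (v 1) (v 3) = 0 ∧ g (v 2) (v 3) = 0) ∧
    (g (v 1) (v 0) = 0 ∧ g (v 2) (v 0) = 0 ∧ g (v 3) (v 0) = 0 ∧ g (v 2) (v 1) = 0 ∧
      g (v 3) (v 1) = 0 ∧ g (v 3) (v 2) = 0) := by
  obtain ⟨-, h1, h2⟩ := h
  refine ⟨⟨h1 0, h1 1, h1 2, h1 3⟩, ⟨?_, ?_, ?_, ?_, ?_, ?_⟩, ⟨?_, ?_, ?_, ?_, ?_, ?_⟩⟩ <;>
    exact h2 _ _ (by decide)

variable {g : LinearMap.BilinForm ℝ 𝔤} {H : 𝔤 [⋀^Fin 3]→ₗ[ℝ] ℝ} {F : 𝔤 [⋀^Fin 2]→ₗ[ℝ] ℝ}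
  {Jp Jm : Module.End ℝ 𝔤} {Xp Xm : 𝔤} {c : ℝ} {v : Module.Basis (Fin 4) ℝ 𝔤} {ε₁ ε₂ : ℝ}
  {k : FrameConstants}

lemma IsHermitianFrame.sign_ne (h : IsHermitianFrame g Jm v ε₁ ε₂ k) : ε₁ ≠ 0 ∧ ε₂ ≠ 0 := by
  have h1 := h.orthonormal.1 0
  have h2 := h.orthonormal.1 2
  simp only [Matrix.cons_val] at h1 h2
  constructor
  · rcases h1 with h | h <;> rw [h] <;> norm_num
  · rcases h2 with h | h <;> rw [h] <;> norm_num

/-- The consequences of `∇⁺ J = 0` in a frame: integrability of `J` and the torsion. -/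
lemma IsHermitianFrame.torsion (h : IsHermitianFrame g Jm v ε₁ ε₂ k)
    (hJ : ∀ x, Jm (Jm x) = -x)
    (hp : ∀ x y z, koszul g H x (Jm y) z + koszul g H x y (Jm z) = 0) :
    (k.d12 = 0 ∧ k.d13 = 0 ∧ k.d23 = -k.d32 ∧ k.d33 - k.d22 = k.q - k.r) ∧
    H ![v 0, v 2, v 3] = 0 ∧ H ![v 0, v 1, v 3] = -(ε₂ * k.d31) ∧
      H ![v 0, v 1, v 2] = -(ε₂ * k.d21) ∧
      H ![v 1, v 2, v 3] = ε₂ * (k.d22 + k.d33) - ε₁ * k.p := by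
  obtain ⟨h1, h2⟩ := h.sign_ne
  obtain ⟨⟨g00, g11, g22, g33⟩, ⟨g01, g02, g03, g12, g13, g23⟩,
    ⟨g10, g20, g30, g21, g31, g32⟩⟩ := h.orthonormal.values
  have J3 : Jm (v 3) = -v 2 := by rw [← h.J_two, hJ]
  have b32 : ⁅v 3, v 2⁆ = -(k.p • v 1) := by rw [← lie_skew, h.b23]
  have b13 : ⁅v 1, v 3⁆ = -(k.q • v 2) := by rw [← lie_skew, h.b31]
  have b21 : ⁅v 2, v 1⁆ = -(k.r • v 3) := by rw [← lie_skew, h.b12]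
  have b10 : ⁅v 1, v 0⁆ = -(k.d11 • v 1 + k.d21 • v 2 + k.d31 • v 3) := by rw [← lie_skew, h.b01]
  have b20 : ⁅v 2, v 0⁆ = -(k.d12 • v 1 + k.d22 • v 2 + k.d32 • v 3) := by rw [← lie_skew, h.b02]
  have b30 : ⁅v 3, v 0⁆ = -(k.d13 • v 1 + k.d23 • v 2 + k.d33 • v 3) := by rw [← lie_skew, h.b03]
  obtain ⟨p1, p2, p3, p4, p5⟩ := three_perms H (v 0) (v 1) (v 2)
  obtain ⟨q1, q2, q3, q4, q5⟩ := three_perms H (v 0) (v 1) (v 3)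
  obtain ⟨r1, r2, r3, r4, r5⟩ := three_perms H (v 0) (v 2) (v 3)
  obtain ⟨s1, s2, s3, s4, s5⟩ := three_perms H (v 1) (v 2) (v 3)
  have neg : ∀ x y z, koszul g H x y (-z) = -koszul g H x y z := by
    intro x y z
    have : H ![x, y, -z] = -H ![x, y, z] := by
      rw [← contractThree_apply, map_neg, contractThree_apply]
    simp only [koszul, lie_neg, neg_lie, map_neg, LinearMap.neg_apply, this]
    ring
  -- With `J v₀ = v₁` and `J v₂ = v₃`, parallelism on the pairs `(v₀,v₃)` and `(v₀,v₂)` gives two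
  -- equations in each of four directions. Of these eight equations, four amount to relations
  -- between the structure constants and four determine the components of `H`.
  have eA : ∀ x, koszul g H x (v 1) (v 3) = koszul g H x (v 0) (v 2) := fun x => by
    have := hp x (v 0) (v 3)
    rw [h.J_zero, J3, neg] at this
    linarith
  have eB : ∀ x, koszul g H x (v 1) (v 2) = -koszul g H x (v 0) (v 3) := fun x => by
    have := hp x (v 0) (v 2)
    rw [h.J_zero, h.J_two] at this
    linarith
  have A0 := eA (v 0); have A1 := eA (v 1); have A2 := eA (v 2); have A3 := eA (v 3)
  have B0 := eB (v 0); have B1 := eB (v 1); have B2 := eB (v 2); have B3 := eB (v 3)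
  simp only [koszul, h.b01, h.b02, h.b03, h.b12, h.b23, h.b31, b32, b13, b21, b10, b20, b30,
    lie_self, map_zero, LinearMap.zero_apply, map_neg, map_add, map_smul, LinearMap.neg_apply,
    LinearMap.add_apply, LinearMap.smul_apply, smul_eq_mul, g00, g11, g22, g33, g01, g02, g03, g12,
    g13, g23, g10, g20, g30, g21, g31, g32, p1, p2, p3, p4, p5, q1, q2, q3, q4, q5, r1, r2, r3, r4,
    r5, s1, s2, s3, s4, s5, three_self_left, three_self_right, three_self_outer]
    at A0 A1 A2 A3 B0 B1 B2 B3
  have i1 : k.d12 = 0 := by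
    apply mul_left_cancel₀ h1; linarith
  have i2 : k.d13 = 0 := by
    apply mul_left_cancel₀ h1; linarith
  have i3 : k.d23 = -k.d32 := by
    apply mul_left_cancel₀ h2; linarith
  have i4 : k.d33 - k.d22 = k.q - k.r := by
    apply mul_left_cancel₀ h2; linarith
  rw [i1] at B0
  rw [i2] at A0
  rw [i3] at B2
  refine ⟨⟨i1, i2, i3, i4⟩, ?_, ?_, ?_, ?_⟩ <;> linarith

/-- The Jacobi identity in a frame adapted to an integrable complex structure. -/
lemma IsHermitianFrame.jacobi (h : IsHermitianFrame g Jm v ε₁ ε₂ k)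
    (h12 : k.d12 = 0) (h13 : k.d13 = 0) (h23 : k.d23 = -k.d32) :
    k.p * (k.d11 - k.d22 - k.d33) = 0 ∧ k.p * k.d21 = 0 ∧ k.p * k.d31 = 0 ∧
      k.q * (k.d22 - k.d33 - k.d11) = 0 ∧ k.r * (k.d33 - k.d11 - k.d22) = 0 ∧
      (k.q - k.r) * k.d32 = 0 := by
  obtain ⟨h1, h2⟩ := h.sign_ne
  obtain ⟨⟨g00, g11, g22, g33⟩, ⟨g01, g02, g03, g12, g13, g23⟩,
    ⟨g10, g20, g30, g21, g31, g32⟩⟩ := h.orthonormal.values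
  have b32 : ⁅v 3, v 2⁆ = -(k.p • v 1) := by rw [← lie_skew, h.b23]
  have b13 : ⁅v 1, v 3⁆ = -(k.q • v 2) := by rw [← lie_skew, h.b31]
  have b21 : ⁅v 2, v 1⁆ = -(k.r • v 3) := by rw [← lie_skew, h.b12]
  -- The Jacobi identity used here says that `ad (v 0)` is a derivation of the ideal.
  have j1 := leibniz_lie (v 0) (v 2) (v 3)
  have j2 := leibniz_lie (v 0) (v 3) (v 1)
  have j3 := leibniz_lie (v 0) (v 1) (v 2)
  simp only [h.b01, h.b02, h.b03, h.b12, h.b23, h.b31, b32, b13, b21, h12, h13, h23, add_lie,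
    lie_add, smul_lie, lie_smul, lie_self, zero_smul, zero_add, smul_zero, add_zero] at j1 j2 j3
  have t11 := congrArg (fun w => g w (v 1)) j1
  have t12 := congrArg (fun w => g w (v 2)) j1
  have t13 := congrArg (fun w => g w (v 3)) j1
  have t22 := congrArg (fun w => g w (v 2)) j2
  have t23 := congrArg (fun w => g w (v 3)) j2
  have t33 := congrArg (fun w => g w (v 3)) j3
  simp only [map_zero, LinearMap.zero_apply, map_neg, map_add, map_smul, LinearMap.neg_apply,
    LinearMap.add_apply, LinearMap.smul_apply, smul_eq_mul, g00, g11, g22, g33, g01, g02, g03, g12,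
    g13, g23, g10, g20, g30, g21, g31, g32] at t11 t12 t13 t22 t23 t33
  refine ⟨?_, ?_, ?_, ?_, ?_, ?_⟩
  · apply mul_left_cancel₀ h1; linarith
  · apply mul_left_cancel₀ h2; linarith
  · apply mul_left_cancel₀ h2; linarith
  · apply mul_left_cancel₀ h2; linarith
  · apply mul_left_cancel₀ h2; linarith
  · apply mul_left_cancel₀ h2; linarith

/-- `koszul` as a linear form in the middle argument. -/
lemma koszul_eq_sum (x y z : 𝔤) : koszul g H x y z = v.repr y 0 * koszul g H x (v 0) z
    + v.repr y 1 * koszul g H x (v 1) z + v.repr y 2 * koszul g H x (v 2) z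
    + v.repr y 3 * koszul g H x (v 3) z := by
  have key : ∀ y, koszul g H x y z = (g.flip z ∘ₗ LieAlgebra.ad ℝ 𝔤 x
      + g.flip x ∘ₗ LieAlgebra.ad ℝ 𝔤 z + g ⁅z, x⁆ + contractThree H z x) y := by
    intro y
    obtain ⟨-, -, -, h4, -⟩ := three_perms H x y z
    simp only [koszul, h4, LinearMap.add_apply, LinearMap.comp_apply, LinearMap.BilinForm.flip_apply,
      LieAlgebra.ad_apply, contractThree_apply, ← lie_skew y z, map_neg, LinearMap.neg_apply]
    ring
  rw [key, map_eq_sum_coord v _ y, Fin.sum_univ_four]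
  simp only [← key, Module.Basis.coord_apply, smul_eq_mul]

/-- The coefficients of `∇⁻ y` in a frame. -/
lemma IsHermitianFrame.connection (h : IsHermitianFrame g Jm v ε₁ ε₂ k)
    (hJ : ∀ x, Jm (Jm x) = -x)
    (hp : ∀ x y z, koszul g H x (Jm y) z + koszul g H x y (Jm z) = 0) (y : 𝔤) :
    (koszul g (-H) (v 0) y (v 1)
        = 2 * (-(v.repr y 2 * (ε₂ * k.d21)) - v.repr y 3 * (ε₂ * k.d31)) ∧
      koszul g (-H) (v 0) y (v 2) = 2 * (v.repr y 1 * (ε₂ * k.d21) - v.repr y 3 * (ε₂ * k.d32)) ∧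
      koszul g (-H) (v 0) y (v 3) = 2 * (v.repr y 1 * (ε₂ * k.d31) + v.repr y 2 * (ε₂ * k.d32))) ∧
    (koszul g (-H) (v 1) y (v 0) = 2 * (v.repr y 1 * (ε₁ * k.d11) + v.repr y 2 * (ε₂ * k.d21)
        + v.repr y 3 * (ε₂ * k.d31)) ∧
      koszul g (-H) (v 1) y (v 1) = 2 * -(v.repr y 0 * (ε₁ * k.d11)) ∧
      koszul g (-H) (v 1) y (v 2)
        = 2 * (-(v.repr y 0 * (ε₂ * k.d21)) - v.repr y 3 * (ε₂ * (k.q - k.d33))) ∧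
      koszul g (-H) (v 1) y (v 3)
        = 2 * (-(v.repr y 0 * (ε₂ * k.d31)) + v.repr y 2 * (ε₂ * (k.q - k.d33)))) ∧
    (koszul g (-H) (v 2) y (v 0) = 2 * (v.repr y 2 * (ε₂ * k.d22)) ∧
      koszul g (-H) (v 2) y (v 1) = 2 * -(v.repr y 3 * (ε₂ * k.d33 - ε₁ * k.p)) ∧
      koszul g (-H) (v 2) y (v 2) = 2 * -(v.repr y 0 * (ε₂ * k.d22)) ∧
      koszul g (-H) (v 2) y (v 3) = 2 * (v.repr y 1 * (ε₂ * k.d33 - ε₁ * k.p))) ∧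
    (koszul g (-H) (v 3) y (v 0) = 2 * (v.repr y 3 * (ε₂ * k.d33)) ∧
      koszul g (-H) (v 3) y (v 1) = 2 * -(v.repr y 2 * (ε₁ * k.p - ε₂ * k.d22)) ∧
      koszul g (-H) (v 3) y (v 2) = 2 * (v.repr y 1 * (ε₁ * k.p - ε₂ * k.d22)) ∧
      koszul g (-H) (v 3) y (v 3) = 2 * -(v.repr y 0 * (ε₂ * k.d33))) := by
  obtain ⟨⟨i12, i13, i23, i4⟩, H1, H2, H3, H0⟩ := h.torsion hJ hp
  obtain ⟨⟨g00, g11, g22, g33⟩, ⟨g01, g02, g03, g12, g13, g23⟩,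
    ⟨g10, g20, g30, g21, g31, g32⟩⟩ := h.orthonormal.values
  have b32 : ⁅v 3, v 2⁆ = -(k.p • v 1) := by rw [← lie_skew, h.b23]
  have b13 : ⁅v 1, v 3⁆ = -(k.q • v 2) := by rw [← lie_skew, h.b31]
  have b21 : ⁅v 2, v 1⁆ = -(k.r • v 3) := by rw [← lie_skew, h.b12]
  have b10 : ⁅v 1, v 0⁆ = -(k.d11 • v 1 + k.d21 • v 2 + k.d31 • v 3) := by rw [← lie_skew, h.b01]
  have b20 : ⁅v 2, v 0⁆ = -(k.d12 • v 1 + k.d22 • v 2 + k.d32 • v 3) := by rw [← lie_skew, h.b02]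
  have b30 : ⁅v 3, v 0⁆ = -(k.d13 • v 1 + k.d23 • v 2 + k.d33 • v 3) := by rw [← lie_skew, h.b03]
  obtain ⟨p1, p2, p3, p4, p5⟩ := three_perms H (v 0) (v 1) (v 2)
  obtain ⟨q1, q2, q3, q4, q5⟩ := three_perms H (v 0) (v 1) (v 3)
  obtain ⟨r1, r2, r3, r4, r5⟩ := three_perms H (v 0) (v 2) (v 3)
  obtain ⟨s1, s2, s3, s4, s5⟩ := three_perms H (v 1) (v 2) (v 3)
  have e1 : k.r = k.q - k.d33 + k.d22 := by linarith
  refine ⟨⟨?_, ?_, ?_⟩, ⟨?_, ?_, ?_, ?_⟩, ⟨?_, ?_, ?_, ?_⟩, ⟨?_, ?_, ?_, ?_⟩⟩ <;>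
  · rw [koszul_eq_sum (v := v)]
    simp only [koszul, h.b01, h.b02, h.b03, h.b12, h.b23, h.b31, b32, b13, b21, b10, b20, b30,
      lie_self, map_zero, LinearMap.zero_apply, map_neg, map_add, map_smul, LinearMap.neg_apply,
      LinearMap.add_apply, LinearMap.smul_apply, smul_eq_mul, g00, g11, g22, g33, g01, g02, g03,
      g12, g13, g23, g10, g20, g30, g21, g31, g32, p1, p2, p3, p4, p5, q1, q2, q3, q4, q5, r1, r2,
      r3, r4, r5, s1, s2, s3, s4, s5, three_self_left, three_self_right, three_self_outer,
      AlternatingMap.neg_apply, H0, H1, H2, H3, i12, i13, i23, e1]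
    ring

end Frames

/-! ### Rigidity: the structure constants forced by the two vectors `X₊`, `X₋`. -/

section Rigidity

variable {𝔤 : Type*} [LieRing 𝔤] [LieAlgebra ℝ 𝔤]
  {g : LinearMap.BilinForm ℝ 𝔤} {H : 𝔤 [⋀^Fin 3]→ₗ[ℝ] ℝ} {F : 𝔤 [⋀^Fin 2]→ₗ[ℝ] ℝ}
  {Jp Jm : Module.End ℝ 𝔤} {Xp Xm : 𝔤} {c : ℝ} {v : Module.Basis (Fin 4) ℝ 𝔤} {ε₁ ε₂ : ℝ}
  {k : FrameConstants}

lemma basis_four_sum {V : Type*} [AddCommGroup V] [Module ℝ V] (v : Module.Basis (Fin 4) ℝ V)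
    (x : V) : x = v.repr x 0 • v 0 + v.repr x 1 • v 1 + v.repr x 2 • v 2 + v.repr x 3 • v 3 := by
  conv_lhs => rw [← v.sum_repr x, Fin.sum_univ_four]

lemma IsOrthonormalFamily.form_eq {V : Type*} [AddCommGroup V] [Module ℝ V]
    {g : LinearMap.BilinForm ℝ V} {v : Module.Basis (Fin 4) ℝ V}
    (h : IsOrthonormalFamily g v ![ε₁, ε₁, ε₂, ε₂]) (x y : V) :
    g x y = ε₁ * (v.repr x 0 * v.repr y 0 + v.repr x 1 * v.repr y 1)
      + ε₂ * (v.repr x 2 * v.repr y 2 + v.repr x 3 * v.repr y 3) := by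
  obtain ⟨⟨g00, g11, g22, g33⟩, ⟨g01, g02, g03, g12, g13, g23⟩,
    ⟨g10, g20, g30, g21, g31, g32⟩⟩ := h.values
  conv_lhs => rw [basis_four_sum v x, basis_four_sum v y]
  simp only [map_add, map_smul, LinearMap.add_apply, LinearMap.smul_apply, smul_eq_mul, g00, g11,
    g22, g33, g01, g02, g03, g12, g13, g23, g10, g20, g30, g21, g31, g32]
  ring

lemma two_form_eq_sum (x y : 𝔤) : F ![x, y] = v.repr y 0 * F ![x, v 0]
    + v.repr y 1 * F ![x, v 1] + v.repr y 2 * F ![x, v 2] + v.repr y 3 * F ![x, v 3] := by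
  rw [← contractTwo_apply, map_eq_sum_coord v _ y, Fin.sum_univ_four]
  simp only [Module.Basis.coord_apply, smul_eq_mul, contractTwo_apply]

/-- For `c ≠ 0` the vectors `X₊`, `X₋` lie in the image of the skew-symmetric `J₊`, so a kernel
vector is orthogonal to both; on such vectors `J₊² = -1`. -/
lemma TensorIdentities.plus_injective (T : TensorIdentities H F g Jp Jm Xp Xm c) (hc : c ≠ 0)
    {x : 𝔤} (hx : Jp x = 0) : x = 0 := by
  have h1 : g Xp x = 0 := by
    have := T.plus_skew Xm x
    rw [hx, T.plus_Xm] at this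
    simpa [hc] using this
  have h2 : g Xm x = 0 := by
    have := T.plus_skew Xp x
    rw [hx, T.plus_Xp] at this
    simpa [hc] using this
  have := T.plus_sq x
  rw [hx, h1, h2] at this
  simpa using this

/-- `F` is of type (1,1) for `J₋`, so its mixed components repeat. -/
lemma IsHermitianFrame.form_relations (h : IsHermitianFrame g Jm v ε₁ ε₂ k)
    (T : TensorIdentities H F g Jp Jm Xp Xm c) :
    F ![v 1, v 3] = F ![v 0, v 2] ∧ F ![v 1, v 2] = -F ![v 0, v 3] := by
  have J3 : Jm (v 3) = -v 2 := by rw [← h.J_two, T.minus_sq]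
  have h1 := T.F_minus (v 0) (v 3)
  have h2 := T.F_minus (v 0) (v 2)
  rw [h.J_zero, J3, ← contractTwo_apply F (v 0), map_neg, contractTwo_apply] at h1
  rw [h.J_zero, h.J_two] at h2
  constructor <;> linarith

/-- `dH = 0` in a frame, when `F` is degenerate. -/
lemma IsHermitianFrame.closed (h : IsHermitianFrame g Jm v ε₁ ε₂ k)
    (T : TensorIdentities H F g Jp Jm Xp Xm c) (hX : Xp ≠ 0) :
    (k.d11 + k.d22 + k.d33) * (ε₂ * (k.d22 + k.d33) - ε₁ * k.p) = 0 := by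
  obtain ⟨⟨i12, i13, i23, i4⟩, H1, H2, H3, H0⟩ := h.torsion T.minus_sq T.parallel_minus
  obtain ⟨F13, F12⟩ := h.form_relations T
  have b13 : ⁅v 1, v 3⁆ = -(k.q • v 2) := by rw [← lie_skew, h.b31]
  have first : ∀ x y z, H ![x, y, z] = contractThree H y z x := fun x y z => by
    rw [contractThree_apply]
    exact (three_perms H x y z).2.2.1.symm
  have d := T.d_H (v 0) (v 1) (v 2) (v 3)
  simp only [first, h.b01, h.b02, h.b03, h.b12, h.b23, b13, map_add, map_smul, map_neg,
    smul_eq_mul] at d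
  obtain ⟨-, s2, s3, -, -⟩ := three_perms H (v 1) (v 2) (v 3)
  simp only [contractThree_apply, three_self_right, three_self_outer, s2, s3, H0, i12, i13, i23,
    F13, F12] at d
  have e0 := T.F_Xp (v 0)
  have e1 := T.F_Xp (v 1)
  have e2 := T.F_Xp (v 2)
  have e3 := T.F_Xp (v 3)
  rw [two_form_eq_sum (v := v)] at e0 e1 e2 e3
  rw [two_self] at e0 e1 e2 e3
  rw [two_swap F (v 0) (v 1), F13, F12] at e1
  rw [two_swap F (v 0) (v 2), two_swap F (v 1) (v 2), F12] at e2
  rw [two_swap F (v 0) (v 3), two_swap F (v 1) (v 3), two_swap F (v 2) (v 3), F13] at e3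
  set x0 := v.repr Xp 0
  set x1 := v.repr Xp 1
  set x2 := v.repr Xp 2
  set x3 := v.repr Xp 3
  set f := F ![v 0, v 1]
  set m := F ![v 0, v 2]
  set n := F ![v 0, v 3]
  set l := F ![v 2, v 3]
  -- This is the Pfaffian of `F`. If it were nonzero, Cramer's rule would give `X₊ = 0` from `F(·,
  -- X₊) = 0`. Its vanishing means `F ∧ F = 0`.
  have pf : f * l - m * m - n * n = 0 := by
    by_contra hne
    have z0 : x0 = 0 := by
      apply (mul_eq_zero.1 (_ : (f * l - m * m - n * n) * x0 = 0)).resolve_left hne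
      linear_combination (-l) * e1 + m * e2 + n * e3
    have z1 : x1 = 0 := by
      apply (mul_eq_zero.1 (_ : (f * l - m * m - n * n) * x1 = 0)).resolve_left hne
      linear_combination l * e0 - n * e2 + m * e3
    have z2 : x2 = 0 := by
      apply (mul_eq_zero.1 (_ : (f * l - m * m - n * n) * x2 = 0)).resolve_left hne
      linear_combination (-m) * e0 + n * e1 - f * e3
    have z3 : x3 = 0 := by
      apply (mul_eq_zero.1 (_ : (f * l - m * m - n * n) * x3 = 0)).resolve_left hne
      linear_combination (-n) * e0 - m * e1 + f * e2
    apply hX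
    rw [basis_four_sum v Xp]
    change x0 • v 0 + x1 • v 1 + x2 • v 2 + x3 • v 3 = 0
    rw [z0, z1, z2, z3]
    simp
  linear_combination -d + 2 * pf

lemma two_form_eq_zero (h01 : F ![v 0, v 1] = 0) (h02 : F ![v 0, v 2] = 0)
    (h03 : F ![v 0, v 3] = 0) (h12 : F ![v 1, v 2] = 0) (h13 : F ![v 1, v 3] = 0)
    (h23 : F ![v 2, v 3] = 0) : F = 0 := by
  refine v.ext_alternating fun w _ => ?_
  have : (fun i => v (w i)) = ![v (w 0), v (w 1)] := by ext1 i; fin_cases i <;> rfl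
  rw [this]
  generalize w 0 = i
  generalize w 1 = j
  have := two_swap F (v 0) (v 1)
  have := two_swap F (v 0) (v 2)
  have := two_swap F (v 0) (v 3)
  have := two_swap F (v 1) (v 2)
  have := two_swap F (v 1) (v 3)
  have := two_swap F (v 2) (v 3)
  fin_cases i <;> fin_cases j <;>
    simp only [Fin.zero_eta, Fin.mk_one, Fin.reduceFinMk, AlternatingMap.zero_apply] <;>
    first | exact two_self F _ | linarith

lemma three_form_eq_zero (h012 : H ![v 0, v 1, v 2] = 0) (h013 : H ![v 0, v 1, v 3] = 0)
    (h023 : H ![v 0, v 2, v 3] = 0) (h123 : H ![v 1, v 2, v 3] = 0) : H = 0 := by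
  refine v.ext_alternating fun w _ => ?_
  have : (fun i => v (w i)) = ![v (w 0), v (w 1), v (w 2)] := by ext1 i; fin_cases i <;> rfl
  rw [this]
  generalize w 0 = i
  generalize w 1 = j
  generalize w 2 = l
  obtain ⟨p1, p2, p3, p4, p5⟩ := three_perms H (v 0) (v 1) (v 2)
  obtain ⟨q1, q2, q3, q4, q5⟩ := three_perms H (v 0) (v 1) (v 3)
  obtain ⟨r1, r2, r3, r4, r5⟩ := three_perms H (v 0) (v 2) (v 3)
  obtain ⟨s1, s2, s3, s4, s5⟩ := three_perms H (v 1) (v 2) (v 3)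
  fin_cases i <;> fin_cases j <;> fin_cases l <;>
    simp only [Fin.zero_eta, Fin.mk_one, Fin.reduceFinMk, AlternatingMap.zero_apply] <;>
    first
    | exact three_self_left H _ _ | exact three_self_right H _ _ | exact three_self_outer H _ _
    | linarith

end Rigidity

section Rigidity

variable {𝔤 : Type*} [LieRing 𝔤] [LieAlgebra ℝ 𝔤]
  {g : LinearMap.BilinForm ℝ 𝔤} {H : 𝔤 [⋀^Fin 3]→ₗ[ℝ] ℝ} {F : 𝔤 [⋀^Fin 2]→ₗ[ℝ] ℝ}
  {Jp Jm : Module.End ℝ 𝔤} {Xp Xm : 𝔤} {c : ℝ} {v : Module.Basis (Fin 4) ℝ 𝔤} {ε₁ ε₂ : ℝ}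
  {k : FrameConstants}

/-- `[v 2, v 3] = 0`: the case of a nonzero bracket is excluded by the two vectors `X₊`, `X₋`. -/
lemma IsHermitianFrame.p_eq_zero (h : IsHermitianFrame g Jm v ε₁ ε₂ k)
    (T : TensorIdentities H F g Jp Jm Xp Xm c) (hc : c ≠ 0) (hXp : g Xp Xp ≠ 0)
    (hXm : g Xm Xm ≠ 0) : k.p = 0 := by
  by_contra hp
  obtain ⟨h1, h2⟩ := h.sign_ne
  obtain ⟨⟨i12, i13, i23, i4⟩, -⟩ := h.torsion T.minus_sq T.parallel_minus
  obtain ⟨j1, j2, j3, j4, j5, j6⟩ := h.jacobi i12 i13 i23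
  obtain ⟨F13, F12⟩ := h.form_relations T
  obtain ⟨⟨X01, X02, X03⟩, ⟨X10, X11, X12, X13⟩, ⟨X20, X21, X22, X23⟩, ⟨X30, X31, X32, X33⟩⟩ :=
    h.connection T.minus_sq T.parallel_minus Xp
  obtain ⟨-, -, ⟨Y20, Y21, Y22, Y23⟩, ⟨Y30, Y31, -, -⟩⟩ :=
    h.connection T.minus_sq T.parallel_minus Xm
  rw [T.parallel_Xp] at X01 X02 X03 X10 X11 X12 X13 X20 X21 X22 X23 X30 X31 X32 X33
  rw [two_self] at X11 X22 X33
  rw [two_swap F (v 0) (v 1)] at X10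
  rw [two_swap F (v 0) (v 2)] at X20
  rw [two_swap F (v 0) (v 3)] at X30
  rw [two_swap F (v 1) (v 2), F12] at X21
  rw [two_swap F (v 1) (v 3), F13] at X31
  rw [two_swap F (v 2) (v 3)] at X32
  rw [F12] at X12
  rw [F13] at X13
  have Npp := h.orthonormal.form_eq Xp Xp
  have Nmm := h.orthonormal.form_eq Xm Xm
  have Npm := h.orthonormal.form_eq Xp Xm
  rw [T.orthogonal] at Npm
  have d21 : k.d21 = 0 := (mul_eq_zero.1 j2).resolve_left hp
  have d31 : k.d31 = 0 := (mul_eq_zero.1 j3).resolve_left hp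
  rw [d21] at X01 X02 X10 X12
  rw [d31] at X01 X03 X10 X13
  have hcp : ε₁ * k.p ≠ 0 := mul_ne_zero h1 hp
  -- Each mixed component of `F` occurs in two of the equations for `∇⁻X₊`; eliminating it leaves
  -- `ε₁ p` times a coordinate of `X₊`.
  have x3 : v.repr Xp 3 = 0 := by
    apply (mul_eq_zero.1 (_ : v.repr Xp 3 * (ε₁ * k.p) = 0)).resolve_right hcp
    linear_combination (-1 / 2 : ℝ) * (X30 + X21)
  have x2 : v.repr Xp 2 = 0 := by
    apply (mul_eq_zero.1 (_ : v.repr Xp 2 * (ε₁ * k.p) = 0)).resolve_right hcp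
    linear_combination (1 / 2 : ℝ) * (X31 - X20)
  rw [x2] at X20 Npp Npm
  rw [x3] at X30 Npp Npm X01
  rw [x2] at X01
  have hF02 : F ![v 0, v 2] = 0 := by
    apply mul_left_cancel₀ hc; linear_combination (-1 / 2 : ℝ) * X20
  have hF03 : F ![v 0, v 3] = 0 := by
    apply mul_left_cancel₀ hc; linear_combination (-1 / 2 : ℝ) * X30
  -- `X₊` is now in the plane of `v 0`, `v 1`, and being non-null it has a nonzero coordinate by
  -- which the next equations may be divided.
  have hx : v.repr Xp 0 ≠ 0 ∨ v.repr Xp 1 ≠ 0 := by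
    by_contra! hx
    apply hXp
    rw [Npp, hx.1, hx.2]; ring
  have x0a : v.repr Xp 0 * k.d11 = 0 := by
    apply mul_left_cancel₀ h1; linear_combination (1 / 2 : ℝ) * X11
  have x1a : v.repr Xp 1 * k.d11 = 0 := by
    apply mul_left_cancel₀ h1; rw [x2, x3] at X10
    linear_combination (-1 / 2 : ℝ) * X10 - (1 / 2 : ℝ) * X01
  have x0b : v.repr Xp 0 * k.d22 = 0 := by
    apply mul_left_cancel₀ h2; linear_combination (1 / 2 : ℝ) * X22
  have x0e : v.repr Xp 0 * k.d33 = 0 := by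
    apply mul_left_cancel₀ h2; linear_combination (1 / 2 : ℝ) * X33
  have x1e : v.repr Xp 1 * (k.d33 - k.d22) = 0 := by
    apply mul_left_cancel₀ h2; linear_combination (-1 / 2 : ℝ) * (X23 + X32)
  have d11 : k.d11 = 0 := by
    rcases hx with hx | hx
    · exact (mul_eq_zero.1 x0a).resolve_left hx
    · exact (mul_eq_zero.1 x1a).resolve_left hx
  have be := (mul_eq_zero.1 j1).resolve_left hp
  have d22 : k.d22 = 0 := by
    rcases hx with hx | hx
    · exact (mul_eq_zero.1 x0b).resolve_left hx
    · have := (mul_eq_zero.1 x1e).resolve_left hx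
      linarith
  have d33 : k.d33 = 0 := by linarith
  rw [hF02] at F13
  rw [hF03, neg_zero] at F12
  have a2 : ∀ w, F ![v 2, w] = v.repr w 3 * F ![v 2, v 3] := fun w => by
    rw [two_form_eq_sum (v := v), two_self, two_swap F (v 0) (v 2), two_swap F (v 1) (v 2), hF02,
      F12]
    ring
  have a3 : ∀ w, F ![v 3, w] = -(v.repr w 2 * F ![v 2, v 3]) := fun w => by
    rw [two_form_eq_sum (v := v), two_self, two_swap F (v 0) (v 3), two_swap F (v 1) (v 3),
      two_swap F (v 2) (v 3), hF03, F13]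
    ring
  rw [T.parallel_Xm, a2] at Y20 Y21 Y22 Y23
  rw [T.parallel_Xm, a3] at Y30 Y31
  rw [d22] at Y20 Y22 Y31
  rw [d33] at Y21 Y23 Y30 X23
  -- If this last relevant component of `F` vanishes, `X₊` and `X₋` are both multiples of `v 0`,
  -- which contradicts orthogonality.
  by_cases hκ : F ![v 2, v 3] = 0
  · rw [hκ] at X23 Y20 Y21 Y22 Y23 Y30 Y31
    have x1 : v.repr Xp 1 = 0 := by
      apply (mul_eq_zero.1 (_ : v.repr Xp 1 * (ε₁ * k.p) = 0)).resolve_right hcp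
      linear_combination (1 / 2 : ℝ) * X23
    have y1 : v.repr Xm 1 = 0 := by
      apply (mul_eq_zero.1 (_ : v.repr Xm 1 * (ε₁ * k.p) = 0)).resolve_right hcp
      linear_combination (1 / 2 : ℝ) * Y23
    have y2 : v.repr Xm 2 = 0 := by
      apply (mul_eq_zero.1 (_ : v.repr Xm 2 * (ε₁ * k.p) = 0)).resolve_right hcp
      linear_combination (1 / 2 : ℝ) * Y31
    have y3 : v.repr Xm 3 = 0 := by
      apply (mul_eq_zero.1 (_ : v.repr Xm 3 * (ε₁ * k.p) = 0)).resolve_right hcp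
      linear_combination (-1 / 2 : ℝ) * Y21
    rw [x1] at Npp Npm
    rw [y1, y2, y3] at Nmm
    have h0 : ε₁ * (v.repr Xp 0 * v.repr Xm 0) = 0 := by linear_combination -Npm
    rcases mul_eq_zero.1 ((mul_eq_zero.1 h0).resolve_left h1) with h0 | h0
    · apply hXp; rw [Npp, h0]; ring
    · apply hXm; rw [Nmm, h0]; ring
  -- Otherwise `F(v₂, J₊ z)` and `F(v₃, J₊ z)`, known from `∇⁻X₋`, reveal entries of `J₊`. With
  -- skewness, `J₊ v₂` and `J₊ v₃` become multiples of `v₁`, which is impossible for an injective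
  -- `J₊`.
  · have z03 : v.repr (Jp (v 0)) 3 = 0 := by
      apply mul_right_cancel₀ hκ; linear_combination (1 / 2 : ℝ) * Y20
    have z02 : v.repr (Jp (v 0)) 2 = 0 := by
      apply mul_right_cancel₀ hκ; linear_combination (-1 / 2 : ℝ) * Y30
    have z23 : v.repr (Jp (v 2)) 3 = 0 := by
      apply mul_right_cancel₀ hκ; linear_combination (1 / 2 : ℝ) * Y22
    have gl : ∀ i w, g (v i) w = ![ε₁, ε₁, ε₂, ε₂] i * v.repr w i := fun i w => by
      rw [h.orthonormal.form_eq]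
      fin_cases i <;> simp
    have gr : ∀ i w, g w (v i) = ![ε₁, ε₁, ε₂, ε₂] i * v.repr w i := fun i w => by
      rw [T.symm, gl]
    have s : ∀ i j, ![ε₁, ε₁, ε₂, ε₂] j * v.repr (Jp (v i)) j
        = -(![ε₁, ε₁, ε₂, ε₂] i * v.repr (Jp (v j)) i) := fun i j => by
      rw [← gl, ← gr, T.plus_skew, neg_neg]
    have s20 := s 2 0
    have s30 := s 3 0
    have s22 := s 2 2
    have s32 := s 3 2
    have s33 := s 3 3
    simp only [Matrix.cons_val, z03, z02, z23] at s20 s30 s22 s32 s33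
    have z20 : v.repr (Jp (v 2)) 0 = 0 := by apply mul_left_cancel₀ h1; linarith
    have z30 : v.repr (Jp (v 3)) 0 = 0 := by apply mul_left_cancel₀ h1; linarith
    have z22 : v.repr (Jp (v 2)) 2 = 0 := by apply mul_left_cancel₀ h2; linarith
    have z32 : v.repr (Jp (v 3)) 2 = 0 := by apply mul_left_cancel₀ h2; linarith
    have z33 : v.repr (Jp (v 3)) 3 = 0 := by apply mul_left_cancel₀ h2; linarith
    have e2 : Jp (v 2) = v.repr (Jp (v 2)) 1 • v 1 := by
      conv_lhs => rw [basis_four_sum v (Jp (v 2)), z20, z22, z23]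
      simp
    have e3 : Jp (v 3) = v.repr (Jp (v 3)) 1 • v 1 := by
      conv_lhs => rw [basis_four_sum v (Jp (v 3)), z30, z32, z33]
      simp
    have aux : ∀ r s : ℝ, Jp (v 2) = r • v 1 → Jp (v 3) = s • v 1 →
        Jp (s • v 2 - r • v 3) = 0 := fun r s hr hs => by
      rw [map_sub, map_smul, map_smul, hr, hs, smul_smul, smul_smul, mul_comm, sub_self]
    have hz := T.plus_injective hc (aux _ _ e2 e3)
    have hz3 := congrArg (fun w => v.repr w 3) hz
    simp at hz3
    rw [hz3, zero_smul] at e2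
    exact v.ne_zero 2 (T.plus_injective hc e2)

end Rigidity

section Rigidity

variable {𝔤 : Type*} [LieRing 𝔤] [LieAlgebra ℝ 𝔤]
  {g : LinearMap.BilinForm ℝ 𝔤} {H : 𝔤 [⋀^Fin 3]→ₗ[ℝ] ℝ} {F : 𝔤 [⋀^Fin 2]→ₗ[ℝ] ℝ}
  {Jp Jm : Module.End ℝ 𝔤} {Xp Xm : 𝔤} {c : ℝ} {v : Module.Basis (Fin 4) ℝ 𝔤} {ε₁ ε₂ : ℝ}
  {k : FrameConstants}

/-- The brackets `[v 3, v 1]` and `[v 1, v 2]` have the same eigenvalue. -/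
lemma IsHermitianFrame.q_eq_r (h : IsHermitianFrame g Jm v ε₁ ε₂ k)
    (T : TensorIdentities H F g Jp Jm Xp Xm c) (hc : c ≠ 0) (hXp : g Xp Xp ≠ 0)
    (hXm : g Xm Xm ≠ 0) (hp : k.p = 0) : k.q = k.r := by
  by_contra hqr
  obtain ⟨h1, h2⟩ := h.sign_ne
  obtain ⟨⟨i12, i13, i23, i4⟩, -⟩ := h.torsion T.minus_sq T.parallel_minus
  obtain ⟨-, -, -, j4, j5, j6⟩ := h.jacobi i12 i13 i23
  obtain ⟨F13, F12⟩ := h.form_relations T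
  obtain ⟨⟨X01, X02, X03⟩, ⟨X10, X11, X12, X13⟩, ⟨X20, X21, X22, X23⟩, ⟨X30, X31, X32, X33⟩⟩ :=
    h.connection T.minus_sq T.parallel_minus Xp
  obtain ⟨-, -, ⟨Y20, Y21, Y22, Y23⟩, ⟨-, -, Y32, Y33⟩⟩ :=
    h.connection T.minus_sq T.parallel_minus Xm
  rw [T.parallel_Xp] at X02 X03 X11 X12 X13 X20 X21 X23 X32
  rw [two_self] at X11
  rw [two_swap F (v 0) (v 2)] at X20
  rw [two_swap F (v 1) (v 2)] at X21
  rw [two_swap F (v 2) (v 3)] at X32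
  rw [F12] at X12 X21
  rw [F13] at X13
  have Npp := h.orthonormal.form_eq Xp Xp
  have Nmm := h.orthonormal.form_eq Xm Xm
  have Npm := h.orthonormal.form_eq Xp Xm
  rw [T.orthogonal] at Npm
  have hqr' : k.q - k.r ≠ 0 := sub_ne_zero.2 hqr
  have β : k.d32 = 0 := (mul_eq_zero.1 j6).resolve_left hqr'
  -- Adding the two equations that contain `F(v₂,v₃)` leaves `d33 - d22 = q - r` times this
  -- coordinate.
  have x1 : v.repr Xp 1 = 0 := by
    apply (mul_eq_zero.1 (_ : v.repr Xp 1 * (ε₂ * (k.q - k.r)) = 0)).resolve_right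
      (mul_ne_zero h2 hqr')
    rw [← i4]
    rw [hp] at X23 X32
    linear_combination (-1 / 2 : ℝ) * (X23 + X32)
  have κ : F ![v 2, v 3] = 0 := by
    apply mul_left_cancel₀ hc
    rw [x1] at X23
    linear_combination (1 / 2 : ℝ) * X23
  -- If `d11` were zero, the Jacobi identity would give `q (q - r) = 0` and `r (q - r) = 0`, hence
  -- `q = r = 0`.
  have a : k.d11 ≠ 0 := fun a => by
    rw [a] at j4 j5
    have q0 : k.q = 0 := by
      apply (mul_eq_zero.1 (_ : k.q * (k.q - k.r) = 0)).resolve_right hqr'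
      rw [← i4]; linear_combination -j4
    have r0 : k.r = 0 := by
      apply (mul_eq_zero.1 (_ : k.r * (k.q - k.r) = 0)).resolve_right hqr'
      rw [← i4]; linear_combination j5
    exact hqr (q0.trans r0.symm)
  have x0 : v.repr Xp 0 = 0 := by
    apply (mul_eq_zero.1 (_ : v.repr Xp 0 * (ε₁ * k.d11) = 0)).resolve_right (mul_ne_zero h1 a)
    linear_combination (1 / 2 : ℝ) * X11
  have m : F ![v 0, v 2] = 0 := by
    apply mul_left_cancel₀ hc
    rw [x1, β] at X02
    linear_combination (1 / 2 : ℝ) * X02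
  have n : F ![v 0, v 3] = 0 := by
    apply mul_left_cancel₀ hc
    rw [x1, β] at X03
    linear_combination (1 / 2 : ℝ) * X03
  rw [m] at F13 X13 X20
  rw [n] at X12 X21
  rw [n, neg_zero] at F12
  rw [x0] at X12 X13 Npp Npm
  rw [x1] at Npp Npm
  rw [hp] at X21
  have x2b : v.repr Xp 2 * k.d22 = 0 := by
    apply mul_left_cancel₀ h2; linear_combination (-1 / 2 : ℝ) * X20
  have x3e : v.repr Xp 3 * k.d33 = 0 := by
    apply mul_left_cancel₀ h2; linear_combination (1 / 2 : ℝ) * X21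
  have a2 : ∀ w, F ![v 2, w] = 0 := fun w => by
    rw [two_form_eq_sum (v := v), two_self, two_swap F (v 0) (v 2), two_swap F (v 1) (v 2), m,
      F12, κ]
    ring
  have a3 : ∀ w, F ![v 3, w] = 0 := fun w => by
    rw [two_form_eq_sum (v := v), two_self, two_swap F (v 0) (v 3), two_swap F (v 1) (v 3),
      two_swap F (v 2) (v 3), n, F13, κ]
    ring
  rw [T.parallel_Xm, a2, hp] at Y21 Y23
  rw [T.parallel_Xm, a2] at Y20 Y22
  rw [T.parallel_Xm, a3, hp] at Y32
  rw [T.parallel_Xm, a3] at Y33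
  have y0b : v.repr Xm 0 * k.d22 = 0 := by
    apply mul_left_cancel₀ h2; linear_combination (1 / 2 : ℝ) * Y22
  have y1b : v.repr Xm 1 * k.d22 = 0 := by
    apply mul_left_cancel₀ h2; linear_combination (1 / 2 : ℝ) * Y32
  have y2b : v.repr Xm 2 * k.d22 = 0 := by
    apply mul_left_cancel₀ h2; linear_combination (-1 / 2 : ℝ) * Y20
  have y0e : v.repr Xm 0 * k.d33 = 0 := by
    apply mul_left_cancel₀ h2; linear_combination (1 / 2 : ℝ) * Y33
  have y1e : v.repr Xm 1 * k.d33 = 0 := by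
    apply mul_left_cancel₀ h2; linear_combination (-1 / 2 : ℝ) * Y23
  have y3e : v.repr Xm 3 * k.d33 = 0 := by
    apply mul_left_cancel₀ h2; linear_combination (1 / 2 : ℝ) * Y21
  -- Since `d33 - d22 = q - r ≠ 0`, at least one of `d22`, `d33` is nonzero. Both `X₊` and `X₋` are
  -- multiples of `v 2` in the first case and of `v 3` in the second, against orthogonality.
  by_cases b : k.d22 = 0
  · have e : k.d33 ≠ 0 := fun e => hqr' (by rw [← i4, e, b, sub_zero])
    rw [(mul_eq_zero.1 x3e).resolve_right e] at Npp Npm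
    rw [(mul_eq_zero.1 y0e).resolve_right e, (mul_eq_zero.1 y1e).resolve_right e,
      (mul_eq_zero.1 y3e).resolve_right e] at Nmm
    have h0 : ε₂ * (v.repr Xp 2 * v.repr Xm 2) = 0 := by linear_combination -Npm
    rcases mul_eq_zero.1 ((mul_eq_zero.1 h0).resolve_left h2) with h0 | h0
    · apply hXp; rw [Npp, h0]; ring
    · apply hXm; rw [Nmm, h0]; ring
  · rw [(mul_eq_zero.1 x2b).resolve_right b] at Npp Npm
    rw [(mul_eq_zero.1 y0b).resolve_right b, (mul_eq_zero.1 y1b).resolve_right b,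
      (mul_eq_zero.1 y2b).resolve_right b] at Nmm
    have h0 : ε₂ * (v.repr Xp 3 * v.repr Xm 3) = 0 := by linear_combination -Npm
    rcases mul_eq_zero.1 ((mul_eq_zero.1 h0).resolve_left h2) with h0 | h0
    · apply hXp; rw [Npp, h0]; ring
    · apply hXm; rw [Nmm, h0]; ring

/-- An adapted structure on a non-abelian ideal: the Lie algebra is special, the twisting forms
vanish, and `X₊`, `X₋` lie in the plane of the first two vectors of the frame. -/
lemma IsHermitianFrame.rigid (h : IsHermitianFrame g Jm v ε₁ ε₂ k)
    (T : TensorIdentities H F g Jp Jm Xp Xm c) (hc : c ≠ 0) (hXp : g Xp Xp ≠ 0)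
    (hXm : g Xm Xm ≠ 0) (hna : k.p ≠ 0 ∨ k.q ≠ 0 ∨ k.r ≠ 0) :
    (k.p = 0 ∧ k.q = k.r ∧ k.q ≠ 0) ∧ (k.d11 = 0 ∧ k.d21 = 0 ∧ k.d31 = 0) ∧
      (k.d12 = 0 ∧ k.d22 = 0) ∧ (k.d13 = 0 ∧ k.d23 = -k.d32 ∧ k.d33 = 0) ∧ F = 0 ∧ H = 0 ∧
      (v.repr Xp 2 = 0 ∧ v.repr Xp 3 = 0) ∧ v.repr Xm 2 = 0 ∧ v.repr Xm 3 = 0 := by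
  have hp := h.p_eq_zero T hc hXp hXm
  have hqr := h.q_eq_r T hc hXp hXm hp
  have hq : k.q ≠ 0 := by
    rcases hna with h | h | h
    · exact absurd hp h
    · exact h
    · rwa [hqr]
  obtain ⟨h1, h2⟩ := h.sign_ne
  obtain ⟨⟨i12, i13, i23, i4⟩, H1, H2, H3, H0⟩ := h.torsion T.minus_sq T.parallel_minus
  obtain ⟨-, -, -, j4, -, -⟩ := h.jacobi i12 i13 i23
  have hX : Xp ≠ 0 := by rintro rfl; simp at hXp
  have cl := h.closed T hX
  rw [hqr, sub_self] at i4
  have a : k.d11 = 0 := by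
    have := (mul_eq_zero.1 j4).resolve_left hq
    linarith
  have eb : k.d33 = k.d22 := by linarith
  -- With `p = d11 = 0` and `d33 = d22` the closedness of `H` reads `4 ε₂ d22² = 0`.
  have b : k.d22 = 0 := by
    rw [a, eb, hp] at cl
    apply pow_eq_zero_iff (n := 2) (by norm_num) |>.1
    apply mul_left_cancel₀ h2
    linear_combination (1 / 4 : ℝ) * cl
  have e : k.d33 = 0 := eb.trans b
  have hF : F = 0 := by
    obtain ⟨F13, F12⟩ := h.form_relations T
    obtain ⟨⟨X01, -, -⟩, ⟨-, -, X12, X13⟩, ⟨X20, X21, -, X23⟩, -⟩ :=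
      h.connection T.minus_sq T.parallel_minus Xp
    rw [T.parallel_Xp] at X01 X12 X13 X20 X21 X23
    rw [two_swap F (v 0) (v 2), b] at X20
    rw [two_swap F (v 1) (v 2), F12, e, hp] at X21
    rw [e, hp] at X23
    have m : F ![v 0, v 2] = 0 := by
      apply mul_left_cancel₀ hc; linear_combination (-1 / 2 : ℝ) * X20
    have n : F ![v 0, v 3] = 0 := by
      apply mul_left_cancel₀ hc; linear_combination (1 / 2 : ℝ) * X21
    rw [m] at F13
    rw [n, neg_zero] at F12
    rw [F12, e] at X12
    rw [F13, e] at X13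
    refine two_form_eq_zero (v := v) ?_ m n F12 F13 ?_
    -- Writing `xᵢ` for the coordinates of `X₊`, `X12` and `X13` say `q x₃ = -x₀ d21` and `q x₂ = x₀
    -- d31`; inserted into `q` times `X01`, the two terms cancel.
    · apply mul_left_cancel₀ (mul_ne_zero hq hc)
      linear_combination (k.q / 2) * X01 + (k.d21 / 2) * X13 - (k.d31 / 2) * X12
    · apply mul_left_cancel₀ hc; linear_combination (1 / 2 : ℝ) * X23
  subst hF
  -- With `F = 0` both `X₊` and `X₋` are `∇⁻`-parallel; these are the consequences in the directions
  -- `v 0` and `v 1`.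
  have key : ∀ y, (∀ x z, koszul g (-H) x y z = 0) →
      (k.q * v.repr y 2 = v.repr y 0 * k.d31 ∧ k.q * v.repr y 3 = -(v.repr y 0 * k.d21)) ∧
      k.q * (v.repr y 1 * k.d21) = -(v.repr y 0 * k.d21 * k.d32) ∧
      k.q * (v.repr y 1 * k.d31) = -(v.repr y 0 * k.d31 * k.d32) := by
    intro y hy
    obtain ⟨⟨-, Y02, Y03⟩, ⟨-, -, Y12, Y13⟩, -, -⟩ := h.connection T.minus_sq T.parallel_minus y
    rw [hy] at Y02 Y03
    rw [hy, e] at Y12 Y13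
    have y2 : k.q * v.repr y 2 = v.repr y 0 * k.d31 := by
      apply mul_left_cancel₀ h2; linear_combination (-1 / 2 : ℝ) * Y13
    have y3 : k.q * v.repr y 3 = -(v.repr y 0 * k.d21) := by
      apply mul_left_cancel₀ h2; linear_combination (1 / 2 : ℝ) * Y12
    refine ⟨⟨y2, y3⟩, ?_, ?_⟩
    · apply mul_left_cancel₀ h2
      linear_combination (-k.q / 2) * Y02 + ε₂ * k.d32 * y3
    · apply mul_left_cancel₀ h2
      linear_combination (-k.q / 2) * Y03 - ε₂ * k.d32 * y2
  obtain ⟨⟨x2, x3⟩, x1s, x1t⟩ := key Xp fun x z => by simp [T.parallel_Xp]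
  obtain ⟨⟨y2, y3⟩, y1s, y1t⟩ := key Xm fun x z => by simp [T.parallel_Xm]
  have st : k.d21 = 0 ∧ k.d31 = 0 := by
    by_contra hst
    rw [not_and_or] at hst
    have x1 : k.q * v.repr Xp 1 = -(v.repr Xp 0 * k.d32) := by
      rcases hst with hs | hs
      · apply mul_right_cancel₀ hs; linear_combination x1s
      · apply mul_right_cancel₀ hs; linear_combination x1t
    have y1 : k.q * v.repr Xm 1 = -(v.repr Xm 0 * k.d32) := by
      rcases hst with hs | hs
      · apply mul_right_cancel₀ hs; linear_combination y1s
      · apply mul_right_cancel₀ hs; linear_combination y1t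
    -- If `d21` or `d31` is nonzero, `X₊` and `X₋` are both multiples of `q v₀ - d32 v₁ + d31 v₂ -
    -- d21 v₃`. Non-nullness makes all factors in this formula nonzero, contradicting orthogonality.
    have N : ∀ z w : 𝔤, k.q * v.repr z 1 = -(v.repr z 0 * k.d32) →
        k.q * v.repr z 2 = v.repr z 0 * k.d31 → k.q * v.repr z 3 = -(v.repr z 0 * k.d21) →
        k.q * v.repr w 1 = -(v.repr w 0 * k.d32) →
        k.q * v.repr w 2 = v.repr w 0 * k.d31 → k.q * v.repr w 3 = -(v.repr w 0 * k.d21) →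
        k.q ^ 2 * g z w = v.repr z 0 * v.repr w 0 *
          (ε₁ * (k.q ^ 2 + k.d32 ^ 2) + ε₂ * (k.d31 ^ 2 + k.d21 ^ 2)) := by
      intro z w z1 z2 z3 w1 w2 w3
      rw [h.orthonormal.form_eq]
      have e1 := congrArg₂ (· * ·) z1 w1
      have e2 := congrArg₂ (· * ·) z2 w2
      have e3 := congrArg₂ (· * ·) z3 w3
      linear_combination ε₁ * e1 + ε₂ * (e2 + e3)
    have Npp := N Xp Xp x1 x2 x3 x1 x2 x3
    have Nmm := N Xm Xm y1 y2 y3 y1 y2 y3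
    have Npm := N Xp Xm x1 x2 x3 y1 y2 y3
    have n1 := mul_ne_zero (pow_ne_zero 2 hq) hXp
    have n2 := mul_ne_zero (pow_ne_zero 2 hq) hXm
    rw [Npp] at n1
    rw [Nmm] at n2
    rw [T.orthogonal, mul_zero, eq_comm] at Npm
    exact mul_ne_zero (mul_ne_zero (left_ne_zero_of_mul (left_ne_zero_of_mul n1))
      (left_ne_zero_of_mul (left_ne_zero_of_mul n2))) (right_ne_zero_of_mul n1) Npm
  rw [st.1] at H3 x3 y3
  rw [st.2] at H2 x2 y2
  rw [b, e, hp] at H0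
  refine ⟨⟨hp, hqr, hq⟩, ⟨a, st.1, st.2⟩, ⟨i12, b⟩, ⟨i13, i23, e⟩, rfl, ?_, ⟨?_, ?_⟩, ?_, ?_⟩
  · refine three_form_eq_zero (v := v) ?_ ?_ H1 ?_
    · rw [H3]; ring
    · rw [H2]; ring
    · rw [H0]; ring
  · apply mul_left_cancel₀ hq; linear_combination x2
  · apply mul_left_cancel₀ hq; linear_combination x3
  · apply mul_left_cancel₀ hq; linear_combination y2
  · apply mul_left_cancel₀ hq; linear_combination y3

end Rigidity

/-! ### Orthonormal families in indefinite signature. -/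

section Orthonormal

variable {ι V : Type*} [AddCommGroup V] [Module ℝ V] {g : LinearMap.BilinForm ℝ V} {δ : ι → ℝ}

lemma IsOrthonormalFamily.sign_mul_self {v : ι → V} (h : IsOrthonormalFamily g v δ) (i : ι) :
    δ i * δ i = 1 := by
  rcases h.1 i with h | h <;> rw [h] <;> norm_num

lemma IsOrthonormalFamily.repr_eq [Finite ι] {v : Module.Basis ι ℝ V}
    (h : IsOrthonormalFamily g v δ) (x : V) (i : ι) : v.repr x i = δ i * g x (v i) := by
  classical
  have := Fintype.ofFinite ι
  conv_rhs => rw [← v.sum_repr x]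
  rw [map_sum, LinearMap.sum_apply, Finset.sum_eq_single i]
  · rw [map_smul, LinearMap.smul_apply, h.2.1, smul_eq_mul, mul_left_comm, h.sign_mul_self, mul_one]
  · intro j _ hj
    rw [map_smul, LinearMap.smul_apply, h.2.2 j i hj, smul_zero]
  · simp

lemma IsOrthonormalFamily.exists_basis [Fintype ι] [Nonempty ι] {v : ι → V}
    (h : IsOrthonormalFamily g v δ) (hc : Fintype.card ι = Module.finrank ℝ V) :
    ∃ b : Module.Basis ι ℝ V, (b : ι → V) = v := by
  have hl : LinearIndependent ℝ v := by
    refine LinearMap.linearIndependent_of_isOrthoᵢ (B := g) (fun i j hij => h.2.2 i j hij) fun i => ?_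
    rw [h.2.1]
    rcases h.1 i with h | h <;> rw [h] <;> norm_num
  exact ⟨basisOfLinearIndependentOfCardEqFinrank hl hc,
    coe_basisOfLinearIndependentOfCardEqFinrank hl hc⟩

lemma IsOrthonormalFamily.trace_eq [Fintype ι] {v : Module.Basis ι ℝ V}
    (h : IsOrthonormalFamily g v δ) (f : Module.End ℝ V) :
    LinearMap.trace ℝ V f = ∑ i, δ i * g (f (v i)) (v i) := by
  classical
  rw [LinearMap.trace_eq_matrix_trace ℝ v]
  simp only [Matrix.trace, Matrix.diag, LinearMap.toMatrix_apply, h.repr_eq]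

lemma exists_smul_unit {x : V} (hx : g x x ≠ 0) :
    ∃ a : ℝ, a ≠ 0 ∧ (g (a • x) (a • x) = 1 ∨ g (a • x) (a • x) = -1) := by
  have h1 : (0 : ℝ) < |g x x| := abs_pos.2 hx
  have h2 : (Real.sqrt |g x x|)⁻¹ * (Real.sqrt |g x x|)⁻¹ = |g x x|⁻¹ := by
    rw [← mul_inv, Real.mul_self_sqrt h1.le]
  refine ⟨(Real.sqrt |g x x|)⁻¹, inv_ne_zero (Real.sqrt_ne_zero'.2 h1), ?_⟩
  rw [map_smul, map_smul, LinearMap.smul_apply, smul_eq_mul, smul_eq_mul, ← mul_assoc, h2]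
  rcases abs_cases (g x x) with h | h <;> rw [h.1]
  · left; exact inv_mul_cancel₀ hx
  · right; rw [inv_neg, neg_mul, inv_mul_cancel₀ hx]

end Orthonormal

/-! ### Existence of a frame in which the brackets of the ideal are diagonal. -/

section FrameExistence

variable {𝔤 : Type*} [LieRing 𝔤] [LieAlgebra ℝ 𝔤] {𝔤₀ : LieIdeal ℝ 𝔤}
  {g : LinearMap.BilinForm ℝ 𝔤} {J : Module.End ℝ 𝔤} {u : 𝔤} {ε₁ : ℝ} {z : 𝔤₀}
  {L : Module.End ℝ 𝔤₀}

/-- A unit normal `u` of an ideal such that `J u` is an eigenvector of the canonical operator. -/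
structure IsAdaptedNormal (𝔤₀ : LieIdeal ℝ 𝔤) (g : LinearMap.BilinForm ℝ 𝔤) (J : Module.End ℝ 𝔤)
    (u : 𝔤) (ε₁ : ℝ) (L : Module.End ℝ 𝔤₀) (z : 𝔤₀) : Prop where
  symm : ∀ x y, g x y = g y x
  nondegenerate : ∀ x, (∀ y, g x y = 0) → x = 0
  sq : ∀ x, J (J x) = -x
  skew : ∀ x y, g (J x) y = -g x (J y)
  sign : ε₁ = 1 ∨ ε₁ = -1
  unit : g u u = ε₁
  mem_iff : ∀ x, x ∈ 𝔤₀ ↔ g u x = 0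
  coe_eq : (z : 𝔤) = J u
  canonical : IsCanonicalOperator (restrictTo 𝔤₀ g) L
  eigenvector : ∃ r : ℝ, L z = r • z

/-- A unit vector orthogonal to `u` and `J u` extends to an orthonormal frame. -/
lemma IsAdaptedNormal.orthonormal (h : IsAdaptedNormal 𝔤₀ g J u ε₁ L z) {w : 𝔤} {ε₂ : ℝ}
    (hw0 : g u w = 0) (hw1 : g (J u) w = 0) (hε₂ : ε₂ = 1 ∨ ε₂ = -1) (hww : g w w = ε₂) :
    IsOrthonormalFamily g ![u, J u, w, J w] ![ε₁, ε₁, ε₂, ε₂] := by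
  have self : ∀ x, g x (J x) = 0 := fun x => by
    have := h.skew x x
    rw [h.symm] at this
    linarith
  have iso : ∀ x y, g (J x) (J y) = g x y := fun x y => by rw [h.skew, h.sq, map_neg, neg_neg]
  have h3 : g u (J w) = 0 := by rw [← neg_neg (g u (J w)), ← h.skew, hw1, neg_zero]
  refine ⟨fun i => ?_, fun i => ?_, fun i j hij => ?_⟩
  · fin_cases i
    exacts [h.sign, h.sign, hε₂, hε₂]
  · fin_cases i
    exacts [h.unit, (iso u u).trans h.unit, hww, (iso w w).trans hww]
  · fin_cases i <;> fin_cases j <;> first | exact absurd rfl hij | skip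
    · exact self u
    · exact hw0
    · exact h3
    · exact (h.symm _ _).trans (self u)
    · exact hw1
    · exact (iso u w).trans hw0
    · exact (h.symm _ _).trans hw0
    · exact (h.symm _ _).trans hw1
    · exact self w
    · exact (h.symm _ _).trans h3
    · exact (h.symm _ _).trans ((iso u w).trans hw0)
    · exact (h.symm _ _).trans (self w)

/-- If all vectors of the complement of `u`, `J u` were null, polarisation would make `g` zero
there, and nondegeneracy would make the complement trivial, leaving dimension at most two. -/
lemma IsAdaptedNormal.exists_nonnull (h : IsAdaptedNormal 𝔤₀ g J u ε₁ L z)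
    (hdim : Module.finrank ℝ 𝔤 = 4) : ∃ w, g u w = 0 ∧ g (J u) w = 0 ∧ g w w ≠ 0 := by
  by_contra! hnull
  have e : ε₁ * ε₁ = 1 := by rcases h.sign with h | h <;> rw [h] <;> norm_num
  have self : g u (J u) = 0 := by
    have := h.skew u u
    rw [h.symm] at this
    linarith
  have self' : g (J u) u = 0 := (h.symm _ _).trans self
  have unit' : g (J u) (J u) = ε₁ := by rw [h.skew, h.sq, map_neg, neg_neg, h.unit]
  have pol : ∀ w w', g u w = 0 → g (J u) w = 0 → g u w' = 0 → g (J u) w' = 0 → g w w' = 0 := by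
    intro w w' h1 h2 h3 h4
    have := hnull (w + w') (by rw [map_add, h1, h3, add_zero]) (by rw [map_add, h2, h4, add_zero])
    simp only [map_add, LinearMap.add_apply] at this
    rw [hnull w h1 h2, hnull w' h3 h4, h.symm w' w] at this
    linarith
  set pr : 𝔤 → 𝔤 := fun x => x - (ε₁ * g u x) • u - (ε₁ * g (J u) x) • J u with hpr
  have p0 : ∀ x, g u (pr x) = 0 := fun x => by
    simp only [hpr, map_sub, map_smul, smul_eq_mul, h.unit, self]
    linear_combination (-g u x) * e
  have p1 : ∀ x, g (J u) (pr x) = 0 := fun x => by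
    simp only [hpr, map_sub, map_smul, smul_eq_mul, unit', self']
    linear_combination (-g (J u) x) * e
  have pz : ∀ x, pr x = 0 := fun x => h.nondegenerate _ fun y => by
    have h1 := pol _ _ (p0 x) (p1 x) (p0 y) (p1 y)
    have h2 : y = pr y + ((ε₁ * g u y) • u + (ε₁ * g (J u) y) • J u) := by
      simp only [hpr]; abel
    rw [h2, map_add, h1, map_add, map_smul, map_smul, h.symm (pr x) u, h.symm (pr x) (J u), p0, p1]
    simp
  have top : (⊤ : Submodule ℝ 𝔤) ≤ Submodule.span ℝ (Set.range ![u, J u]) := fun x _ => by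
    have : x = (ε₁ * g u x) • u + (ε₁ * g (J u) x) • J u := by
      have := pz x
      simp only [hpr] at this
      rw [sub_sub] at this
      exact sub_eq_zero.1 this
    rw [this]
    exact add_mem (Submodule.smul_mem _ _ (Submodule.subset_span ⟨0, rfl⟩))
      (Submodule.smul_mem _ _ (Submodule.subset_span ⟨1, rfl⟩))
  have := finrank_range_le_card (R := ℝ) ![u, J u]
  rw [Set.finrank, top_le_iff.1 top, finrank_top, hdim] at this
  simp at this

/-- The frame of a unit vector orthogonal to `u` and `J u`, with the brackets of the ideal. -/
lemma IsAdaptedNormal.exists_frame (h : IsAdaptedNormal 𝔤₀ g J u ε₁ L z)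
    (hdim : Module.finrank ℝ 𝔤 = 4) (hdim₀ : Module.finrank ℝ 𝔤₀ = 3) (hu : IsUnimodular 𝔤₀)
    {w : 𝔤} (hw0 : g u w = 0) (hw1 : g (J u) w = 0) (hww : g w w ≠ 0) :
    ∃ (v : Module.Basis (Fin 4) ℝ 𝔤) (ε₂ a p q r s : ℝ), a ≠ 0 ∧
      IsOrthonormalFamily g v ![ε₁, ε₁, ε₂, ε₂] ∧ v 0 = u ∧ v 1 = J u ∧ v 2 = a • w ∧
      v 3 = J (a • w) ∧ ⁅v 2, v 3⁆ = p • v 1 ∧ ⁅v 3, v 1⁆ = q • v 2 + s • v 3 ∧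
      ⁅v 1, v 2⁆ = s • v 2 + r • v 3 := by
  obtain ⟨a, ha, hsign⟩ := exists_smul_unit hww
  set w' := a • w with hw'
  have hw0' : g u w' = 0 := by rw [hw', map_smul, hw0, smul_zero]
  have hw1' : g (J u) w' = 0 := by rw [hw', map_smul, hw1, smul_zero]
  obtain ⟨ε₂, hε₂⟩ : ∃ ε₂, ε₂ = g w' w' := ⟨_, rfl⟩
  rw [← hε₂] at hsign
  have ho := h.orthonormal hw0' hw1' hsign hε₂.symm
  obtain ⟨v, hv⟩ := ho.exists_basis (by simp [hdim])
  have v0 : v 0 = u := congrFun hv 0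
  have v1 : v 1 = J u := congrFun hv 1
  have v2 : v 2 = w' := congrFun hv 2
  have v3 : v 3 = J w' := congrFun hv 3
  rw [← hv] at ho
  obtain ⟨-, ⟨g01, g02, g03, g12, g13, g23⟩, ⟨g10, g20, g30, g21, g31, g32⟩⟩ := ho.values
  have m1 : v 1 ∈ 𝔤₀ := (h.mem_iff _).2 (v0 ▸ g01)
  have m2 : v 2 ∈ 𝔤₀ := (h.mem_iff _).2 (v0 ▸ g02)
  have m3 : v 3 ∈ 𝔤₀ := (h.mem_iff _).2 (v0 ▸ g03)
  have expand : ∀ x ∈ 𝔤₀, x = (ε₁ * g x (v 1)) • v 1 + (ε₂ * g x (v 2)) • v 2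
      + (ε₂ * g x (v 3)) • v 3 := fun x hx => by
    have r0 : v.repr x 0 = 0 := by
      rw [ho.repr_eq, h.symm, v0, (h.mem_iff x).1 hx, mul_zero]
    have r1 := ho.repr_eq x 1
    have r2 := ho.repr_eq x 2
    have r3 := ho.repr_eq x 3
    conv_lhs => rw [basis_four_sum v x, r0, r1, r2, r3, zero_smul, zero_add]
    rfl
  -- the cross product of `v 2` and `v 3` is a multiple of `v 1`
  have e23 : ∃ p : ℝ, ⁅v 2, v 3⁆ = p • v 1 := by
    obtain ⟨b, δ, cross, -, hcross, hL⟩ := h.canonical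
    obtain ⟨r, hr⟩ := h.eigenvector
    set y : 𝔤₀ := cross ⟨v 2, m2⟩ ⟨v 3, m3⟩ with hy
    have c2 : g y (v 2) = 0 := by
      have := hcross ⟨v 2, m2⟩ ⟨v 3, m3⟩ ⟨v 2, m2⟩
      rw [b.det.map_eq_zero_of_eq _ (i := 0) (j := 2) rfl (by decide)] at this
      exact this
    have c3 : g y (v 3) = 0 := by
      have := hcross ⟨v 2, m2⟩ ⟨v 3, m3⟩ ⟨v 3, m3⟩
      rw [b.det.map_eq_zero_of_eq _ (i := 1) (j := 2) rfl (by decide)] at this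
      exact this
    have hyz : y = (ε₁ * g y (v 1)) • z := by
      apply Subtype.ext
      have := expand y y.2
      rw [c2, c3, mul_zero, zero_smul, zero_smul, add_zero, add_zero] at this
      change _ = _ • (z : 𝔤)
      rw [h.coe_eq, ← v1]
      exact this
    refine ⟨ε₁ * g y (v 1) * r, ?_⟩
    have e := hL ⟨v 2, m2⟩ ⟨v 3, m3⟩
    rw [← hy, hyz, map_smul, hr, smul_smul] at e
    have e' := congrArg (Subtype.val) e
    rw [LieSubmodule.coe_smul, h.coe_eq, ← v1] at e'
    exact e'
  obtain ⟨p, hp⟩ := e23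
  -- unimodularity
  have tr : ∀ x ∈ 𝔤₀, ε₁ * g ⁅x, v 1⁆ (v 1) + ε₂ * g ⁅x, v 2⁆ (v 2) + ε₂ * g ⁅x, v 3⁆ (v 3) = 0 := by
    intro x hx
    have ho' : IsOrthonormalFamily (restrictTo 𝔤₀ g)
        ![(⟨v 1, m1⟩ : 𝔤₀), ⟨v 2, m2⟩, ⟨v 3, m3⟩] ![ε₁, ε₂, ε₂] := by
      refine ⟨fun i => ?_, fun i => ?_, fun i j hij => ?_⟩
      · fin_cases i
        exacts [h.sign, hsign, hsign]
      · fin_cases i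
        exacts [ho.2.1 1, ho.2.1 2, ho.2.1 3]
      · fin_cases i <;> fin_cases j <;> first | exact absurd rfl hij | skip
        exacts [g12, g13, g21, g23, g31, g32]
    obtain ⟨b, hb⟩ := ho'.exists_basis (by simp [hdim₀])
    rw [← hb] at ho'
    have := hu ⟨x, hx⟩
    rw [ho'.trace_eq, Fin.sum_univ_three, hb] at this
    exact this
  have t1 := tr _ m1
  have t2 := tr _ m2
  have t3 := tr _ m3
  have b21 : ⁅v 2, v 1⁆ = -⁅v 1, v 2⁆ := (lie_skew _ _).symm
  have b13 : ⁅v 1, v 3⁆ = -⁅v 3, v 1⁆ := (lie_skew _ _).symm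
  have b32 : ⁅v 3, v 2⁆ = -(p • v 1) := by rw [← hp, lie_skew]
  have e1 : ε₁ ≠ 0 := by rcases h.sign with h | h <;> rw [h] <;> norm_num
  have e2 : ε₂ ≠ 0 := by rcases hsign with h | h <;> rw [h] <;> norm_num
  simp only [lie_self, map_zero, LinearMap.zero_apply, b21, b13, b32, hp, map_neg, map_smul,
    LinearMap.neg_apply, LinearMap.smul_apply, g12, g13, smul_zero, mul_zero, neg_zero, zero_add,
    add_zero] at t1 t2 t3
  -- The traces of `ad (v 2)` and `ad (v 3)` remove the components along `v 1`. The trace of `ad (v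
  -- 1)` equates the two off-diagonal entries, so both are the same `s`: the canonical operator is
  -- symmetric.
  have k1 : g ⁅v 1, v 2⁆ (v 1) = 0 := by apply mul_left_cancel₀ e1; linarith
  have k2 : g ⁅v 3, v 1⁆ (v 1) = 0 := by apply mul_left_cancel₀ e1; linarith
  refine ⟨v, ε₂, a, p, ε₂ * g ⁅v 3, v 1⁆ (v 2), ε₂ * g ⁅v 1, v 2⁆ (v 3),
    ε₂ * g ⁅v 1, v 2⁆ (v 2), ha, ho, v0, v1, v2, v3, hp, ?_, ?_⟩
  · have k3 : ε₂ * g ⁅v 1, v 2⁆ (v 2) = ε₂ * g ⁅v 3, v 1⁆ (v 3) := by linarith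
    have := expand _ (lie_mem_left ℝ 𝔤 𝔤₀ (v 3) (v 1) m3)
    rwa [k2, mul_zero, zero_smul, zero_add, ← k3] at this
  · have := expand _ (lie_mem_left ℝ 𝔤 𝔤₀ (v 1) (v 2) m1)
    rwa [k1, mul_zero, zero_smul, zero_add] at this

/-- A symmetric `2 × 2` matrix has a real eigenvector. -/
lemma exists_quadratic_root (s d : ℝ) : ∃ t : ℝ, s + t * d - s * t ^ 2 = 0 := by
  by_cases hs : s = 0
  · exact ⟨0, by rw [hs]; ring⟩
  · obtain ⟨t, ht⟩ := exists_quadratic_eq_zero (a := -s) (b := d) (c := s) (neg_ne_zero.2 hs)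
      ⟨Real.sqrt (d ^ 2 + 4 * s ^ 2), by
        rw [Real.mul_self_sqrt (by positivity), discrim]; ring⟩
    exact ⟨t, by linear_combination ht⟩

/-- An adapted normal extends to a frame in which the brackets of the ideal are diagonal. -/
lemma IsAdaptedNormal.exists_hermitianFrame (h : IsAdaptedNormal 𝔤₀ g J u ε₁ L z)
    (hdim : Module.finrank ℝ 𝔤 = 4) (hdim₀ : Module.finrank ℝ 𝔤₀ = 3) (hu : IsUnimodular 𝔤₀)
    (hna : ¬ IsLieAbelian 𝔤₀) :
    ∃ (v : Module.Basis (Fin 4) ℝ 𝔤) (ε₂ : ℝ) (k : FrameConstants),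
      IsHermitianFrame g J v ε₁ ε₂ k ∧ v 0 = u ∧ v 1 ∈ 𝔤₀ ∧ v 2 ∈ 𝔤₀ ∧ v 3 ∈ 𝔤₀ ∧
      (k.p ≠ 0 ∨ k.q ≠ 0 ∨ k.r ≠ 0) := by
  obtain ⟨w, hw0, hw1, hww⟩ := h.exists_nonnull hdim
  obtain ⟨v, ε₂, a, p, q, r, s, ha, ho, v0, v1, v2, v3, b23, b31, b12⟩ :=
    h.exists_frame hdim hdim₀ hu hw0 hw1 hww
  -- The equation says that `(1, t)` is an eigenvector of the symmetric matrix with rows `(q, s)`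
  -- and `(s, r)`.
  obtain ⟨t, ht⟩ := exists_quadratic_root s (r - q)
  obtain ⟨⟨g00, g11, g22, g33⟩, ⟨g01, g02, g03, g12, g13, g23⟩,
    ⟨g10, g20, g30, g21, g31, g32⟩⟩ := ho.values
  -- The plane of `v 2`, `v 3` is definite because `J` is an isometry, so the eigenvector has norm
  -- `ε₂ (1 + t²)` and is non-null.
  have hww' : g (v 2 + t • v 3) (v 2 + t • v 3) ≠ 0 := by
    simp only [map_add, map_smul, LinearMap.add_apply, LinearMap.smul_apply, g22, g23, g32, g33,
      smul_eq_mul]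
    have e2 : ε₂ ≠ 0 := by rcases ho.1 2 with h | h <;> simp at h <;> rw [h] <;> norm_num
    have : ε₂ + t * 0 + t * (0 + t * ε₂) = ε₂ * (1 + t ^ 2) := by ring
    rw [this]
    exact mul_ne_zero e2 (by positivity)
  have J3 : J (v 3) = -v 2 := by rw [v3, ← v2, v2, h.sq]
  have J2 : J (v 2) = v 3 := by rw [v2, v3]
  obtain ⟨v', ε₂', a', p', q', r', s', ha', ho', v0', v1', v2', v3', b23', b31', b12'⟩ :=
    h.exists_frame hdim hdim₀ hu (w := v 2 + t • v 3) (by rw [← v0, map_add, map_smul, g02, g03]; simp)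
      (by rw [← v1, map_add, map_smul, g12, g13]; simp) hww'
  have v3'' : v' 3 = a' • (v 3 - t • v 2) := by
    rw [v3', map_smul, map_add, map_smul, J2, J3, smul_neg, sub_eq_add_neg]
  -- The off-diagonal entry of the new frame is, up to a factor, the quadratic equation for `t`.
  have s0 : s' = 0 := by
    have b21 : ⁅v 2, v 1⁆ = -⁅v 1, v 2⁆ := (lie_skew _ _).symm
    have h33 : g (v' 3) (v' 3) = ε₂' := ho'.2.1 3
    have h23 : g (v' 2) (v' 3) = 0 := ho'.values.2.1.2.2.2.2.2
    have e : g ⁅v' 3, v' 1⁆ (v' 3) = s' * ε₂' := by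
      rw [b31', map_add, map_smul, map_smul, LinearMap.add_apply, LinearMap.smul_apply,
        LinearMap.smul_apply, h33, h23, smul_zero, zero_add, smul_eq_mul]
    have e2 : ε₂' ≠ 0 := by rcases ho'.1 3 with h | h <;> simp at h <;> rw [h] <;> norm_num
    rw [v3'', v1', ← v1, smul_lie, sub_lie, smul_lie, b21, b31, b12] at e
    simp only [map_add, map_sub, map_neg, map_smul, LinearMap.add_apply, LinearMap.sub_apply,
      LinearMap.neg_apply, LinearMap.smul_apply, g22, g23, g32, g33, smul_eq_mul] at e
    apply (mul_eq_zero.1 (_ : s' * ε₂' = 0)).resolve_right e2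
    rw [← e]
    linear_combination a' ^ 2 * ε₂ * ht
  rw [s0, zero_smul] at b31' b12'
  rw [add_zero] at b31'
  rw [zero_add] at b12'
  obtain ⟨-, ⟨h01, h02, h03, -⟩, -⟩ := ho'.values
  have m1 : v' 1 ∈ 𝔤₀ := (h.mem_iff _).2 (v0' ▸ h01)
  have m2 : v' 2 ∈ 𝔤₀ := (h.mem_iff _).2 (v0' ▸ h02)
  have m3 : v' 3 ∈ 𝔤₀ := (h.mem_iff _).2 (v0' ▸ h03)
  have expand : ∀ x ∈ 𝔤₀, x = v'.repr x 1 • v' 1 + v'.repr x 2 • v' 2 + v'.repr x 3 • v' 3 :=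
    fun x hx => by
      have r0 : v'.repr x 0 = 0 := by
        rw [ho'.repr_eq, h.symm, v0', (h.mem_iff x).1 hx, mul_zero]
      conv_lhs => rw [basis_four_sum v' x, r0, zero_smul, zero_add]
  refine ⟨v', ε₂', ⟨p', q', r', v'.repr ⁅v' 0, v' 1⁆ 1, v'.repr ⁅v' 0, v' 1⁆ 2,
    v'.repr ⁅v' 0, v' 1⁆ 3, v'.repr ⁅v' 0, v' 2⁆ 1, v'.repr ⁅v' 0, v' 2⁆ 2,
    v'.repr ⁅v' 0, v' 2⁆ 3, v'.repr ⁅v' 0, v' 3⁆ 1, v'.repr ⁅v' 0, v' 3⁆ 2,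
    v'.repr ⁅v' 0, v' 3⁆ 3⟩, ⟨ho', by rw [v0', v1'], by rw [v2', v3'], b23', b31', b12',
    expand _ (lie_mem_right ℝ 𝔤 𝔤₀ _ _ m1), expand _ (lie_mem_right ℝ 𝔤 𝔤₀ _ _ m2),
    expand _ (lie_mem_right ℝ 𝔤 𝔤₀ _ _ m3)⟩, v0', m1, m2, m3, ?_⟩
  by_contra! hz
  simp only at hz
  obtain ⟨rfl, rfl, rfl⟩ := hz
  rw [zero_smul] at b23' b31' b12'
  have b32' : ⁅v' 3, v' 2⁆ = 0 := by rw [← lie_skew, b23', neg_zero]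
  have b13' : ⁅v' 1, v' 3⁆ = 0 := by rw [← lie_skew, b31', neg_zero]
  have b21' : ⁅v' 2, v' 1⁆ = 0 := by rw [← lie_skew, b12', neg_zero]
  refine hna ⟨fun x y => Subtype.ext ?_⟩
  change ⁅(x : 𝔤), (y : 𝔤)⁆ = 0
  rw [expand x x.2, expand y y.2]
  simp only [add_lie, lie_add, smul_lie, lie_smul, lie_self, b12', b13', b21', b23', b31', b32',
    smul_zero, add_zero]

/-- The normal of an adapted structure. -/
lemma IsAdapted.exists_normal {𝔲 : Submodule ℝ 𝔤} {H : 𝔤 [⋀^Fin 3]→ₗ[ℝ] ℝ}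
    {F : 𝔤 [⋀^Fin 2]→ₗ[ℝ] ℝ} {Jp : Module.End ℝ 𝔤} {Xp Xm : 𝔤} {c : ℝ}
    (T : TensorIdentities H F g Jp J Xp Xm c) (h : IsAdapted 𝔲 𝔤₀ g J Xp Xm)
    (hdim : Module.finrank ℝ 𝔲 = 1) (hc : IsCompl 𝔲 𝔤₀.toSubmodule) :
    ∃ (u : 𝔤) (ε₁ : ℝ) (L : Module.End ℝ 𝔤₀) (z : 𝔤₀), u ∈ 𝔲 ∧ IsAdaptedNormal 𝔤₀ g J u ε₁ L z := by
  obtain ⟨⟨u₀, hu₀⟩, hne, hspan⟩ := finrank_eq_one_iff'.1 hdim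
  have hne' : u₀ ≠ 0 := fun e => hne (Subtype.ext e)
  obtain ⟨a, ha, hsign⟩ := exists_smul_unit (h.non_null u₀ hu₀ hne')
  have hu : a • u₀ ∈ 𝔲 := Submodule.smul_mem _ _ hu₀
  obtain ⟨L, hL, -, r, hr⟩ := h.canonical
  obtain ⟨z, hz, hzr⟩ := hr _ hu
  refine ⟨a • u₀, g (a • u₀) (a • u₀), L, z, hu, T.symm, T.nondegenerate, T.minus_sq, T.minus_skew,
    hsign, rfl, fun x => ⟨fun hx => h.orthogonal _ hu _ hx, fun hx => ?_⟩, hz, hL, r, hzr⟩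
  have hx' : x ∈ 𝔲 ⊔ 𝔤₀.toSubmodule := by rw [hc.sup_eq_top]; trivial
  obtain ⟨y, hy, w, hw, rfl⟩ := Submodule.mem_sup.1 hx'
  obtain ⟨d, hd⟩ := hspan ⟨y, hy⟩
  have hd' : d • u₀ = y := congrArg Subtype.val hd
  rw [map_add, h.orthogonal _ hu w hw, add_zero, ← hd', map_smul, map_smul, LinearMap.smul_apply,
    smul_eq_mul, smul_eq_mul] at hx
  have hd0 : d = 0 := by
    simpa [ha, h.non_null u₀ hu₀ hne'] using hx
  rw [← hd', hd0, zero_smul, zero_add]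
  exact hw

end FrameExistence

/-! ### Necessity: components in a special basis. -/

section Necessity

variable {𝔤 : Type*} [LieRing 𝔤] [LieAlgebra ℝ 𝔤]
  {g : LinearMap.BilinForm ℝ 𝔤} {H : 𝔤 [⋀^Fin 3]→ₗ[ℝ] ℝ} {F : 𝔤 [⋀^Fin 2]→ₗ[ℝ] ℝ}
  {Jp Jm : Module.End ℝ 𝔤} {Xp Xm : 𝔤} {c : ℝ} {v : Module.Basis (Fin 4) ℝ 𝔤} {ε₁ ε₂ : ℝ}

/-- The components of an adapted structure in a special basis. -/
structure IsSpecialComponents (g : LinearMap.BilinForm ℝ 𝔤) (Jp Jm : Module.End ℝ 𝔤) (Xp Xm : 𝔤)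
    (c : ℝ) (b : Module.Basis (Fin 4) ℝ 𝔤) (ε₁ x y x' y' : ℝ) : Prop where
  eq_Xp : Xp = x • b 0 + y • b 1
  eq_Xm : Xm = x' • b 0 + y' • b 1
  norm_Xp : ε₁ * (x ^ 2 + y ^ 2) = 1 - c ^ 2
  norm_Xm : ε₁ * (x' ^ 2 + y' ^ 2) = 1 - c ^ 2
  orthogonal : x * x' + y * y' = 0
  ne_neg_one : c ≠ -1
  ne_zero : c ≠ 0
  ne_one : c ≠ 1
  Jm_zero : Jm (b 0) = b 1
  Jm_one : Jm (b 1) = - b 0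
  Jm_two : Jm (b 2) = b 3
  Jm_three : Jm (b 3) = - b 2
  Jp_Xp : Jp Xp = -(c • Xm)
  Jp_Xm : Jp Xm = c • Xp
  Jp_span : ∀ z ∈ Submodule.span ℝ {b 2, b 3},
    Jp z ∈ Submodule.span ℝ {b 2, b 3} ∧ Jp (Jp z) = - z ∧
      ∀ w ∈ Submodule.span ℝ {b 2, b 3}, g (Jp z) w = - g z (Jp w)

/-- Two orthogonal non-null vectors span the plane of `v 0`, `v 1`. This plane is invariant under
the skew-symmetric `J₊`, hence so is its complement, where `J₊² = -1`. -/
lemma TensorIdentities.isSpecialComponents (T : TensorIdentities H F g Jp Jm Xp Xm c) (hc : c ≠ 0)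
    (hXp : g Xp Xp ≠ 0) (ho : IsOrthonormalFamily g v ![ε₁, ε₁, ε₂, ε₂])
    (hJ0 : Jm (v 0) = v 1) (hJ2 : Jm (v 2) = v 3) (x2 : v.repr Xp 2 = 0) (x3 : v.repr Xp 3 = 0)
    (y2 : v.repr Xm 2 = 0) (y3 : v.repr Xm 3 = 0) :
    IsSpecialComponents g Jp Jm Xp Xm c v ε₁ (v.repr Xp 0) (v.repr Xp 1) (v.repr Xm 0)
      (v.repr Xm 1) := by
  have e : ε₁ ≠ 0 := by rcases ho.1 0 with h | h <;> simp at h <;> rw [h] <;> norm_num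
  have Npp := ho.form_eq Xp Xp
  have Nmm := ho.form_eq Xm Xm
  have Npm := ho.form_eq Xp Xm
  rw [T.norm_Xp] at Npp
  rw [T.norm_Xm] at Nmm
  rw [T.orthogonal] at Npm
  simp only [x2, x3, y2, y3, mul_zero, add_zero] at Npp Nmm Npm
  have hc2 : 1 - c ^ 2 ≠ 0 := by rwa [← T.norm_Xp]
  have orth : v.repr Xp 0 * v.repr Xm 0 + v.repr Xp 1 * v.repr Xm 1 = 0 :=
    (mul_eq_zero.1 Npm.symm).resolve_left e
  -- Lagrange's identity: the product of the norms is the squared scalar product plus the squared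
  -- determinant, up to `ε₁² = 1`.
  have hdet : v.repr Xp 0 * v.repr Xm 1 - v.repr Xp 1 * v.repr Xm 0 ≠ 0 := fun hdet => by
    apply hc2
    apply pow_eq_zero_iff (n := 2) (by norm_num) |>.1
    set a := v.repr Xp 0
    set b := v.repr Xp 1
    set a' := v.repr Xm 0
    set b' := v.repr Xm 1
    calc (1 - c ^ 2) ^ 2 = (ε₁ * (a * a + b * b)) * (ε₁ * (a' * a' + b' * b')) := by
          rw [← Npp, ← Nmm]; ring
      _ = ε₁ ^ 2 * ((a * a' + b * b') ^ 2 + (a * b' - b * a') ^ 2) := by ring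
      _ = 0 := by rw [orth, hdet]; ring
  have gXp : ∀ z, g Xp z = ε₁ * (v.repr Xp 0 * v.repr z 0 + v.repr Xp 1 * v.repr z 1) := fun z => by
    rw [ho.form_eq, x2, x3]; ring
  have gXm : ∀ z, g Xm z = ε₁ * (v.repr Xm 0 * v.repr z 0 + v.repr Xm 1 * v.repr z 1) := fun z => by
    rw [ho.form_eq, y2, y3]; ring
  have perp : ∀ z ∈ Submodule.span ℝ {v 2, v 3}, g Xp z = 0 ∧ g Xm z = 0 := fun z hz => by
    obtain ⟨a, b, rfl⟩ := Submodule.mem_span_pair.1 hz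
    rw [gXp, gXm]
    simp
  have mem : ∀ z, g Xp z = 0 → g Xm z = 0 → z ∈ Submodule.span ℝ {v 2, v 3} := fun z h1 h2 => by
    rw [gXp] at h1
    rw [gXm] at h2
    replace h1 := (mul_eq_zero.1 h1).resolve_left e
    replace h2 := (mul_eq_zero.1 h2).resolve_left e
    have z0 : v.repr z 0 = 0 := by
      apply mul_left_cancel₀ hdet; linear_combination v.repr Xm 1 * h1 - v.repr Xp 1 * h2
    have z1 : v.repr z 1 = 0 := by
      apply mul_left_cancel₀ hdet; linear_combination v.repr Xp 0 * h2 - v.repr Xm 0 * h1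
    refine Submodule.mem_span_pair.2 ⟨v.repr z 2, v.repr z 3, ?_⟩
    conv_rhs => rw [basis_four_sum v z, z0, z1, zero_smul, zero_smul, zero_add, zero_add]
  refine ⟨?_, ?_, ?_, ?_, orth, ?_, hc, ?_, hJ0, ?_, hJ2, ?_, T.plus_Xp, T.plus_Xm,
    fun z hz => ⟨mem _ ?_ ?_, ?_, fun w _ => T.plus_skew z w⟩⟩
  · conv_lhs => rw [basis_four_sum v Xp, x2, x3, zero_smul, zero_smul, add_zero, add_zero]
  · conv_lhs => rw [basis_four_sum v Xm, y2, y3, zero_smul, zero_smul, add_zero, add_zero]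
  · rw [Npp]; ring
  · rw [Nmm]; ring
  · rintro rfl; apply hc2; norm_num
  · rintro rfl; apply hc2; norm_num
  · rw [← hJ0, T.minus_sq]
  · rw [← hJ2, T.minus_sq]
  · have := T.plus_skew Xp z
    rw [T.plus_Xp, map_neg, map_smul, LinearMap.neg_apply, LinearMap.smul_apply, (perp z hz).2] at this
    simpa using this
  · have := T.plus_skew Xm z
    rw [T.plus_Xm, map_smul, LinearMap.smul_apply, (perp z hz).1] at this
    simpa using this
  · rw [T.plus_sq, (perp z hz).1, (perp z hz).2, zero_smul, zero_smul, add_zero, add_zero]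

/-- The algebraic part of the classification. -/
lemma TensorIdentities.exists_specialBasis {𝔲 : Submodule ℝ 𝔤} {𝔤₀ : LieIdeal ℝ 𝔤}
    (T : TensorIdentities H F g Jp Jm Xp Xm c) (hc : c ≠ 0) (h : IsAdapted 𝔲 𝔤₀ g Jm Xp Xm)
    [Module.Finite ℝ 𝔤] (hdim𝔲 : Module.finrank ℝ 𝔲 = 1) (hdim𝔤₀ : Module.finrank ℝ 𝔤₀ = 3)
    (hcompl : IsCompl 𝔲 𝔤₀.toSubmodule) (hu : IsUnimodular 𝔤₀) (hna : ¬ IsLieAbelian 𝔤₀) :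
    ∃ (b : Module.Basis (Fin 4) ℝ 𝔤) (ε₁ ε₂ l β x y x' y' : ℝ),
      IsSpecialBasis 𝔲 𝔤₀ g b ε₁ ε₂ l β ∧ IsSpecialComponents g Jp Jm Xp Xm c b ε₁ x y x' y' ∧
        H = 0 ∧ F = 0 := by
  obtain ⟨u, ε₁, L, z, hu𝔲, hn⟩ := h.exists_normal T hdim𝔲 hcompl
  have hdim : Module.finrank ℝ 𝔤 = 4 := by
    have := Submodule.finrank_add_eq_of_isCompl hcompl
    change _ + Module.finrank ℝ 𝔤₀ = _ at this
    omega
  obtain ⟨v, ε₂, k, hf, v0, m1, m2, m3, hk⟩ := hn.exists_hermitianFrame hdim hdim𝔤₀ hu hna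
  obtain ⟨⟨p, qr, q⟩, ⟨d11, d21, d31⟩, ⟨d12, d22⟩, ⟨d13, d23, d33⟩, hF, hH, ⟨x2, x3⟩, y2, y3⟩ :=
    hf.rigid T hc h.non_null_plus h.non_null_minus hk
  have e : ε₂ * ε₂ = 1 := hf.orthonormal.sign_mul_self 2
  have b12 := hf.b12
  have b23 := hf.b23
  have b31 := hf.b31
  have b01 := hf.b01
  have b02 := hf.b02
  have b03 := hf.b03
  rw [p, zero_smul] at b23
  rw [d11, d21, d31, zero_smul, zero_smul, zero_smul, add_zero, add_zero] at b01
  rw [d12, d22, zero_smul, zero_smul, add_zero, zero_add] at b02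
  rw [d13, d23, d33, zero_smul, zero_smul, zero_add, add_zero, neg_smul] at b03
  -- The normal form has coefficient `ε₂ l`, so `l = ε₂ q` makes it equal to `q`, by `ε₂² = 1`.
  refine ⟨v, ε₁, ε₂, ε₂ * k.q, k.d32, _, _, _, _,
    ⟨v0 ▸ hu𝔲, m1, m2, m3, hf.orthonormal, mul_ne_zero hf.sign_ne.2 q, ?_, b23, ?_, b01, b02, b03⟩,
    T.isSpecialComponents hc h.non_null_plus hf.orthonormal hf.J_zero hf.J_two x2 x3 y2 y3, hH, hF⟩
  · rw [b12, ← mul_assoc, e, one_mul, qr]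
  · rw [b31, ← mul_assoc, e, one_mul]

end Necessity

/-! ### Integrability of parallel endomorphisms: the pointwise computation. -/

section FlatConnection

variable {𝔤 : Type*} [LieRing 𝔤] [LieAlgebra ℝ 𝔤]

/-- The Dorfman bracket of two sections with values `x`, `x'` and covariant derivatives `P`, `Q`, for
a metric connection in which the bracket has no further terms. -/
def connectionBracket (x : Model 𝔤) (P : 𝔤 →ₗ[ℝ] Model 𝔤) (x' : Model 𝔤) (Q : 𝔤 →ₗ[ℝ] Model 𝔤) :
    Model 𝔤 :=
  Q x.1 - P x'.1 + (0, (2 : ℝ) • ((modelPairing 𝔤).flip x' ∘ₗ P), 0)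

/-- Here `-A x` and `-A ∘ₗ P` are the value and the derivative of the imaginary part when `A` is
parallel. The derivative terms stay in the eigenbundle, and the terms with the scalar product
cancel. -/
lemma connectionBracket_integrable {A : Module.End ℝ (Model 𝔤)}
    (skew : ∀ u v, modelPairing 𝔤 (A u) v = -modelPairing 𝔤 u (A v)) {x x' : Model 𝔤}
    {P Q : 𝔤 →ₗ[ℝ] Model 𝔤} (hx' : A (A x') = -x')
    (hP : ∀ z, A (A (P z)) = -P z) (hQ : ∀ z, A (A (Q z)) = -Q z) :
    A (connectionBracket x P x' Q - connectionBracket (-A x) (-A ∘ₗ P) (-A x') (-A ∘ₗ Q))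
      = -(connectionBracket x P (-A x') (-A ∘ₗ Q) + connectionBracket (-A x) (-A ∘ₗ P) x' Q) ∧
    A (connectionBracket x P (-A x') (-A ∘ₗ Q) + connectionBracket (-A x) (-A ∘ₗ P) x' Q)
      = connectionBracket x P x' Q - connectionBracket (-A x) (-A ∘ₗ P) (-A x') (-A ∘ₗ Q) := by
  have e1 : connectionBracket x P x' Q - connectionBracket (-A x) (-A ∘ₗ P) (-A x') (-A ∘ₗ Q)
      = Q x.1 - P x'.1 - (A (Q (A x).1) - A (P (A x').1)) := by
    -- `A` is skew with `A² = -1` on `x'`, so it preserves this scalar product and the two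
    -- correction terms are equal; in `e2` skewness alone makes them opposite.
    have : ∀ z, modelPairing 𝔤 (A (P z)) (A x') = modelPairing 𝔤 (P z) x' := fun z => by
      rw [skew, hx', map_neg, neg_neg]
    have h : (modelPairing 𝔤).flip (-A x') ∘ₗ (-A ∘ₗ P) = (modelPairing 𝔤).flip x' ∘ₗ P := by
      ext z
      simp [LinearMap.BilinForm.flip_apply, this]
    simp only [connectionBracket, h]
    simp only [LinearMap.comp_apply, LinearMap.neg_apply, Prod.fst_neg, map_neg, neg_neg]
    abel
  have e2 : connectionBracket x P (-A x') (-A ∘ₗ Q) + connectionBracket (-A x) (-A ∘ₗ P) x' Q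
      = -A (Q x.1) + P (A x').1 - Q (A x).1 + A (P x'.1) := by
    have h : (modelPairing 𝔤).flip x' ∘ₗ (-A ∘ₗ P) = -((modelPairing 𝔤).flip (-A x') ∘ₗ P) := by
      ext z
      simp [LinearMap.BilinForm.flip_apply, skew]
    have h' : ((0, (2 : ℝ) • ((modelPairing 𝔤).flip (-A x') ∘ₗ P), 0) : Model 𝔤)
        + (0, (2 : ℝ) • -((modelPairing 𝔤).flip (-A x') ∘ₗ P), 0) = 0 := by
      ext <;> simp
    simp only [connectionBracket, h]
    rw [add_add_add_comm, h']
    simp only [LinearMap.comp_apply, LinearMap.neg_apply, Prod.fst_neg, map_neg]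
    abel
  rw [e1, e2]
  simp only [map_add, map_sub, map_neg, hP, hQ]
  constructor <;> abel

/-- The Dorfman bracket is the one of the connection `D + α ⊗ K`. -/
def IsConnectionTerm (α : Module.Dual ℝ 𝔤) (K : Module.End ℝ (Model 𝔤)) : Prop :=
  ∀ u v : Model 𝔤, lieDorfman 0 0 u v
    = α u.1 • K v - α v.1 • K u + (0, (2 * modelPairing 𝔤 (K u) v) • α, 0)

end FlatConnection

/-! ### Integrability of parallel endomorphisms on the group. -/

section Integrability

variable {n : ℕ} {G : Type*} [TopologicalSpace G] [ChartedSpace (EuclideanSpace ℝ (Fin n)) G]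
  [Group G] [LieGroup (𝓡 n) ∞ G]

/-- The left-invariant field of endomorphisms of `E` with value `A` at `1`. -/
def leftFiberEnd (A : Module.End ℝ (Model (GroupLieAlgebra (𝓡 n) G))) (p : G) :
    Module.End ℝ (Fiber n p) :=
  (trivialise p).symm.toLinearMap ∘ₗ A ∘ₗ (trivialise p).toLinearMap

lemma leftFiberEnd_apply (A : Module.End ℝ (Model (GroupLieAlgebra (𝓡 n) G))) (p : G)
    (u : Fiber n p) : leftFiberEnd A p u = (trivialise p).symm (A (trivialise p u)) := rfl

lemma trivialise_leftFiberEnd (A : Module.End ℝ (Model (GroupLieAlgebra (𝓡 n) G))) (p : G)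
    (u : Fiber n p) : trivialise p (leftFiberEnd A p u) = A (trivialise p u) :=
  LinearEquiv.apply_symm_apply _ _

lemma leftFiberEnd_leftSection (A : Module.End ℝ (Model (GroupLieAlgebra (𝓡 n) G))) (p : G)
    (u : Model (GroupLieAlgebra (𝓡 n) G)) :
    leftFiberEnd A p (leftSection u p) = leftSection (A u) p := by
  rw [leftFiberEnd_apply, trivialise_leftSection, leftSection]

lemma smoothEnd_leftFiberEnd (A : Module.End ℝ (Model (GroupLieAlgebra (𝓡 n) G))) :
    SmoothEnd (leftFiberEnd A : (p : G) → Module.End ℝ (Fiber n p)) := by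
  intro s hs
  rw [smoothSection_iff] at hs ⊢
  simp only [trivialise_leftFiberEnd]
  exact hs.comp A

/-- The derivative of a section in the connection `D + α ⊗ K`. -/
def covariantDerivative (α : Module.Dual ℝ (GroupLieAlgebra (𝓡 n) G))
    (K : Module.End ℝ (Model (GroupLieAlgebra (𝓡 n) G)))
    (σ : G → Model (GroupLieAlgebra (𝓡 n) G)) (p : G) :
    GroupLieAlgebra (𝓡 n) G →ₗ[ℝ] Model (GroupLieAlgebra (𝓡 n) G) :=
  vectorDifferential n σ p ∘ₗ fromLie p + α.smulRight (K (σ p))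

variable {α : Module.Dual ℝ (GroupLieAlgebra (𝓡 n) G)}
  {K A : Module.End ℝ (Model (GroupLieAlgebra (𝓡 n) G))}

lemma trivialDorfman_eq (hK : IsConnectionTerm α K) (σ τ : G → Model (GroupLieAlgebra (𝓡 n) G))
    (p : G) : trivialDorfman 0 0 σ τ p = connectionBracket (σ p) (covariantDerivative α K σ p) (τ p)
      (covariantDerivative α K τ p) := by
  have h : ((0, (2 : ℝ) • ((modelPairing _).flip (τ p) ∘ₗ covariantDerivative α K σ p), 0) :
      Model (GroupLieAlgebra (𝓡 n) G))
      = (0, (2 : ℝ) • ((modelPairing _).flip (τ p) ∘ₗ vectorDifferential n σ p ∘ₗ fromLie p), 0)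
        + (0, (2 * modelPairing _ (K (σ p)) (τ p)) • α, 0) := by
    refine Prod.ext (by simp) (Prod.ext ?_ (by simp))
    ext z
    simp [covariantDerivative, LinearMap.BilinForm.flip_apply]
    ring
  rw [connectionBracket, h, trivialDorfman, hK]
  simp only [covariantDerivative, LinearMap.add_apply, LinearMap.comp_apply,
    LinearMap.smulRight_apply]
  abel

/-- An endomorphism that is constant in the trivialisation and commutes with `K` is parallel for `D
+ α ⊗ K`. -/
lemma covariantDerivative_comp (hKA : ∀ u, K (A u) = A (K u))
    {σ : G → Model (GroupLieAlgebra (𝓡 n) G)} (hσ : WeaklySmooth n σ) (p : G) :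
    covariantDerivative α K (fun q => A (σ q)) p = A ∘ₗ covariantDerivative α K σ p := by
  refine LinearMap.ext fun z => ?_
  simp only [covariantDerivative, LinearMap.add_apply, LinearMap.comp_apply,
    LinearMap.smulRight_apply, vectorDifferential_comp hσ A, hKA, map_add, map_smul]

/-- A skew-symmetric endomorphism that is parallel for `D + α ⊗ K` is integrable. -/
lemma isIntegrable_of_parallel (hK : IsConnectionTerm α K) (hKA : ∀ u, K (A u) = A (K u))
    (skew : ∀ u v, modelPairing _ (A u) v = -modelPairing _ u (A v)) :
    IsIntegrable (leftForm 0) (leftForm 0)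
      (leftFiberEnd A : (p : G) → Module.End ℝ (Fiber n p)) := by
  intro s t s' t' hs hs'
  -- A section of the eigenbundle is `s - i A s` with `A² s = -s`; differentiating these relations
  -- with the parallel `A` shows that the covariant derivatives satisfy them too.
  have sec : ∀ {s t : (p : G) → Fiber n p}, IsSectionOfL (leftFiberEnd A) s t →
      (∀ p, trivialise p (t p) = -A (trivialise p (s p))) ∧
      (∀ p, A (A (trivialise p (s p))) = -trivialise p (s p)) ∧
      (∀ p, covariantDerivative α K (fun q => trivialise q (t q)) p
        = -A ∘ₗ covariantDerivative α K (fun q => trivialise q (s q)) p) ∧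
      ∀ p z, A (A (covariantDerivative α K (fun q => trivialise q (s q)) p z))
        = -covariantDerivative α K (fun q => trivialise q (s q)) p z := by
    intro s t h
    have hσ := (smoothSection_iff s).1 h.smooth_re
    have h1 : ∀ p, trivialise p (t p) = -A (trivialise p (s p)) := fun p => by
      rw [← trivialise_leftFiberEnd, h.re, map_neg, neg_neg]
    have h2 : ∀ p, A (A (trivialise p (s p))) = -trivialise p (s p) := fun p => by
      rw [← neg_neg (A (trivialise p (s p))), ← h1, map_neg, ← trivialise_leftFiberEnd, h.im]
    refine ⟨h1, h2, fun p => ?_, fun p z => ?_⟩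
    · simp only [h1]
      exact covariantDerivative_comp (A := -A) (fun u => by simp [hKA]) hσ p
    · have h3 : covariantDerivative α K (fun q => (A * A) (trivialise q (s q))) p
          = (A * A) ∘ₗ covariantDerivative α K (fun q => trivialise q (s q)) p :=
        covariantDerivative_comp (A := A * A) (fun u => by simp [hKA]) hσ p
      have h4 : covariantDerivative α K (fun q => (-1 : Module.End ℝ _) (trivialise q (s q))) p
          = (-1 : Module.End ℝ _) ∘ₗ covariantDerivative α K (fun q => trivialise q (s q)) p :=
        covariantDerivative_comp (A := -1) (fun u => by simp) hσ p
      have h5 : (fun q => (A * A) (trivialise q (s q)))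
          = fun q => (-1 : Module.End ℝ _) (trivialise q (s q)) := by
        ext1 q
        simp [h2]
      rw [h5, h4] at h3
      have := DFunLike.congr_fun h3 z
      simpa using this.symm
  obtain ⟨a1, -, a3, a4⟩ := sec hs
  obtain ⟨b1, b2, b3, b4⟩ := sec hs'
  refine ⟨_, _, _, _, isDorfman_trivialDorfman 0 0 hs.smooth_re hs'.smooth_re,
    isDorfman_trivialDorfman 0 0 hs.smooth_im hs'.smooth_im,
    isDorfman_trivialDorfman 0 0 hs.smooth_re hs'.smooth_im,
    isDorfman_trivialDorfman 0 0 hs.smooth_im hs'.smooth_re, fun p => ?_⟩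
  have key := connectionBracket_integrable skew (x := trivialise p (s p))
    (x' := trivialise p (s' p))
    (P := covariantDerivative α K (fun q => trivialise q (s q)) p)
    (Q := covariantDerivative α K (fun q => trivialise q (s' q)) p) (b2 p) (a4 p) (b4 p)
  rw [← a1, ← b1, ← a3, ← b3] at key
  simp only [trivialDorfman_eq hK]
  rw [← map_sub, ← map_add, ← map_neg, leftFiberEnd_apply, leftFiberEnd_apply,
    LinearEquiv.apply_symm_apply, LinearEquiv.apply_symm_apply, key.1, key.2]
  exact ⟨rfl, rfl⟩

end Integrability

/-! ### Construction of the endomorphisms on `E₋ ⊕ E₊` from the components. -/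

section Splitting

variable {𝔤 : Type*} [LieRing 𝔤] [LieAlgebra ℝ 𝔤]

/-- The pointwise identities between the components of a `B_n`-generalized almost pseudo-Hermitian
structure, for even `n`. -/
structure HermitianComponents (g : LinearMap.BilinForm ℝ 𝔤) (Jp Jm : Module.End ℝ 𝔤) (Xp Xm : 𝔤)
    (c : ℝ) : Prop where
  symm : ∀ x y, g x y = g y x
  nondegenerate : g.Nondegenerate
  minus_sq : ∀ x, Jm (Jm x) = -x
  minus_skew : ∀ x y, g (Jm x) y = -g x (Jm y)
  plus_skew : ∀ x y, g (Jp x) y = -g x (Jp y)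
  plus_Xp : Jp Xp = -(c • Xm)
  plus_Xm : Jp Xm = c • Xp
  norm_Xp : g Xp Xp = 1 - c ^ 2
  norm_Xm : g Xm Xm = 1 - c ^ 2
  orthogonal : g Xp Xm = 0
  plus_sq : ∀ x, Jp (Jp x) = -x + g Xp x • Xp + g Xm x • Xm

variable {g : LinearMap.BilinForm ℝ 𝔤} {Jp Jm : Module.End ℝ 𝔤} {Xp Xm : 𝔤} {c : ℝ}

/-- The product `𝓖𝓕` has the same components as `𝓕` except for `-J₋`, so every statement about `𝓕`
covers `𝓖𝓕` as well. -/
lemma HermitianComponents.neg (h : HermitianComponents g Jp Jm Xp Xm c) :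
    HermitianComponents g Jp (-Jm) Xp Xm c where
  __ := h
  minus_sq x := by simp [h.minus_sq]
  minus_skew x y := by simp [h.minus_skew]

variable [Module.Finite ℝ 𝔤]

/-- The splitting `E = E_- ⊕ E_+` of the model fibre. -/
def splitting (g : LinearMap.BilinForm ℝ 𝔤) (hg : g.Nondegenerate) : (𝔤 × 𝔤 × ℝ) ≃ₗ[ℝ] Model 𝔤 where
  toFun a := (a.1 + a.2.1, g (a.2.1 - a.1), a.2.2)
  invFun u := ((1 / 2 : ℝ) • (u.1 - (g.toDual hg).symm u.2.1),
    (1 / 2 : ℝ) • (u.1 + (g.toDual hg).symm u.2.1), u.2.2)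
  map_add' a b := by
    refine Prod.ext ?_ (Prod.ext ?_ rfl)
    · simp only [Prod.fst_add, Prod.snd_add]; abel
    · simp only [Prod.fst_add, Prod.snd_add, ← map_add]; congr 1; abel
  map_smul' r a := by
    refine Prod.ext ?_ (Prod.ext ?_ rfl)
    · simp
    · simp [smul_sub]
  left_inv a := by
    have h : (g.toDual hg).symm (g (a.2.1 - a.1)) = a.2.1 - a.1 :=
      (g.toDual hg).symm_apply_apply _
    simp only [h]
    refine Prod.ext ?_ (Prod.ext ?_ rfl)
    · simp only; module
    · simp only; module
  right_inv u := by
    have h : g ((g.toDual hg).symm u.2.1) = u.2.1 := (g.toDual hg).apply_symm_apply _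
    refine Prod.ext ?_ (Prod.ext ?_ rfl)
    · simp only; module
    · simp only
      rw [← smul_sub, add_sub_sub_cancel, map_smul, map_add, h]
      module

lemma splitting_apply (hg : g.Nondegenerate) (x y : 𝔤) (l : ℝ) :
    splitting g hg (x, y, l) = minusPart g x + plusPart g y l := by
  refine Prod.ext rfl (Prod.ext ?_ ?_)
  · simp [splitting, minusPart_apply, plusPart, sub_eq_neg_add]
  · simp [splitting, minusPart_apply, plusPart]

lemma minusPart_eq_splitting (hg : g.Nondegenerate) (x : 𝔤) :
    minusPart g x = splitting g hg (x, 0, 0) := by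
  rw [splitting_apply]
  ext <;> simp [plusPart]

lemma plusPart_eq_splitting (hg : g.Nondegenerate) (x : 𝔤) (l : ℝ) :
    plusPart g x l = splitting g hg (0, x, l) := by
  rw [splitting_apply, map_zero, zero_add]

lemma modelPairing_splitting (hg : g.Nondegenerate) (symm : ∀ x y, g x y = g y x)
    (a b : 𝔤 × 𝔤 × ℝ) : modelPairing 𝔤 (splitting g hg a) (splitting g hg b)
      = -g a.1 b.1 + g a.2.1 b.2.1 + a.2.2 * b.2.2 := by
  obtain ⟨x, y, l⟩ := a
  obtain ⟨x', y', l'⟩ := b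
  simp only [splitting_apply, map_add, LinearMap.add_apply, pairing_minus_minus symm,
    pairing_minus_plus symm, pairing_plus_plus symm]
  have : modelPairing 𝔤 (plusPart g y l) (minusPart g x') = 0 := by
    have := pairing_minus_plus symm x' y l
    rwa [modelPairing_apply, add_comm (_ : ℝ) ((minusPart g x').2.1 _), mul_comm (_ : ℝ) (plusPart g y l).2.2]
      at this
  rw [this]
  ring

/-- The endomorphism `± 1` on `E_±`. -/
def metricEnd (g : LinearMap.BilinForm ℝ 𝔤) (hg : g.Nondegenerate) : Module.End ℝ (Model 𝔤) :=
  (splitting g hg).conj ((-LinearMap.fst ℝ 𝔤 (𝔤 × ℝ)).prod (LinearMap.snd ℝ 𝔤 (𝔤 × ℝ)))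

/-- The endomorphism with the components `J₊`, `J₋`, `X₋`. -/
def componentEnd (g : LinearMap.BilinForm ℝ 𝔤) (hg : g.Nondegenerate) (Jp Jm : Module.End ℝ 𝔤)
    (Xm : 𝔤) : Module.End ℝ (Model 𝔤) :=
  (splitting g hg).conj ((Jm ∘ₗ LinearMap.fst ℝ 𝔤 (𝔤 × ℝ)).prod
    (((Jp.coprod (LinearMap.toSpanSingleton ℝ 𝔤 Xm)).prod (-g Xm ∘ₗ LinearMap.fst ℝ 𝔤 ℝ)) ∘ₗ
      LinearMap.snd ℝ 𝔤 (𝔤 × ℝ)))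

lemma metricEnd_splitting (hg : g.Nondegenerate) (x y : 𝔤) (l : ℝ) :
    metricEnd g hg (splitting g hg (x, y, l)) = splitting g hg (-x, y, l) := by
  rw [metricEnd, LinearEquiv.conj_apply_apply, LinearEquiv.symm_apply_apply]
  rfl

lemma componentEnd_splitting (hg : g.Nondegenerate) (x y : 𝔤) (l : ℝ) :
    componentEnd g hg Jp Jm Xm (splitting g hg (x, y, l))
      = splitting g hg (Jm x, Jp y + l • Xm, -g Xm y) := by
  rw [componentEnd, LinearEquiv.conj_apply_apply, LinearEquiv.symm_apply_apply]
  rfl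

lemma exists_eq_splitting (hg : g.Nondegenerate) (u : Model 𝔤) :
    ∃ x y l, u = splitting g hg (x, y, l) := by
  obtain ⟨a, rfl⟩ := (splitting g hg).surjective u
  exact ⟨_, _, _, rfl⟩

lemma metricEnd_componentEnd (hg : g.Nondegenerate) (u : Model 𝔤) :
    metricEnd g hg (componentEnd g hg Jp Jm Xm u) = componentEnd g hg Jp (-Jm) Xm u := by
  obtain ⟨x, y, l, rfl⟩ := exists_eq_splitting hg u
  rw [componentEnd_splitting, metricEnd_splitting, componentEnd_splitting, LinearMap.neg_apply]

lemma componentEnd_metricEnd (hg : g.Nondegenerate) (u : Model 𝔤) :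
    componentEnd g hg Jp Jm Xm (metricEnd g hg u) = componentEnd g hg Jp (-Jm) Xm u := by
  obtain ⟨x, y, l, rfl⟩ := exists_eq_splitting hg u
  rw [metricEnd_splitting, componentEnd_splitting, componentEnd_splitting, LinearMap.neg_apply,
    map_neg]

lemma HermitianComponents.componentEnd_skew (h : HermitianComponents g Jp Jm Xp Xm c)
    (u v : Model 𝔤) : modelPairing 𝔤 (componentEnd g h.nondegenerate Jp Jm Xm u) v
      = -modelPairing 𝔤 u (componentEnd g h.nondegenerate Jp Jm Xm v) := by
  obtain ⟨x, y, l, rfl⟩ := exists_eq_splitting h.nondegenerate u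
  obtain ⟨x', y', l', rfl⟩ := exists_eq_splitting h.nondegenerate v
  rw [componentEnd_splitting, componentEnd_splitting, modelPairing_splitting _ h.symm,
    modelPairing_splitting _ h.symm]
  simp only [h.minus_skew, map_add, map_smul, LinearMap.add_apply, LinearMap.smul_apply,
    h.plus_skew, smul_eq_mul, h.symm y Xm]
  ring

lemma HermitianComponents.componentEnd_kernel (h : HermitianComponents g Jp Jm Xp Xm c) :
    componentEnd g h.nondegenerate Jp Jm Xm (plusPart g Xp c) = 0 := by
  rw [plusPart_eq_splitting h.nondegenerate, componentEnd_splitting, h.plus_Xp, h.symm,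
    h.orthogonal, map_zero, neg_zero, neg_add_cancel]
  exact map_zero _

lemma HermitianComponents.componentEnd_sq (h : HermitianComponents g Jp Jm Xp Xm c)
    (u : Model 𝔤) : componentEnd g h.nondegenerate Jp Jm Xm
      (componentEnd g h.nondegenerate Jp Jm Xm u)
      = -u + modelPairing 𝔤 u (plusPart g Xp c) • plusPart g Xp c := by
  obtain ⟨x, y, l, rfl⟩ := exists_eq_splitting h.nondegenerate u
  rw [plusPart_eq_splitting h.nondegenerate, componentEnd_splitting, componentEnd_splitting,
    modelPairing_splitting _ h.symm, ← map_neg (splitting g h.nondegenerate), ← map_smul, ← map_add]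
  congr 1
  refine Prod.ext ?_ (Prod.ext ?_ ?_)
  · simp [h.minus_sq]
  · simp only [map_add, map_smul, h.plus_sq, h.plus_Xm, h.symm y Xp, Prod.snd_add, Prod.snd_neg,
      Prod.fst_add, Prod.fst_neg, Prod.smul_snd, Prod.smul_fst, map_zero]
    module
  · have e : g Xm (Jp y) = -(c * g Xp y) := by
      have := h.plus_skew Xm y
      rw [h.plus_Xm, map_smul, LinearMap.smul_apply, smul_eq_mul] at this
      linarith
    simp only [map_add, map_smul, e, h.norm_Xm, h.symm y Xp, Prod.snd_add, Prod.snd_neg,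
      Prod.smul_snd, map_zero, smul_eq_mul]
    ring

/-- The lift of a skew-symmetric endomorphism to the model fibre. -/
def rotationLift (K : Module.End ℝ 𝔤) : Module.End ℝ (Model 𝔤) :=
  K.prodMap ((-K.dualMap).prodMap 0)

/-- For `g`-skew `K` the dual action on covectors corresponds to `K` under `g`, so the lift
preserves the splitting and acts by `K` on both tangent factors. -/
lemma rotationLift_splitting (hg : g.Nondegenerate) {K : Module.End ℝ 𝔤}
    (hK : ∀ x y, g (K x) y = -g x (K y)) (x y : 𝔤) (l : ℝ) :
    rotationLift K (splitting g hg (x, y, l)) = splitting g hg (K x, K y, 0) := by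
  refine Prod.ext ?_ (Prod.ext ?_ rfl)
  · simp [rotationLift, splitting]
  · ext z
    simp [rotationLift, splitting, hK]
    ring

lemma rotationLift_componentEnd (hg : g.Nondegenerate) {K : Module.End ℝ 𝔤}
    (hK : ∀ x y, g (K x) y = -g x (K y)) (hm : ∀ x, K (Jm x) = Jm (K x))
    (hp : ∀ x, K (Jp x) = Jp (K x)) (hX : K Xm = 0) (u : Model 𝔤) :
    rotationLift K (componentEnd g hg Jp Jm Xm u) = componentEnd g hg Jp Jm Xm (rotationLift K u) := by
  obtain ⟨x, y, l, rfl⟩ := exists_eq_splitting hg u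
  rw [componentEnd_splitting, rotationLift_splitting hg hK, rotationLift_splitting hg hK,
    componentEnd_splitting, hm, map_add, map_smul, hp, hX]
  congr 3
  · module
  · have := hK Xm y
    rw [hX, map_zero, LinearMap.zero_apply] at this
    linarith

/-- The hypothesis says that the connection `x ↦ α x • K` is torsion-free, so for `H = F = 0` the
bracket has no torsion term. -/
lemma isConnectionTerm_rotationLift {K : Module.End ℝ 𝔤} {α : Module.Dual ℝ 𝔤}
    (h : ∀ x y, ⁅x, y⁆ = α x • K y - α y • K x) : IsConnectionTerm α (rotationLift K) := by
  intro u v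
  refine Prod.ext ?_ (Prod.ext ?_ ?_)
  · simp [lieDorfman, rotationLift, h]
  · ext z
    simp [lieDorfman, rotationLift, h, modelPairing_apply]
    ring
  · simp [lieDorfman, rotationLift]

end Splitting

/-! ### Left-invariant pseudo-Kähler structures from parallel components. -/

section Existence

variable {n : ℕ} {G : Type*} [TopologicalSpace G] [ChartedSpace (EuclideanSpace ℝ (Fin n)) G]
  [Group G] [LieGroup (𝓡 n) ∞ G]
  {g : LinearMap.BilinForm ℝ (GroupLieAlgebra (𝓡 n) G)}
  {Jp Jm K : Module.End ℝ (GroupLieAlgebra (𝓡 n) G)} {Xp Xm : GroupLieAlgebra (𝓡 n) G} {c : ℝ}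
  {α : Module.Dual ℝ (GroupLieAlgebra (𝓡 n) G)}

lemma isTwist_zero : IsTwist (n := n) (M := G) (leftForm 0) (leftForm 0) := by
  have h2 : ∀ (p : G) (x y : Tan n p), leftForm 0 p ![x, y] = 0 := fun p x y => by
    rw [leftForm_two]; rfl
  have h3 : ∀ (p : G) (x y z : Tan n p), leftForm 0 p ![x, y, z] = 0 := fun p x y z => by
    rw [leftForm_three]; rfl
  constructor
  · intro X Y Z _ _ _
    simp only [h3]
    exact SmoothFunction.const 0
  · intro X Y _ _
    simp only [h2]
    exact SmoothFunction.const 0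
  · intro X Y Z _ _ _ p
    simp only [h2, dirDeriv_const]
    norm_num
  · intro X Y Z W _ _ _ _ p
    simp only [h2, h3, dirDeriv_const]
    norm_num

lemma pairing_leftFiberEnd_left (A : Module.End ℝ (Model (GroupLieAlgebra (𝓡 n) G))) (p : G)
    (u v : Fiber n p) : pairing (leftFiberEnd A p u) v
      = modelPairing _ (A (trivialise p u)) (trivialise p v) := by
  rw [← modelPairing_trivialise, trivialise_leftFiberEnd]

lemma pairing_leftFiberEnd_right (A : Module.End ℝ (Model (GroupLieAlgebra (𝓡 n) G))) (p : G)
    (u v : Fiber n p) : pairing u (leftFiberEnd A p v)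
      = modelPairing _ (trivialise p u) (A (trivialise p v)) := by
  rw [← modelPairing_trivialise, trivialise_leftFiberEnd]

lemma HermitianComponents.isBnAlmostComplex (hn : Even n)
    (h : HermitianComponents g Jp Jm Xp Xm c) :
    IsBnAlmostComplex (leftFiberEnd (componentEnd g h.nondegenerate Jp Jm Xm) :
      (p : G) → Module.End ℝ (Fiber n p)) := by
  refine ⟨smoothEnd_leftFiberEnd _, fun p u v => ?_, fun p =>
    ⟨leftSection (plusPart g Xp c) p, ?_, ?_, fun u => ?_⟩⟩
  · rw [pairing_leftFiberEnd_left, pairing_leftFiberEnd_right, h.componentEnd_skew]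
  · rw [pairing_leftSection, pairing_plus_plus h.symm, h.norm_Xp, hn.neg_one_pow]
    ring
  · rw [leftFiberEnd_leftSection, h.componentEnd_kernel]
    exact map_zero _
  · apply (trivialise p).injective
    rw [trivialise_leftFiberEnd, trivialise_leftFiberEnd, h.componentEnd_sq, hn.neg_one_pow,
      one_mul, map_add, map_neg, map_smul, trivialise_leftSection, ← modelPairing_trivialise,
      trivialise_leftSection]

lemma HermitianComponents.isGeneralizedMetric (h : HermitianComponents g Jp Jm Xp Xm c) :
    IsGeneralizedMetric (leftFiberEnd (metricEnd g h.nondegenerate) :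
      (p : G) → Module.End ℝ (Fiber n p)) := by
  refine ⟨smoothEnd_leftFiberEnd _, fun p u => ?_, fun p u v => ?_, fun p => ⟨?_, fun X => ?_⟩⟩
  · apply (trivialise p).injective
    rw [trivialise_leftFiberEnd, trivialise_leftFiberEnd]
    obtain ⟨x, y, l, hu⟩ := exists_eq_splitting h.nondegenerate (trivialise p u)
    rw [hu, metricEnd_splitting, metricEnd_splitting, neg_neg]
  · rw [pairing_leftFiberEnd_left, pairing_leftFiberEnd_right]
    obtain ⟨x, y, l, hu⟩ := exists_eq_splitting h.nondegenerate (trivialise p u)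
    obtain ⟨x', y', l', hv⟩ := exists_eq_splitting h.nondegenerate (trivialise p v)
    rw [hu, hv, metricEnd_splitting, metricEnd_splitting, modelPairing_splitting _ h.symm,
      modelPairing_splitting _ h.symm]
    simp
  · have key : ∀ u : Fiber n p, leftFiberEnd (metricEnd g h.nondegenerate) p u = -u →
        u = leftSection (minusPart g (toLie p u.1)) p := by
      intro u hu
      have hu' := congrArg (trivialise p) hu
      rw [trivialise_leftFiberEnd, map_neg] at hu'
      obtain ⟨x, y, l, e⟩ := exists_eq_splitting h.nondegenerate (trivialise p u)
      rw [e, metricEnd_splitting, ← map_neg (splitting g h.nondegenerate)] at hu'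
      have h1 := (splitting g h.nondegenerate).injective hu'
      simp only [Prod.neg_mk, Prod.mk.injEq, self_eq_neg] at h1
      obtain ⟨-, hy, rfl⟩ := h1
      have hy0 : (2 : ℝ) • y = 0 := by
        rw [two_smul]
        nth_rw 1 [hy]
        exact neg_add_cancel y
      obtain rfl : y = 0 := by simpa using hy0
      rw [← minusPart_eq_splitting] at e
      have e1 : toLie p u.1 = x := congrArg (fun w : Model _ => w.1) e
      rw [e1, ← e, leftSection_trivialise]
    rintro ⟨u, hu⟩ ⟨v, hv⟩ huv
    apply Subtype.ext
    change u.1 = v.1 at huv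
    change u = v
    rw [key u hu, key v hv, huv]
  · refine ⟨⟨leftSection (minusPart g (toLie p X)) p, ?_⟩, fromLie_toLie p X⟩
    rw [leftFiberEnd_leftSection, minusPart_eq_splitting h.nondegenerate, metricEnd_splitting,
      ← leftSection_neg,
      ← map_neg (splitting g h.nondegenerate)]
    simp

lemma HermitianComponents.isComponents (h : HermitianComponents g Jp Jm Xp Xm c) :
    IsComponents (n := n) (M := G) (leftFiberEnd (metricEnd g h.nondegenerate))
      (leftFiberEnd (componentEnd g h.nondegenerate Jp Jm Xm)) (leftBilin g) (leftEnd Jp)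
      (leftEnd Jm) (leftField Xp) (leftField Xm) (fun _ => c) := by
  have minus : ∀ (p : G) (X : Tan n p), ((X, -leftBilin g p X, 0) : Fiber n p)
      = leftSection (minusPart g (toLie p X)) p := fun p X => by
    rw [leftSection_minusPart, fromLie_toLie]
  have plus : ∀ (p : G) (X : Tan n p) (l : ℝ), ((X, leftBilin g p X, l) : Fiber n p)
      = leftSection (plusPart g (toLie p X) l) p := fun p X l => by
    rw [leftSection_plusPart, fromLie_toLie]
  have hJ : ∀ (J : Module.End ℝ (GroupLieAlgebra (𝓡 n) G)) (p : G) (X : Tan n p),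
      toLie p (leftEnd J p X) = J (toLie p X) := fun J p X => toLie_fromLie _ _
  refine ⟨fun p X => ?_, fun p X Y => ?_, fun p X => ?_, fun p => ?_, fun p => ?_, fun p X => ?_,
    fun p => ?_⟩
  · rw [minus, leftFiberEnd_leftSection, minusPart_eq_splitting h.nondegenerate,
      metricEnd_splitting, ← leftSection_neg,
      ← map_neg (splitting g h.nondegenerate)]
    simp
  · rw [minus, minus, pairing_leftSection, pairing_minus_minus h.symm, neg_neg]
    rfl
  · rw [minus, minus, leftFiberEnd_leftSection, minusPart_eq_splitting h.nondegenerate,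
      componentEnd_splitting, hJ, minusPart_eq_splitting h.nondegenerate]
    simp
  · rw [plus, pairing_leftSection, pairing_plus_plus h.symm, leftField, toLie_fromLie, h.norm_Xp]
    ring
  · rw [plus, leftFiberEnd_leftSection, leftField, toLie_fromLie, h.componentEnd_kernel]
    exact map_zero _
  · have e : leftBilin g p (leftField Xm p) X = g Xm (toLie p X) := by
      rw [leftField, ← fromLie_toLie p X, leftBilin_fromLie, toLie_fromLie]
    rw [e, plus, plus, leftFiberEnd_leftSection, plusPart_eq_splitting h.nondegenerate,
      componentEnd_splitting, hJ, plusPart_eq_splitting h.nondegenerate]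
    simp
  · have e : ((0, 0, 1) : Fiber n p) = leftSection (plusPart g 0 1) p := by
      rw [leftSection_plusPart, map_zero, map_zero]
    rw [e, plus, leftFiberEnd_leftSection, plusPart_eq_splitting h.nondegenerate,
      componentEnd_splitting, leftField, toLie_fromLie, plusPart_eq_splitting h.nondegenerate]
    simp

/-- The structure defined by components that are parallel for the connection `D + α ⊗ K`. -/
lemma HermitianComponents.exists_isPseudoKahler (hn : Even n)
    (h : HermitianComponents g Jp Jm Xp Xm c) (hK : ∀ x y, g (K x) y = -g x (K y))
    (hm : ∀ x, K (Jm x) = Jm (K x)) (hp : ∀ x, K (Jp x) = Jp (K x)) (hX : K Xm = 0)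
    (hb : ∀ x y, ⁅x, y⁆ = α x • K y - α y • K x) :
    ∃ Gend A : (p : G) → Module.End ℝ (Fiber n p),
      IsPseudoKahler (leftForm 0) (leftForm 0) Gend A ∧
      IsComponents Gend A (leftBilin g) (leftEnd Jp) (leftEnd Jm) (leftField Xp) (leftField Xm)
        (fun _ => c) := by
  have hα := isConnectionTerm_rotationLift hb
  have prod : (fun p : G => leftFiberEnd (metricEnd g h.nondegenerate) p *
      leftFiberEnd (componentEnd g h.nondegenerate Jp Jm Xm) p)
      = leftFiberEnd (componentEnd g h.nondegenerate Jp (-Jm) Xm) := by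
    ext1 p
    refine LinearMap.ext fun u => ?_
    rw [Module.End.mul_apply, leftFiberEnd_apply _ p (leftFiberEnd _ p u), trivialise_leftFiberEnd,
      metricEnd_componentEnd, leftFiberEnd_apply]
  refine ⟨_, _, ⟨h.isGeneralizedMetric, fun p => ?_, h.isBnAlmostComplex hn, ?_, ?_, ?_⟩,
    h.isComponents⟩
  · refine LinearMap.ext fun u => ?_
    rw [Module.End.mul_apply, Module.End.mul_apply, leftFiberEnd_apply _ p (leftFiberEnd _ p u),
      trivialise_leftFiberEnd, leftFiberEnd_apply _ p (leftFiberEnd _ p u),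
      trivialise_leftFiberEnd, metricEnd_componentEnd, componentEnd_metricEnd]
  · exact isIntegrable_of_parallel hα (rotationLift_componentEnd h.nondegenerate hK hm hp hX)
      h.componentEnd_skew
  · rw [prod]
    exact h.neg.isBnAlmostComplex hn
  · rw [prod]
    exact isIntegrable_of_parallel hα
      (rotationLift_componentEnd h.nondegenerate hK (fun x => by simp [hm]) hp hX)
      h.neg.componentEnd_skew

end Existence

/-! ### Special bases: the bracket as a rotation and the adapted components. -/

section SpecialBasis

variable {𝔤 : Type*} [LieRing 𝔤] [LieAlgebra ℝ 𝔤] {𝔲 : Submodule ℝ 𝔤} {𝔤₀ : LieIdeal ℝ 𝔤}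
  {g : LinearMap.BilinForm ℝ 𝔤} {Jp Jm : Module.End ℝ 𝔤} {Xp Xm : 𝔤}
  {b : Module.Basis (Fin 4) ℝ 𝔤} {c ε₁ ε₂ l β x y x' y' : ℝ}

lemma forall_fin_four {P : Fin 4 → Prop} (h0 : P 0) (h1 : P 1) (h2 : P 2) (h3 : P 3) : ∀ i, P i :=
  fun i => by fin_cases i <;> assumption

/-- Skew-symmetry of an endomorphism may be checked on a basis. -/
lemma skew_of_basis {J : Module.End ℝ 𝔤} (h : ∀ i j, g (J (b i)) (b j) = -g (b i) (J (b j)))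
    (z w : 𝔤) : g (J z) w = -g z (J w) := by
  have : g ∘ₗ J = -(g.compl₂ J) := by
    refine b.ext fun i => b.ext fun j => ?_
    simp [h]
  have := DFunLike.congr_fun (DFunLike.congr_fun this z) w
  simpa using this

lemma IsOrthonormalFamily.nondegenerate (h : IsOrthonormalFamily g b ![ε₁, ε₁, ε₂, ε₂]) :
    g.Nondegenerate := by
  have hs : ∀ x y, g x y = g y x := fun x y => by rw [h.form_eq, h.form_eq]; ring
  have key : ∀ x, (∀ y, g x y = 0) → x = 0 := fun x hx => by
    apply b.repr.injective
    ext i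
    rw [h.repr_eq, hx, mul_zero, map_zero, Finsupp.zero_apply]
  exact ⟨key, fun x hx => key x fun y => (hs x y).trans (hx y)⟩

/-- The rotation of the plane of the last two vectors of a frame. -/
def planeRotation (b : Module.Basis (Fin 4) ℝ 𝔤) : Module.End ℝ 𝔤 :=
  b.constr ℝ ![0, 0, b 3, -b 2]

lemma planeRotation_basis (b : Module.Basis (Fin 4) ℝ 𝔤) :
    planeRotation b (b 0) = 0 ∧ planeRotation b (b 1) = 0 ∧ planeRotation b (b 2) = b 3 ∧
      planeRotation b (b 3) = -b 2 := by
  refine ⟨?_, ?_, ?_, ?_⟩ <;> exact b.constr_basis ℝ _ _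

lemma IsOrthonormalFamily.planeRotation_skew (h : IsOrthonormalFamily g b ![ε₁, ε₁, ε₂, ε₂])
    (z w : 𝔤) : g (planeRotation b z) w = -g z (planeRotation b w) := by
  obtain ⟨k0, k1, k2, k3⟩ := planeRotation_basis b
  obtain ⟨⟨g00, g11, g22, g33⟩, ⟨g01, g02, g03, g12, g13, g23⟩,
    ⟨g10, g20, g30, g21, g31, g32⟩⟩ := h.values
  refine skew_of_basis (b := b) (forall_fin_four ?_ ?_ ?_ ?_) z w <;>
    refine forall_fin_four ?_ ?_ ?_ ?_ <;>
    simp only [k0, k1, k2, k3, map_zero, map_neg, LinearMap.zero_apply, LinearMap.neg_apply, g22,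
      g33, g02, g03, g12, g13, g23, g20, g30, g21, g31, g32, neg_zero, neg_neg]

/-- The bracket of a special basis. -/
lemma IsSpecialBasis.lie_eq (h : IsSpecialBasis 𝔲 𝔤₀ g b ε₁ ε₂ l β) (z w : 𝔤) :
    ⁅z, w⁆ = b.constr ℝ ![β, ε₂ * l, 0, 0] z • planeRotation b w
      - b.constr ℝ ![β, ε₂ * l, 0, 0] w • planeRotation b z := by
  obtain ⟨k0, k1, k2, k3⟩ := planeRotation_basis b
  -- `ad (b 0)` and `ad (b 1)` act on the plane of `b 2`, `b 3` as `β` and `ε₂ l` times the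
  -- rotation; `α` records these speeds.
  set α : 𝔤 →ₗ[ℝ] ℝ := b.constr ℝ ![β, ε₂ * l, 0, 0] with hα
  have a0 : α (b 0) = β := b.constr_basis ℝ _ _
  have a1 : α (b 1) = ε₂ * l := b.constr_basis ℝ _ _
  have a2 : α (b 2) = 0 := b.constr_basis ℝ _ _
  have a3 : α (b 3) = 0 := b.constr_basis ℝ _ _
  have b10 : ⁅b 1, b 0⁆ = 0 := by rw [← lie_skew, h.u_e₁, neg_zero]
  have b20 : ⁅b 2, b 0⁆ = -(β • b 3) := by rw [← lie_skew, h.u_e₂]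
  have b30 : ⁅b 3, b 0⁆ = β • b 2 := by rw [← lie_skew, h.u_e₃, neg_neg]
  have b21 : ⁅b 2, b 1⁆ = -((ε₂ * l) • b 3) := by rw [← lie_skew, h.e₁_e₂]
  have b13 : ⁅b 1, b 3⁆ = -((ε₂ * l) • b 2) := by rw [← lie_skew, h.e₃_e₁]
  have b32 : ⁅b 3, b 2⁆ = 0 := by rw [← lie_skew, h.e₂_e₃, neg_zero]
  have key : (LieAlgebra.ad ℝ 𝔤 : 𝔤 →ₗ[ℝ] Module.End ℝ 𝔤)
      = α.smulRight (planeRotation b) - ((LinearMap.lsmul ℝ 𝔤).flip.compl₁₂ (planeRotation b) α) := by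
    refine b.ext fun i => b.ext fun j => ?_
    change ⁅b i, b j⁆ = α (b i) • planeRotation b (b j) - α (b j) • planeRotation b (b i)
    revert i j
    refine forall_fin_four ?_ ?_ ?_ ?_ <;> refine forall_fin_four ?_ ?_ ?_ ?_ <;>
      simp only [lie_self, h.u_e₁, h.u_e₂, h.u_e₃, h.e₁_e₂, h.e₂_e₃, h.e₃_e₁, b10, b20, b30, b21,
        b13, b32, k0, k1, k2, k3, a0, a1, a2, a3, smul_zero, zero_smul, sub_self, smul_neg,
        sub_zero, zero_sub, neg_neg, neg_zero]
  exact DFunLike.congr_fun (DFunLike.congr_fun key z) w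

/-- In a special basis, `J₊` is a multiple of the rotation on the plane of the last two vectors. -/
lemma IsSpecialComponents.Jp_plane (h : IsSpecialComponents g Jp Jm Xp Xm c b ε₁ x y x' y')
    (ho : IsOrthonormalFamily g b ![ε₁, ε₁, ε₂, ε₂]) :
    ∃ d : ℝ, Jp (b 2) = d • b 3 ∧ Jp (b 3) = -(d • b 2) := by
  have e2 : ε₂ ≠ 0 := by rcases ho.1 2 with h | h <;> simp at h <;> rw [h] <;> norm_num
  obtain ⟨⟨-, -, g22, g33⟩, ⟨-, -, -, -, -, g23⟩, ⟨-, -, -, -, -, g32⟩⟩ := ho.values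
  have m2 : b 2 ∈ Submodule.span ℝ {b 2, b 3} := Submodule.subset_span (by simp)
  have m3 : b 3 ∈ Submodule.span ℝ {b 2, b 3} := Submodule.subset_span (by simp)
  obtain ⟨h2, -, s2⟩ := h.Jp_span _ m2
  obtain ⟨h3, -, s3⟩ := h.Jp_span _ m3
  obtain ⟨p, q, h2⟩ := Submodule.mem_span_pair.1 h2
  obtain ⟨r, s, h3⟩ := Submodule.mem_span_pair.1 h3
  have t22 := s2 _ m2
  have t23 := s2 _ m3
  have t33 := s3 _ m3
  rw [← h2] at t22 t23
  rw [← h3] at t23 t33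
  simp only [map_add, map_smul, LinearMap.add_apply, LinearMap.smul_apply, smul_eq_mul, g22, g33,
    g23, g32] at t22 t23 t33
  have p0 : p = 0 := by apply mul_right_cancel₀ e2; linarith
  have s0 : s = 0 := by apply mul_right_cancel₀ e2; linarith
  have rq : r = -q := by apply mul_right_cancel₀ e2; linarith
  refine ⟨q, ?_, ?_⟩
  · rw [← h2, p0, zero_smul, zero_add]
  · rw [← h3, s0, rq, zero_smul, add_zero, neg_smul]

/-- By Lagrange's identity the determinant of `X₊`, `X₋` in the first plane has square `(1 - c²)²`,
which is nonzero as `c ≠ ±1`; the coefficients come from Cramer's rule. -/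
lemma IsSpecialComponents.exists_decomposition
    (h : IsSpecialComponents g Jp Jm Xp Xm c b ε₁ x y x' y') (hε : ε₁ = 1 ∨ ε₁ = -1) (z : 𝔤) :
    ∃ r s : ℝ, ∃ w ∈ Submodule.span ℝ {b 2, b 3}, z = r • Xp + s • Xm + w := by
  have hc2 : 1 - c ^ 2 ≠ 0 := fun h0 => by
    have : (1 - c) * (1 + c) = 0 := by linear_combination h0
    rcases mul_eq_zero.1 this with h1 | h1
    · exact h.ne_one (by linarith)
    · exact h.ne_neg_one (by linarith)
  have e : ε₁ * ε₁ = 1 := by rcases hε with h | h <;> rw [h] <;> norm_num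
  have hdet : (x * y' - y * x') ^ 2 = (1 - c ^ 2) ^ 2 := by
    calc (x * y' - y * x') ^ 2 = (ε₁ * ε₁) * ((x ^ 2 + y ^ 2) * (x' ^ 2 + y' ^ 2)) := by
          rw [e]; linear_combination -(x * x' + y * y') * h.orthogonal
      _ = (ε₁ * (x ^ 2 + y ^ 2)) * (ε₁ * (x' ^ 2 + y' ^ 2)) := by ring
      _ = _ := by rw [h.norm_Xp, h.norm_Xm]; ring
  have hdet' : x * y' - y * x' ≠ 0 := fun h0 => by
    rw [h0] at hdet
    exact pow_ne_zero 2 hc2 (by rw [← hdet]; norm_num)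
  obtain ⟨r, s, e0, e1⟩ : ∃ r s : ℝ, b.repr z 0 = r * x + s * x' ∧ b.repr z 1 = r * y + s * y' := by
    refine ⟨(y' * b.repr z 0 - x' * b.repr z 1) / (x * y' - y * x'),
      (x * b.repr z 1 - y * b.repr z 0) / (x * y' - y * x'), ?_, ?_⟩ <;>
    · rw [div_mul_eq_mul_div, div_mul_eq_mul_div, ← add_div, eq_div_iff hdet']
      ring
  refine ⟨r, s, b.repr z 2 • b 2 + b.repr z 3 • b 3, Submodule.mem_span_pair.2 ⟨_, _, rfl⟩, ?_⟩
  rw [h.eq_Xp, h.eq_Xm]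
  conv_lhs => rw [basis_four_sum b z, e0, e1]
  module

/-- The relations for `J₊` are checked on the decomposition into `X₊`, `X₋` and the plane of `b 2`,
`b 3`, where `J₊` is prescribed. -/
lemma IsSpecialComponents.hermitianComponents
    (h : IsSpecialComponents g Jp Jm Xp Xm c b ε₁ x y x' y')
    (ho : IsOrthonormalFamily g b ![ε₁, ε₁, ε₂, ε₂]) : HermitianComponents g Jp Jm Xp Xm c := by
  have symm : ∀ x y, g x y = g y x := fun x y => by rw [ho.form_eq, ho.form_eq]; ring
  obtain ⟨⟨g00, g11, g22, g33⟩, ⟨g01, g02, g03, g12, g13, g23⟩,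
    ⟨g10, g20, g30, g21, g31, g32⟩⟩ := ho.values
  have npp : g Xp Xp = 1 - c ^ 2 := by
    rw [h.eq_Xp, ← h.norm_Xp]
    simp only [map_add, map_smul, LinearMap.add_apply, LinearMap.smul_apply, smul_eq_mul, g00, g11,
      g01, g10]
    ring
  have nmm : g Xm Xm = 1 - c ^ 2 := by
    rw [h.eq_Xm, ← h.norm_Xm]
    simp only [map_add, map_smul, LinearMap.add_apply, LinearMap.smul_apply, smul_eq_mul, g00, g11,
      g01, g10]
    ring
  have npm : g Xp Xm = 0 := by
    rw [h.eq_Xp, h.eq_Xm]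
    simp only [map_add, map_smul, LinearMap.add_apply, LinearMap.smul_apply, smul_eq_mul, g00, g11,
      g01, g10]
    linear_combination ε₁ * h.orthogonal
  have nmp : g Xm Xp = 0 := (symm _ _).trans npm
  have perp : ∀ w ∈ Submodule.span ℝ {b 2, b 3}, g Xp w = 0 ∧ g Xm w = 0 := fun w hw => by
    obtain ⟨r, s, rfl⟩ := Submodule.mem_span_pair.1 hw
    rw [h.eq_Xp, h.eq_Xm]
    simp [g02, g03, g12, g13]
  have perp' : ∀ w ∈ Submodule.span ℝ {b 2, b 3}, g w Xp = 0 ∧ g w Xm = 0 := fun w hw =>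
    ⟨(symm _ _).trans (perp w hw).1, (symm _ _).trans (perp w hw).2⟩
  have dec := h.exists_decomposition (ho.1 0)
  refine ⟨symm, ho.nondegenerate, fun z => ?_, skew_of_basis (b := b) ?_, fun z w => ?_, h.Jp_Xp,
    h.Jp_Xm, npp, nmm, npm, fun z => ?_⟩
  · have : Jm ∘ₗ Jm = -LinearMap.id := by
      refine b.ext (forall_fin_four ?_ ?_ ?_ ?_) <;>
        simp [h.Jm_zero, h.Jm_one, h.Jm_two, h.Jm_three]
    exact DFunLike.congr_fun this z
  · refine forall_fin_four ?_ ?_ ?_ ?_ <;> refine forall_fin_four ?_ ?_ ?_ ?_ <;>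
    simp only [h.Jm_zero, h.Jm_one, h.Jm_two, h.Jm_three, map_neg, LinearMap.neg_apply, g00, g11,
      g22, g33, g01, g02, g03, g12, g13, g23, g10, g20, g30, g21, g31, g32, neg_zero, neg_neg]
  · obtain ⟨r, s, z', hz', rfl⟩ := dec z
    obtain ⟨r', s', w', hw', rfl⟩ := dec w
    obtain ⟨hJz, -, hs⟩ := h.Jp_span z' hz'
    obtain ⟨hJw, -, -⟩ := h.Jp_span w' hw'
    simp only [map_add, map_smul, h.Jp_Xp, h.Jp_Xm, map_neg, LinearMap.add_apply,
      LinearMap.smul_apply, LinearMap.neg_apply, smul_eq_mul, npp, nmm, npm, nmp, perp _ hw',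
      perp _ hJw, perp' _ hz', perp' _ hJz, hs w' hw']
    ring
  · obtain ⟨r, s, w, hw, rfl⟩ := dec z
    obtain ⟨hJw, hJ2, -⟩ := h.Jp_span w hw
    simp only [map_add, map_smul, map_neg, h.Jp_Xp, h.Jp_Xm, hJ2, smul_eq_mul, npp, nmm, npm, nmp,
      perp _ hw]
    module

/-- On the plane of `b 2`, `b 3` both `J₋` and `J₊` are multiples of the rotation; the complementary
plane is invariant under both and annihilated by the rotation. -/
lemma IsSpecialComponents.planeRotation_comm
    (h : IsSpecialComponents g Jp Jm Xp Xm c b ε₁ x y x' y')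
    (ho : IsOrthonormalFamily g b ![ε₁, ε₁, ε₂, ε₂]) :
    (∀ z, planeRotation b (Jm z) = Jm (planeRotation b z)) ∧
      (∀ z, planeRotation b (Jp z) = Jp (planeRotation b z)) ∧ planeRotation b Xm = 0 := by
  obtain ⟨k0, k1, k2, k3⟩ := planeRotation_basis b
  have kp : planeRotation b Xp = 0 := by rw [h.eq_Xp]; simp [k0, k1]
  have km : planeRotation b Xm = 0 := by rw [h.eq_Xm]; simp [k0, k1]
  refine ⟨fun z => ?_, fun z => ?_, km⟩
  · have : planeRotation b ∘ₗ Jm = Jm ∘ₗ planeRotation b := by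
      refine b.ext (forall_fin_four ?_ ?_ ?_ ?_) <;>
        simp [h.Jm_zero, h.Jm_one, h.Jm_two, h.Jm_three, k0, k1, k2, k3]
    exact DFunLike.congr_fun this z
  · obtain ⟨d, d2, d3⟩ := h.Jp_plane ho
    obtain ⟨r, s, w, hw, rfl⟩ := h.exists_decomposition (ho.1 0) z
    obtain ⟨p, q, rfl⟩ := Submodule.mem_span_pair.1 hw
    simp [h.Jp_Xp, h.Jp_Xm, kp, km, k2, k3, d2, d3]

/-- The ideal of a special basis is spanned by the last three vectors. -/
lemma IsSpecialBasis.repr_zero_of_mem (h : IsSpecialBasis 𝔲 𝔤₀ g b ε₁ ε₂ l β)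
    (hcompl : IsCompl 𝔲 𝔤₀.toSubmodule) {z : 𝔤} (hz : z ∈ 𝔤₀) : b.repr z 0 = 0 := by
  by_contra h0
  have h1 : b.repr z 0 • b 0 ∈ 𝔤₀ := by
    have : b.repr z 0 • b 0 = z - b.repr z 1 • b 1 - b.repr z 2 • b 2 - b.repr z 3 • b 3 := by
      conv_rhs => enter [1, 1, 1]; rw [basis_four_sum b z]
      abel
    rw [this]
    exact sub_mem (sub_mem (sub_mem hz (𝔤₀.toSubmodule.smul_mem _ h.mem_e₁))
      (𝔤₀.toSubmodule.smul_mem _ h.mem_e₂)) (𝔤₀.toSubmodule.smul_mem _ h.mem_e₃)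
  have h2 : b 0 ∈ 𝔤₀.toSubmodule := by
    have := 𝔤₀.toSubmodule.smul_mem (b.repr z 0)⁻¹ h1
    rwa [smul_smul, inv_mul_cancel₀ h0, one_smul] at this
  exact b.ne_zero 0 (Submodule.disjoint_def.1 hcompl.disjoint _ h.mem_u h2)

/-- The cross product of a three-dimensional oriented vector space with an orthonormal basis. -/
def crossOfBasis {V : Type*} [AddCommGroup V] [Module ℝ V] (v : Module.Basis (Fin 3) ℝ V)
    (δ : Fin 3 → ℝ) : V →ₗ[ℝ] V →ₗ[ℝ] V :=
  LinearMap.mk₂ ℝ (fun x y =>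
      (δ 0 * (v.repr x 1 * v.repr y 2 - v.repr x 2 * v.repr y 1)) • v 0
    + (δ 1 * (v.repr x 2 * v.repr y 0 - v.repr x 0 * v.repr y 2)) • v 1
    + (δ 2 * (v.repr x 0 * v.repr y 1 - v.repr x 1 * v.repr y 0)) • v 2)
    (fun x x' y => by simp only [map_add, Finsupp.add_apply]; module)
    (fun r x y => by simp only [map_smul, Finsupp.smul_apply, smul_eq_mul]; module)
    (fun x y y' => by simp only [map_add, Finsupp.add_apply]; module)
    (fun r x y => by simp only [map_smul, Finsupp.smul_apply, smul_eq_mul]; module)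

lemma IsOrthonormalFamily.crossOfBasis_eq {V : Type*} [AddCommGroup V] [Module ℝ V]
    {g : LinearMap.BilinForm ℝ V} {v : Module.Basis (Fin 3) ℝ V} {δ : Fin 3 → ℝ}
    (h : IsOrthonormalFamily g v δ) (x y z : V) :
    g (crossOfBasis v δ x y) z = v.det ![x, y, z] := by
  have e : ∀ i, g (v i) z = δ i * v.repr z i := fun i => by
    conv_lhs => rw [← v.sum_repr z, map_sum]
    rw [Finset.sum_eq_single i]
    · rw [map_smul, h.2.1, smul_eq_mul, mul_comm]
    · intro j _ hj
      rw [map_smul, h.2.2 i j hj.symm, smul_zero]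
    · simp
  have s0 := h.sign_mul_self 0
  have s1 := h.sign_mul_self 1
  have s2 := h.sign_mul_self 2
  rw [Module.Basis.det_apply, Matrix.det_fin_three]
  simp only [crossOfBasis, LinearMap.mk₂_apply, map_add, map_smul, LinearMap.add_apply,
    LinearMap.smul_apply, e, smul_eq_mul, Module.Basis.toMatrix_apply, Matrix.cons_val]
  linear_combination (v.repr z 0 * (v.repr x 1 * v.repr y 2 - v.repr x 2 * v.repr y 1)) * s0
    + (v.repr z 1 * (v.repr x 2 * v.repr y 0 - v.repr x 0 * v.repr y 2)) * s1
    + (v.repr z 2 * (v.repr x 0 * v.repr y 1 - v.repr x 1 * v.repr y 0)) * s2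

lemma IsSpecialBasis.isAdapted (h : IsSpecialBasis 𝔲 𝔤₀ g b ε₁ ε₂ l β)
    (hC : IsSpecialComponents g Jp Jm Xp Xm c b ε₁ x y x' y')
    (hdim𝔲 : Module.finrank ℝ 𝔲 = 1) (hdim𝔤₀ : Module.finrank ℝ 𝔤₀ = 3)
    (hcompl : IsCompl 𝔲 𝔤₀.toSubmodule) : IsAdapted 𝔲 𝔤₀ g Jm Xp Xm := by
  have ho := h.orthonormal
  have hH := hC.hermitianComponents ho
  obtain ⟨⟨g00, g11, g22, g33⟩, ⟨g01, g02, g03, g12, g13, g23⟩,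
    ⟨g10, g20, g30, g21, g31, g32⟩⟩ := ho.values
  have e1 : ε₁ ≠ 0 := by rcases ho.1 0 with h | h <;> simp at h <;> rw [h] <;> norm_num
  have hu : ∀ z ∈ 𝔲, ∃ t : ℝ, z = t • b 0 := by
    have hb : (⟨b 0, h.mem_u⟩ : 𝔲) ≠ 0 := fun h0 => b.ne_zero 0 (congrArg Subtype.val h0)
    intro z hz
    obtain ⟨t, ht⟩ := (finrank_eq_one_iff_of_nonzero' _ hb).1 hdim𝔲 ⟨z, hz⟩
    exact ⟨t, (congrArg Subtype.val ht).symm⟩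
  have hc2 : 1 - c ^ 2 ≠ 0 := fun h0 => by
    have : (1 - c) * (1 + c) = 0 := by linear_combination h0
    rcases mul_eq_zero.1 this with h1 | h1
    · exact hC.ne_one (by linarith)
    · exact hC.ne_neg_one (by linarith)
  refine ⟨fun z hz w hw => ?_, ?_, fun z hz hne => ?_, ?_, ?_⟩
  · obtain ⟨t, rfl⟩ := hu z hz
    rw [basis_four_sum b w, h.repr_zero_of_mem hcompl hw]
    simp [g01, g02, g03]
  · have ho' : IsOrthonormalFamily (restrictTo 𝔤₀ g)
        ![(⟨b 1, h.mem_e₁⟩ : 𝔤₀), ⟨b 2, h.mem_e₂⟩, ⟨b 3, h.mem_e₃⟩] ![ε₁, ε₂, ε₂] := by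
      refine ⟨fun i => ?_, fun i => ?_, fun i j hij => ?_⟩
      · fin_cases i
        exacts [ho.1 0, ho.1 2, ho.1 2]
      · fin_cases i
        exacts [g11, g22, g33]
      · fin_cases i <;> fin_cases j <;> first | exact absurd rfl hij | skip
        exacts [g12, g13, g21, g23, g31, g32]
    obtain ⟨v, hv⟩ := ho'.exists_basis (by simp [hdim𝔤₀])
    have v0 : v 0 = ⟨b 1, h.mem_e₁⟩ := congrFun hv 0
    have v1 : v 1 = ⟨b 2, h.mem_e₂⟩ := congrFun hv 1
    have v2 : v 2 = ⟨b 3, h.mem_e₃⟩ := congrFun hv 2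
    rw [← hv] at ho'
    -- `[e₂,e₃] = 0` puts `e₁` in the kernel of the canonical operator, and the factor `ε₂` in the
    -- other two brackets is the sign in the cross product, leaving the eigenvalue `l` twice. As
    -- `J₋u = e₁`, the required eigenvalue is 0.
    let L : Module.End ℝ 𝔤₀ := v.constr ℝ ![0, l • v 1, l • v 2]
    have L0 : L (v 0) = 0 := v.constr_basis ℝ _ _
    have L1 : L (v 1) = l • v 1 := v.constr_basis ℝ _ _
    have L2 : L (v 2) = l • v 2 := v.constr_basis ℝ _ _
    have b01 : ⁅v 0, v 1⁆ = (ε₂ * l) • v 2 := by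
      rw [v0, v1, v2]; exact Subtype.ext h.e₁_e₂
    have b12 : ⁅v 1, v 2⁆ = 0 := by
      rw [v1, v2]; exact Subtype.ext h.e₂_e₃
    have b20 : ⁅v 2, v 0⁆ = (ε₂ * l) • v 1 := by
      rw [v0, v1, v2]; exact Subtype.ext h.e₃_e₁
    have b10 : ⁅v 1, v 0⁆ = -((ε₂ * l) • v 2) := by rw [← lie_skew, b01]
    have b21 : ⁅v 2, v 1⁆ = 0 := by rw [← lie_skew, b12, neg_zero]
    have b02 : ⁅v 0, v 2⁆ = -((ε₂ * l) • v 1) := by rw [← lie_skew, b20]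
    refine ⟨L, ⟨v, _, crossOfBasis v ![ε₁, ε₂, ε₂], ho', ho'.crossOfBasis_eq, fun z w => ?_⟩,
      ⟨Fin 3, v, fun i => ?_⟩, 0, fun z hz => ?_⟩
    · have hz : z = v.repr z 0 • v 0 + v.repr z 1 • v 1 + v.repr z 2 • v 2 := by
        conv_lhs => rw [← v.sum_repr z, Fin.sum_univ_three]
      have hw : w = v.repr w 0 • v 0 + v.repr w 1 • v 1 + v.repr w 2 • v 2 := by
        conv_lhs => rw [← v.sum_repr w, Fin.sum_univ_three]
      have lhs : ⁅z, w⁆ = (ε₂ * (v.repr z 2 * v.repr w 0 - v.repr z 0 * v.repr w 2)) • l • v 1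
          + (ε₂ * (v.repr z 0 * v.repr w 1 - v.repr z 1 * v.repr w 0)) • l • v 2 := by
        conv_lhs => rw [hz, hw]
        simp only [add_lie, lie_add, smul_lie, lie_smul, lie_self, b01, b12, b20, b10, b21, b02]
        module
      rw [lhs]
      simp only [crossOfBasis, LinearMap.mk₂_apply, map_add, map_smul, L0, L1, L2, smul_zero,
        zero_add, Matrix.cons_val]
    · fin_cases i
      exacts [⟨0, by rw [zero_smul]; exact L0⟩, ⟨l, L1⟩, ⟨l, L2⟩]
    · obtain ⟨t, rfl⟩ := hu z hz
      refine ⟨t • v 0, ?_, ?_⟩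
      · rw [map_smul, hC.Jm_zero, v0]; rfl
      · rw [map_smul, L0, smul_zero, zero_smul]
  · obtain ⟨t, rfl⟩ := hu z hz
    have ht : t ≠ 0 := fun h0 => hne (by rw [h0, zero_smul])
    rw [map_smul, map_smul, LinearMap.smul_apply, g00]
    exact mul_ne_zero ht (mul_ne_zero ht e1)
  · rwa [hH.norm_Xp]
  · rwa [hH.norm_Xm]

/-- Every special basis carries components of an adapted structure. -/
lemma IsSpecialBasis.exists_components (h : IsSpecialBasis 𝔲 𝔤₀ g b ε₁ ε₂ l β) :
    ∃ (Jp Jm : Module.End ℝ 𝔤) (Xp Xm : 𝔤) (c x y x' y' : ℝ),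
      IsSpecialComponents g Jp Jm Xp Xm c b ε₁ x y x' y' := by
  -- The sign of `1 - c²` must be `ε₁`: `c = 1/2` serves for `ε₁ = 1` and `c = 2` for `ε₁ = -1`.
  -- Then `X₊ = x u` and `X₋ = x e₁`.
  obtain ⟨c, x, h0, h1, h2, hx⟩ : ∃ c x : ℝ, c ≠ -1 ∧ c ≠ 0 ∧ c ≠ 1 ∧ ε₁ * x ^ 2 = 1 - c ^ 2 := by
    have hε := h.orthonormal.1 0
    simp only [Matrix.cons_val] at hε
    rcases hε with rfl | rfl
    · refine ⟨1 / 2, Real.sqrt (3 / 4), by norm_num, by norm_num, by norm_num, ?_⟩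
      rw [Real.sq_sqrt (by norm_num)]; norm_num
    · refine ⟨2, Real.sqrt 3, by norm_num, by norm_num, by norm_num, ?_⟩
      rw [Real.sq_sqrt (by norm_num)]; norm_num
  obtain ⟨⟨g00, g11, g22, g33⟩, ⟨g01, g02, g03, g12, g13, g23⟩,
    ⟨g10, g20, g30, g21, g31, g32⟩⟩ := h.orthonormal.values
  let Jm : Module.End ℝ 𝔤 := b.constr ℝ ![b 1, -b 0, b 3, -b 2]
  -- On the first plane `J₊` is forced by its values on `X₊` and `X₋`; on the second the rotation is
  -- one possible choice.
  let Jp : Module.End ℝ 𝔤 := b.constr ℝ ![-(c • b 1), c • b 0, b 3, -b 2]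
  have p0 : Jp (b 0) = -(c • b 1) := b.constr_basis ℝ _ _
  have p1 : Jp (b 1) = c • b 0 := b.constr_basis ℝ _ _
  have p2 : Jp (b 2) = b 3 := b.constr_basis ℝ _ _
  have p3 : Jp (b 3) = -b 2 := b.constr_basis ℝ _ _
  refine ⟨Jp, Jm, x • b 0 + (0 : ℝ) • b 1, (0 : ℝ) • b 0 + x • b 1, c, x, 0, 0, x, rfl, rfl, ?_,
    ?_, by ring, h0, h1, h2, b.constr_basis ℝ _ _, b.constr_basis ℝ _ _, b.constr_basis ℝ _ _,
    b.constr_basis ℝ _ _, ?_, ?_, fun z hz => ?_⟩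
  · rw [← hx]; ring
  · rw [← hx]; ring
  · simp only [map_add, map_smul, p0, p1]; module
  · simp only [map_add, map_smul, p0, p1]; module
  · obtain ⟨r, s, rfl⟩ := Submodule.mem_span_pair.1 hz
    refine ⟨Submodule.mem_span_pair.2 ⟨-s, r, ?_⟩, ?_, fun w hw => ?_⟩
    · simp only [map_add, map_smul, p2, p3]; module
    · simp only [map_add, map_smul, map_neg, p2, p3]; module
    · obtain ⟨r', s', rfl⟩ := Submodule.mem_span_pair.1 hw
      simp only [map_add, map_smul, map_neg, p2, p3, LinearMap.add_apply, LinearMap.smul_apply,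
        LinearMap.neg_apply, smul_eq_mul, g22, g33, g23, g32]
      ring

end SpecialBasis

/-! ### Sufficiency: every special basis with such components gives an adapted structure. -/

section Sufficiency

variable {n : ℕ} {G : Type*} [TopologicalSpace G] [ChartedSpace (EuclideanSpace ℝ (Fin n)) G]
  [Group G] [LieGroup (𝓡 n) ∞ G] {𝔲 : Submodule ℝ (GroupLieAlgebra (𝓡 n) G)}
  {𝔤₀ : LieIdeal ℝ (GroupLieAlgebra (𝓡 n) G)}
  {g : LinearMap.BilinForm ℝ (GroupLieAlgebra (𝓡 n) G)}
  {Jp Jm : Module.End ℝ (GroupLieAlgebra (𝓡 n) G)} {Xp Xm : GroupLieAlgebra (𝓡 n) G}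
  {b : Module.Basis (Fin 4) ℝ (GroupLieAlgebra (𝓡 n) G)} {c ε₁ ε₂ l β x y x' y' : ℝ}

lemma IsSpecialBasis.isAdaptedPseudoKahler (hn : Even n)
    (h : IsSpecialBasis 𝔲 𝔤₀ g b ε₁ ε₂ l β)
    (hC : IsSpecialComponents g Jp Jm Xp Xm c b ε₁ x y x' y')
    (hdim𝔲 : Module.finrank ℝ 𝔲 = 1) (hdim𝔤₀ : Module.finrank ℝ 𝔤₀ = 3)
    (hcompl : IsCompl 𝔲 𝔤₀.toSubmodule) :
    IsAdaptedPseudoKahler 𝔲 𝔤₀ 0 0 g Jp Jm Xp Xm c := by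
  obtain ⟨hm, hp, hX⟩ := hC.planeRotation_comm h.orthonormal
  exact ⟨isTwist_zero, (hC.hermitianComponents h.orthonormal).exists_isPseudoKahler hn
    h.orthonormal.planeRotation_skew hm hp hX h.lie_eq, h.isAdapted hC hdim𝔲 hdim𝔤₀ hcompl⟩

end Sufficiency

end BnGeometry

end

theorem mainTheorem12 {G : Type*} [TopologicalSpace G]
    [ChartedSpace (EuclideanSpace ℝ (Fin 4)) G] [Group G] [LieGroup (𝓡 4) ∞ G]
    (𝔲 : Submodule ℝ (GroupLieAlgebra (𝓡 4) G)) (𝔤₀ : LieIdeal ℝ (GroupLieAlgebra (𝓡 4) G))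
    (hdim𝔲 : Module.finrank ℝ 𝔲 = 1) (hdim𝔤₀ : Module.finrank ℝ 𝔤₀ = 3)
    (hcompl : IsCompl 𝔲 𝔤₀.toSubmodule)
    (hunimodular : IsUnimodular 𝔤₀) (hnonabelian : ¬ IsLieAbelian 𝔤₀) :
    (∀ g : LinearMap.BilinForm ℝ (GroupLieAlgebra (𝓡 4) G),
      (∃ (H : (GroupLieAlgebra (𝓡 4) G) [⋀^Fin 3]→ₗ[ℝ] ℝ)
          (F : (GroupLieAlgebra (𝓡 4) G) [⋀^Fin 2]→ₗ[ℝ] ℝ)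
          (Jp Jm : Module.End ℝ (GroupLieAlgebra (𝓡 4) G))
          (Xp Xm : GroupLieAlgebra (𝓡 4) G) (c : ℝ),
          IsAdaptedPseudoKahler 𝔲 𝔤₀ H F g Jp Jm Xp Xm c ∧ c ≠ 0) ↔
        ∃ (b : Module.Basis (Fin 4) ℝ (GroupLieAlgebra (𝓡 4) G)) (ε₁ ε₂ l β : ℝ),
          IsSpecialBasis 𝔲 𝔤₀ g b ε₁ ε₂ l β) ∧
    (∀ (H : (GroupLieAlgebra (𝓡 4) G) [⋀^Fin 3]→ₗ[ℝ] ℝ)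
        (F : (GroupLieAlgebra (𝓡 4) G) [⋀^Fin 2]→ₗ[ℝ] ℝ)
        (g : LinearMap.BilinForm ℝ (GroupLieAlgebra (𝓡 4) G))
        (Jp Jm : Module.End ℝ (GroupLieAlgebra (𝓡 4) G))
        (Xp Xm : GroupLieAlgebra (𝓡 4) G) (c : ℝ),
      (IsAdaptedPseudoKahler 𝔲 𝔤₀ H F g Jp Jm Xp Xm c ∧ c ≠ 0) ↔
        ∃ (b : Module.Basis (Fin 4) ℝ (GroupLieAlgebra (𝓡 4) G))
          (ε₁ ε₂ l β x y x' y' : ℝ),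
          IsSpecialBasis 𝔲 𝔤₀ g b ε₁ ε₂ l β ∧
          Xp = x • b 0 + y • b 1 ∧ Xm = x' • b 0 + y' • b 1 ∧
          ε₁ * (x ^ 2 + y ^ 2) = 1 - c ^ 2 ∧ ε₁ * (x' ^ 2 + y' ^ 2) = 1 - c ^ 2 ∧
          x * x' + y * y' = 0 ∧
          c ≠ -1 ∧ c ≠ 0 ∧ c ≠ 1 ∧
          Jm (b 0) = b 1 ∧ Jm (b 1) = - b 0 ∧ Jm (b 2) = b 3 ∧ Jm (b 3) = - b 2 ∧
          Jp Xp = -(c • Xm) ∧ Jp Xm = c • Xp ∧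
          (∀ z ∈ Submodule.span ℝ {b 2, b 3},
            Jp z ∈ Submodule.span ℝ {b 2, b 3} ∧ Jp (Jp z) = - z ∧
            ∀ w ∈ Submodule.span ℝ {b 2, b 3}, g (Jp z) w = - g z (Jp w)) ∧
          H = 0 ∧ F = 0) := by
  have necessity : ∀ {H : (GroupLieAlgebra (𝓡 4) G) [⋀^Fin 3]→ₗ[ℝ] ℝ}
      {F : (GroupLieAlgebra (𝓡 4) G) [⋀^Fin 2]→ₗ[ℝ] ℝ}
      {g : LinearMap.BilinForm ℝ (GroupLieAlgebra (𝓡 4) G)}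
      {Jp Jm : Module.End ℝ (GroupLieAlgebra (𝓡 4) G)}
      {Xp Xm : GroupLieAlgebra (𝓡 4) G} {c : ℝ},
      IsAdaptedPseudoKahler 𝔲 𝔤₀ H F g Jp Jm Xp Xm c → c ≠ 0 →
      ∃ (b : Module.Basis (Fin 4) ℝ (GroupLieAlgebra (𝓡 4) G)) (ε₁ ε₂ l β x y x' y' : ℝ),
        IsSpecialBasis 𝔲 𝔤₀ g b ε₁ ε₂ l β ∧ IsSpecialComponents g Jp Jm Xp Xm c b ε₁ x y x' y' ∧
          H = 0 ∧ F = 0 := fun h hc =>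
    (h.tensorIdentities (by decide)).exists_specialBasis hc h.adapted hdim𝔲 hdim𝔤₀ hcompl
      hunimodular hnonabelian
  refine ⟨fun g => ⟨?_, ?_⟩, fun H F g Jp Jm Xp Xm c => ⟨?_, ?_⟩⟩
  · rintro ⟨H, F, Jp, Jm, Xp, Xm, c, h, hc⟩
    obtain ⟨b, ε₁, ε₂, l, β, -, -, -, -, hb, -⟩ := necessity h hc
    exact ⟨b, ε₁, ε₂, l, β, hb⟩
  · rintro ⟨b, ε₁, ε₂, l, β, hb⟩
    obtain ⟨Jp, Jm, Xp, Xm, c, x, y, x', y', hC⟩ := hb.exists_components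
    exact ⟨0, 0, Jp, Jm, Xp, Xm, c,
      hb.isAdaptedPseudoKahler (by decide) hC hdim𝔲 hdim𝔤₀ hcompl, hC.ne_zero⟩
  · rintro ⟨h, hc⟩
    obtain ⟨b, ε₁, ε₂, l, β, x, y, x', y', hb, hC, hH, hF⟩ := necessity h hc
    exact ⟨b, ε₁, ε₂, l, β, x, y, x', y', hb, hC.eq_Xp, hC.eq_Xm, hC.norm_Xp, hC.norm_Xm,
      hC.orthogonal, hC.ne_neg_one, hC.ne_zero, hC.ne_one, hC.Jm_zero, hC.Jm_one, hC.Jm_two,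
      hC.Jm_three, hC.Jp_Xp, hC.Jp_Xm, hC.Jp_span, hH, hF⟩
  · rintro ⟨b, ε₁, ε₂, l, β, x, y, x', y', hb, h1, h2, h3, h4, h5, h6, h7, h8, h9, h10, h11, h12,
      h13, h14, h15, rfl, rfl⟩
    exact ⟨hb.isAdaptedPseudoKahler (by decide)
      ⟨h1, h2, h3, h4, h5, h6, h7, h8, h9, h10, h11, h12, h13, h14, h15⟩ hdim𝔲 hdim𝔤₀ hcompl, h7⟩
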